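/- \textbf{Setting.} Let $\Omega=(0,1)$, $L>0$, and let $\|v\|_{H^2}^2=\sum_{j\le 2}\|\partial_x^j v\|_{L^2(\Omega)}^2$ (weak derivatives). Let $H^m_{per}$ be the space of $v\in H^m(\Omega)$ with $\partial_x^kv(0)=\partial_x^kv(1)$ for $k<m$. Let $\mathcal C$ be any constant with $\|vw\|_{H^2}\le\mathcal C\|v\|_{H^2}\|w\|_{H^2}$ for all real $v,w\in H^2_{per}$; $\mathcal C=33.02$ is such a constant. For real coefficients $a_l,b_{kl}$ consider $$\partial_t u=\mathcal L[u]+\mathcal Q[u]+f,\qquad \mathcal L[u]=\sum_{l=0}^d\frac{a_l}{L^l}\partial_x^l u,\qquad \mathcal Q[u]=\sum_{0\le k\le l\le d}\frac{b_{kl}}{L^{k+l}}\,\partial_x^ku\,\partial_x^lu .$$ A solution is a real function $u$ on $\Omega\times[0,\infty)$ with $u(t)\in H^{d+2}(\Omega)$, $u(0,t)=0$ and $\partial_x^ku(0,t)=\partial_x^ku(1,t)$ for $0\le k\le d$ and all $t\ge0$, such that $t\mapsto u(t)\in H^2(\Omega)$ is continuous at $t=0$ and satisfies the equation as a differentiable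 $H^2(\Omega)$-valued map for $t>0$. The forcing satisfies $f(t)\in H^2_{per}$ and $f_{\max}=\sup_{t\ge0}\|f(t)\|_{H^2}<\infty$. A solution $u$ is \emph{trajectory-based asymptotically stable} if for every $\varepsilon>0$ there is $\delta_\varepsilon>0$ such that every solution $\tilde u$ (same equation, same $f$) with $\|u(0)-\tilde u(0)\|_{H^2}<\delta_\varepsilon$ satisfies $\|u(t)-\tilde u(t)\|_{H^2}<\varepsilon$ for all $t\ge 0$, and if moreover $\|u(t)-\tilde u(t)\|_{H^2}\to0$ as $t\to\infty$ for all solutions $\tilde u$ with $\|u(0)-\tilde u(0)\|_{H^2}$ small enough. Put $y_0=\|u(0)\|_{H^2}$, $\mu=\mathcal C\sum_{0\le k\le l\le d}|b_{kl}|/L^{k+l}$, $\beta=-\sup_{k\ne0}\lambda_k$, where $\lambda_k$ $(k\in\mathbb Z)$ are the eigenvalues of $\mathcal L$ for the eigenfunctions $e^{2\pi ikx}$, $\mathcal R=\frac{f_{\max}+\mu y_0^2}{\beta y_0}$, $\mathcal R^*=\frac{2\mu y_0}{\beta}$ and $v=\frac{f_{\max}+\mu y_0^2}{y_0}$. \textbf{Claim.}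 In each of the three cases below, $\mathcal L$ with domain $H^d_{per}$ is self-adjoint in $L^2(\Omega)$, its spectrum is $\{\lambda_k:k\in\mathbb Z\}$, the supremum in $\beta$ is attained, and $\lambda_k$, $\beta>0$ and $\mu$ have the stated values. (1) Forced Burgers equation $\partial_tu=-\frac1L u\,\partial_xu+\frac{\nu}{L^2}\partial_x^2u+f$ with $\nu>0$ ($d=2$): $\lambda_k=-\nu\left(\frac{2\pi k}L\right)^2$, $\beta=\nu\left(\frac{2\pi}L\right)^2$, $\mu=\frac{\mathcal C}L$. If $y_0>0$, then $\mathcal R<1$ and $\mathcal R^*<1$ are equivalent to, respectively, $$\frac{vL^2}{\nu}<(2\pi)^2,\qquad \frac{2\mathcal C y_0L}{\nu}<(2\pi)^2 ,$$ the first of which is also equivalent to $Re:=\frac{vL}{\nu}<\frac{(2\pi)^2}{L}$; and under these two conditions $u$ is trajectory-based asymptotically stable. (2) KPP--Fisher equation $\partial_tu=\frac{D}{L^2}\partial_x^2u+r_1u-r_2u^2$ with $D>0$, $r_1<0$, $r_2\in\mathbb R$ ($d=2$, $f=0$): $\lambda_k=r_1-D\left(\frac{2\pi k}L\right)^2$,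 $\beta=D\left(\frac{2\pi}L\right)^2-r_1$, $\mu=\mathcal C|r_2|$. If $$\mathcal R=\frac{|r_2|\,\mathcal C y_0}{D(2\pi/L)^2-r_1}<1,\qquad \mathcal R^*=\frac{2|r_2|\,\mathcal C y_0}{D(2\pi/L)^2-r_1}<1,$$ then $u$ is trajectory-based asymptotically stable. (3) Generalized Kuramoto--Sivashinsky equation $\partial_tu=\frac{a}{L^2}\partial_x^2u+\frac{b}{L^4}\partial_x^4u+\frac cL u\,\partial_xu$ with $b<0$, $a>\left(\frac{2\pi}L\right)^2b$, $c\in\mathbb R$ ($d=4$, $f=0$): $\lambda_k=-a\left(\frac{2\pi k}L\right)^2+b\left(\frac{2\pi k}L\right)^4$, $\beta=a\left(\frac{2\pi}L\right)^2-b\left(\frac{2\pi}L\right)^4$, $\mu=\frac{\mathcal C|c|}L$. If $$\mathcal R=\frac{|c|\,\mathcal C y_0}{L\left(a(2\pi/L)^2-b(2\pi/L)^4\right)}<1,\qquad \mathcal R^*=\frac{2|c|\,\mathcal C y_0}{L\left(a(2\pi/L)^2-b(2\pi/L)^4\right)}<1,$$ then $u$ is trajectory-based asymptotically stable. -/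

import Mathlib

open Set Filter Topology MeasureTheory

noncomputable section

namespace QuadPDE

/-- Lebesgue measure on the open unit interval `Ω = (0,1)`. -/
def unitMeasure : Measure ℝ := volume.restrict (Ioo (0 : ℝ) 1)

/-- `g` is a weak derivative of `v` on `(0,1)`, tested against smooth functions with compact
support in `(0,1)`. -/
def HasWeakDeriv (v g : ℝ → ℝ) : Prop :=
  ∀ φ : ℝ → ℝ, ContDiff ℝ (⊤ : ℕ∞) φ → HasCompactSupport φ → tsupport φ ⊆ Ioo (0 : ℝ) 1 →
    ∫ x, v x * deriv φ x ∂unitMeasure = -∫ x, g x * φ x ∂unitMeasure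

/-- The Sobolev space `H^m(0,1)`: the weak derivatives up to order `m` exist and lie in `L²`. -/
def MemSobolev : ℕ → (ℝ → ℝ) → Prop
  | 0, v => MemLp v 2 unitMeasure
  | m + 1, v => MemLp v 2 unitMeasure ∧ ∃ g, HasWeakDeriv v g ∧ MemSobolev m g

open Classical in
/-- The weak derivative in `L²(0,1)` (unique up to null sets); zero if there is none. -/
def weakDeriv (v : ℝ → ℝ) : ℝ → ℝ :=
  if h : ∃ g, MemLp g 2 unitMeasure ∧ HasWeakDeriv v g then h.choose else 0

/-- The `H²(0,1)` norm. -/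
def h2norm (v : ℝ → ℝ) : ℝ :=
  Real.sqrt (∑ j ∈ Finset.range 3, ∫ x, (weakDeriv^[j] v x) ^ 2 ∂unitMeasure)

/-- `v` has a continuous representative on `[0,1]` which takes the same value at both ends. -/
def PeriodicTrace (v : ℝ → ℝ) : Prop :=
  ∃ c : ℝ → ℝ, ContinuousOn c (Icc 0 1) ∧ v =ᵐ[unitMeasure] c ∧ c 0 = c 1

/-- `v` has a continuous representative on `[0,1]` which vanishes at `0`. -/
def ZeroTrace (v : ℝ → ℝ) : Prop :=
  ∃ c : ℝ → ℝ, ContinuousOn c (Icc 0 1) ∧ v =ᵐ[unitMeasure] c ∧ c 0 = 0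

/-- The periodic Sobolev space `H^m_per(0,1)`. -/
def MemPeriodicSobolev (m : ℕ) (v : ℝ → ℝ) : Prop :=
  MemSobolev m v ∧ ∀ k < m, PeriodicTrace (weakDeriv^[k] v)

/-- `C` is a Banach algebra constant: `‖v w‖_{H²} ≤ C ‖v‖_{H²} ‖w‖_{H²}` for periodic `v, w`. -/
def IsAlgebraConstant (C : ℝ) : Prop :=
  ∀ v w : ℝ → ℝ, MemPeriodicSobolev 2 v → MemPeriodicSobolev 2 w →
    h2norm (fun x => v x * w x) ≤ C * h2norm v * h2norm w

/-- The linear part `∑_{l ≤ d} L^{-l} a_l ∂ₓ^l v`. -/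
def linOp (d : ℕ) (a : ℕ → ℝ) (L : ℝ) (v : ℝ → ℝ) (x : ℝ) : ℝ :=
  ∑ l ∈ Finset.range (d + 1), 1 / L ^ l * a l * weakDeriv^[l] v x

/-- The quadratic part `∑_{0 ≤ k ≤ l ≤ d} L^{-(k+l)} b_{kl} ∂ₓ^k v ∂ₓ^l v`. -/
def quadOp (d : ℕ) (b : ℕ → ℕ → ℝ) (L : ℝ) (v : ℝ → ℝ) (x : ℝ) : ℝ :=
  ∑ l ∈ Finset.range (d + 1), ∑ k ∈ Finset.range (l + 1),
    1 / L ^ (k + l) * b k l * weakDeriv^[k] v x * weakDeriv^[l] v x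

/-- The parameter `μ = C ∑_{0 ≤ k ≤ l ≤ d} L^{-(k+l)} |b_{kl}|`. -/
def muParam (C : ℝ) (d : ℕ) (b : ℕ → ℕ → ℝ) (L : ℝ) : ℝ :=
  C * ∑ l ∈ Finset.range (d + 1), ∑ k ∈ Finset.range (l + 1), 1 / L ^ (k + l) * |b k l|

/-- The linear part, as an operator in `L²(0,1)` with domain `H^d_per(0,1)`, equals its adjoint. -/
def IsSelfAdjointLin (d : ℕ) (a : ℕ → ℝ) (L : ℝ) : Prop :=
  ∀ w g : ℝ → ℝ, MemLp w 2 unitMeasure → MemLp g 2 unitMeasure →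
    ((∀ v, MemPeriodicSobolev d v →
        ∫ x, linOp d a L v x * w x ∂unitMeasure = ∫ x, v x * g x ∂unitMeasure) ↔
      MemPeriodicSobolev d w ∧ linOp d a L w =ᵐ[unitMeasure] g)

/-- The (real) spectrum of the linear part, as an operator in `L²(0,1)` with domain
`H^d_per(0,1)`: the set of `s` for which `𝓛 - s` is not a bijection of the domain onto `L²(0,1)`. -/
def linSpectrum (d : ℕ) (a : ℕ → ℝ) (L : ℝ) : Set ℝ :=
  {s | ¬ ((∀ g, MemLp g 2 unitMeasure → ∃ v, MemPeriodicSobolev d v ∧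
              (fun x => linOp d a L v x - s * v x) =ᵐ[unitMeasure] g) ∧
          (∀ v, MemPeriodicSobolev d v →
              (fun x => linOp d a L v x - s * v x) =ᵐ[unitMeasure] 0 → v =ᵐ[unitMeasure] 0))}

/-- The curve `u` has derivative `u'` at time `t`, in the `H²` norm. -/
def HasDerivAtH2 (u : ℝ → ℝ → ℝ) (u' : ℝ → ℝ) (t : ℝ) : Prop :=
  MemSobolev 2 u' ∧
    Tendsto (fun h : ℝ => h2norm (fun x => (u (t + h) x - u t x) / h - u' x)) (𝓝[≠] 0) (𝓝 0)

/-- `u` (time first, space second) is a solution on `[0,∞)` of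
`∂ₜ u = 𝓛[u] + 𝓠[u] + f` on `(0,1)` with values in `H^{d+2}(0,1)`, such that `u(0,t) = 0` and
`∂ₓ^k u` is periodic for `k ≤ d`. -/
structure IsSolution (d : ℕ) (a : ℕ → ℝ) (b : ℕ → ℕ → ℝ) (L : ℝ) (f u : ℝ → ℝ → ℝ) : Prop where
  mem : ∀ t, 0 ≤ t → MemSobolev (d + 2) (u t)
  zero : ∀ t, 0 ≤ t → ZeroTrace (u t)
  periodic : ∀ t, 0 ≤ t → ∀ k ≤ d, PeriodicTrace (weakDeriv^[k] (u t))
  initial : Tendsto (fun t => h2norm (fun x => u t x - u 0 x)) (𝓝[>] 0) (𝓝 0)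
  equation : ∀ t, 0 < t →
    HasDerivAtH2 u (fun x => linOp d a L (u t) x + quadOp d b L (u t) x + f t x) t

/-- Trajectory-based stability in the Lyapunov sense, in the `H²` norm. -/
def IsTrajectoryStable (d : ℕ) (a : ℕ → ℝ) (b : ℕ → ℕ → ℝ) (L : ℝ) (f u : ℝ → ℝ → ℝ) : Prop :=
  ∀ ε > 0, ∃ η > 0, ∀ w : ℝ → ℝ → ℝ, IsSolution d a b L f w →
    h2norm (fun x => u 0 x - w 0 x) < η → ∀ t, 0 ≤ t → h2norm (fun x => u t x - w t x) < ε

/-- Trajectory-based asymptotic stability. -/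
def IsTrajectoryAsympStable (d : ℕ) (a : ℕ → ℝ) (b : ℕ → ℕ → ℝ) (L : ℝ) (f u : ℝ → ℝ → ℝ) :
    Prop :=
  IsTrajectoryStable d a b L f u ∧
    ∃ η > 0, ∀ w : ℝ → ℝ → ℝ, IsSolution d a b L f w →
      h2norm (fun x => u 0 x - w 0 x) < η →
        Tendsto (fun t => h2norm (fun x => u t x - w t x)) atTop (𝓝 0)

/-- `f` is a forcing term with values in `H²_per(0,1)` and `fmax = sup_{t ≥ 0} ‖f(t)‖_{H²}`. -/
def IsForcing (f : ℝ → ℝ → ℝ) (fmax : ℝ) : Prop :=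
  (∀ t, 0 ≤ t → MemPeriodicSobolev 2 (f t)) ∧ IsLUB ((fun t => h2norm (f t)) '' Ici 0) fmax

/-- The number `𝓡 = (fmax + μ y₀²) / (β y₀)`. -/
def stabR (fmax μ β y₀ : ℝ) : ℝ := (fmax + μ * y₀ ^ 2) / (β * y₀)

/-- The number `𝓡* = 2 μ y₀ / β`. -/
def stabRstar (μ β y₀ : ℝ) : ℝ := 2 * μ * y₀ / β

/-- The characteristic effective velocity `v = (fmax + μ y₀²) / y₀`. -/
def effVelocity (fmax μ y₀ : ℝ) : ℝ := (fmax + μ * y₀ ^ 2) / y₀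

/-- `-β` is the largest of the eigenvalues `e k`, `k ≠ 0`, and it is negative. -/
def IsGap (e : ℤ → ℝ) (β : ℝ) : Prop := 0 < β ∧ IsGreatest (e '' {k | k ≠ 0}) (-β)

/-- Linear coefficients of the Burgers equation (order `d = 2`). -/
def burgersLin (ν : ℝ) : ℕ → ℝ := fun l => if l = 2 then ν else 0

/-- Quadratic coefficients of the Burgers equation. -/
def burgersQuad : ℕ → ℕ → ℝ := fun k l => if k = 0 ∧ l = 1 then -1 else 0

/-- Linear coefficients of the KPP–Fisher equation (order `d = 2`). -/
def kppLin (D r₁ : ℝ) : ℕ → ℝ := fun l => if l = 2 then D else if l = 0 then r₁ else 0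

/-- Quadratic coefficients of the KPP–Fisher equation. -/
def kppQuad (r₂ : ℝ) : ℕ → ℕ → ℝ := fun k l => if k = 0 ∧ l = 0 then -r₂ else 0

/-- Linear coefficients of the generalized Kuramoto–Sivashinsky equation (order `d = 4`). -/
def ksLin (a b : ℝ) : ℕ → ℝ := fun l => if l = 2 then a else if l = 4 then b else 0

/-- Quadratic coefficients of the generalized Kuramoto–Sivashinsky equation. -/
def ksQuad (c : ℝ) : ℕ → ℕ → ℝ := fun k l => if k = 0 ∧ l = 1 then c else 0

/-- The right-hand side of the Burgers equation in explicit form. -/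
theorem burgers_rhs (ν L : ℝ) (v : ℝ → ℝ) (x : ℝ) :
    linOp 2 (burgersLin ν) L v x + quadOp 2 burgersQuad L v x =
      -(1 / L) * v x * weakDeriv v x + 1 / L ^ 2 * ν * weakDeriv (weakDeriv v) x := by
  simp [linOp, quadOp, burgersLin, burgersQuad, Finset.sum_range_succ]
  ring

/-- The right-hand side of the KPP–Fisher equation in explicit form. -/
theorem kpp_rhs (D r₁ r₂ L : ℝ) (v : ℝ → ℝ) (x : ℝ) :
    linOp 2 (kppLin D r₁) L v x + quadOp 2 (kppQuad r₂) L v x =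
      1 / L ^ 2 * D * weakDeriv (weakDeriv v) x + r₁ * v x - r₂ * v x ^ 2 := by
  simp [linOp, quadOp, kppLin, kppQuad, Finset.sum_range_succ]
  ring

/-- The right-hand side of the generalized Kuramoto–Sivashinsky equation in explicit form. -/
theorem ks_rhs (a b c L : ℝ) (v : ℝ → ℝ) (x : ℝ) :
    linOp 4 (ksLin a b) L v x + quadOp 4 (ksQuad c) L v x =
      1 / L ^ 2 * a * weakDeriv (weakDeriv v) x
        + 1 / L ^ 4 * b * weakDeriv (weakDeriv (weakDeriv (weakDeriv v))) x
        + 1 / L * c * v x * weakDeriv v x := by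
  simp [linOp, quadOp, ksLin, ksQuad, Finset.sum_range_succ]

end QuadPDE

end

/-! Stability is proved with the energy `y² = ‖∂ₓ²(u - w)‖²` in L²(0,1) for two solutions `u`, `w`.
A solution vanishes at both end points and has periodic first derivative, so for differences `y` is
equivalent to the H² norm (`ZeroJet.h2norm_le`).

Put `v = u - w`, `q = (u + w)/2` and `S = ‖∂ₓ²(u + w)‖ = 2‖∂ₓ²q‖`. For equal forcings, half the time
derivative of `y²` is `-⟨∂ₓ³v, ∂ₓ(rhs u - rhs w)⟩`. The linear part is controlled by Wirtinger's
inequality `2π‖∂ₓ²v‖ ≤ ‖∂ₓ³v‖`, which yields `-β y²`. The quadratic part is polarised: `u uₓ - w wₓ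
= (qv)ₓ` and `u² - w² = 2qv`; zero boundary values give `π‖∂ₓ²(qv)‖ ≤ ‖∂ₓ²q‖ y`
(`ZeroJet.l2_mul_le`). Testing the algebra inequality on the constant 1 shows `C ≥ 1`, so in all
three equations the bound is at most `-(β - μS) y²` while `μS ≤ β` (`IsDissipative` and its three
instances).

The energy inequality is used twice. With `w = 0` the sphere `‖∂ₓ²u‖ = M` cannot be reached from
inside if `fmax + μM² < βM`; this is `𝓡 < 1` for `M` slightly above `y₀`. Then `S ≤ 2M + y`, and
`2μM < β`, which is `𝓡* < 1`, makes every small `y` decay exponentially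
(`IsDissipative.isTrajectoryAsympStable`).

Periodicity is assumed only up to order `d`, while `∂ₓ(rhs)` has order `d + 1`. Its periodicity is
read off from the time derivative instead: `∂ₓ²u(t)` has mean zero for all `t`, hence so has
`∂ₓ²∂ₜu` (`IsSolution.exists_deriv_jet`).

For the spectrum, `𝓛 - s` is inverted on periodic functions by factoring the constant coefficient
operator into first order factors over ℂ. A symmetric operator with `𝓛 - s₀` onto for one real `s₀`
is self-adjoint; cosines are the eigenfunctions.

Weak derivatives are handled throughout by absolutely continuous representatives (`IsPrim`, `Jet`).
-/

noncomputable section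

namespace QuadPDE

set_option linter.unusedSectionVars false

/-! ### Absolutely continuous functions on [0,1] as primitives -/

section Primitive

variable {E : Type*} [NormedAddCommGroup E] [NormedSpace ℝ E]

/-- On `[0,1]`, `v` is a primitive of the integrable function `h`. -/
def IsPrim (v h : ℝ → E) : Prop :=
  IntervalIntegrable h volume 0 1 ∧ ∀ x ∈ Icc (0 : ℝ) 1, v x = v 0 + ∫ t in (0 : ℝ)..x, h t

theorem intervalIntegrable_sub_interval {h : ℝ → E} (hh : IntervalIntegrable h volume 0 1)
    {x y : ℝ} (hx : x ∈ Icc (0 : ℝ) 1) (hy : y ∈ Icc (0 : ℝ) 1) :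
    IntervalIntegrable h volume x y := by
  refine hh.mono_set ?_
  rw [uIcc_of_le (zero_le_one' ℝ)]
  exact uIcc_subset_Icc hx hy

theorem IsPrim.sub_eq {v h : ℝ → E} (H : IsPrim v h) {x y : ℝ}
    (hx : x ∈ Icc (0 : ℝ) 1) (hy : y ∈ Icc (0 : ℝ) 1) : v y - v x = ∫ t in x..y, h t := by
  have h0 : (0 : ℝ) ∈ Icc (0 : ℝ) 1 := by simp
  rw [H.2 x hx, H.2 y hy, ← intervalIntegral.integral_interval_sub_left
    (intervalIntegrable_sub_interval H.1 h0 hy) (intervalIntegrable_sub_interval H.1 h0 hx)]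
  abel

theorem IsPrim.continuousOn {v h : ℝ → E} (H : IsPrim v h) : ContinuousOn v (Icc 0 1) := by
  have h1 := intervalIntegral.continuousOn_primitive_interval' H.1
    (a := 0) (by simp)
  rw [uIcc_of_le (zero_le_one' ℝ)] at h1
  exact (continuousOn_const.add h1).congr H.2

theorem IsPrim.integral_eq_zero_iff {v h : ℝ → E} (H : IsPrim v h) :
    ∫ t in (0 : ℝ)..1, h t = 0 ↔ v 0 = v 1 := by
  rw [← H.sub_eq (by simp) (by simp), sub_eq_zero, eq_comm]

theorem isPrim_integral {h : ℝ → E} (hh : IntervalIntegrable h volume 0 1) (c : E) :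
    IsPrim (fun x => c + ∫ t in (0 : ℝ)..x, h t) h :=
  ⟨hh, fun x _ => by simp⟩

theorem IsPrim.add {v h w k : ℝ → E} (H : IsPrim v h) (K : IsPrim w k) :
    IsPrim (fun x => v x + w x) (fun x => h x + k x) := by
  refine ⟨H.1.add K.1, fun x hx => ?_⟩
  have h0 : (0 : ℝ) ∈ Icc (0 : ℝ) 1 := by simp
  rw [intervalIntegral.integral_add (intervalIntegrable_sub_interval H.1 h0 hx)
    (intervalIntegrable_sub_interval K.1 h0 hx)]
  show v x + w x = v 0 + w 0 + _
  rw [H.2 x hx, K.2 x hx]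
  abel

theorem IsPrim.smul {𝕜 : Type*} [RCLike 𝕜] [NormedSpace 𝕜 E]
    {v h : ℝ → E} (H : IsPrim v h) (c : 𝕜) :
    IsPrim (fun x => c • v x) (fun x => c • h x) := by
  refine ⟨H.1.smul c, fun x hx => ?_⟩
  rw [intervalIntegral.integral_smul]
  show c • v x = c • v 0 + _
  rw [H.2 x hx, smul_add]

theorem IsPrim.const_mul {𝕜 : Type*} [RCLike 𝕜]
    {v h : ℝ → 𝕜} (H : IsPrim v h) (c : 𝕜) :
    IsPrim (fun x => c * v x) (fun x => c * h x) := H.smul c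

theorem IsPrim.sub {v h w k : ℝ → E} (H : IsPrim v h) (K : IsPrim w k) :
    IsPrim (fun x => v x - w x) (fun x => h x - k x) := by
  simpa [sub_eq_add_neg] using H.add (K.smul (-1 : ℝ))

theorem unitMeasure_eq : unitMeasure = volume.restrict (Ioc (0 : ℝ) 1) :=
  Measure.restrict_congr_set Ioo_ae_eq_Ioc

theorem integral_unitMeasure (f : ℝ → E) : ∫ x, f x ∂unitMeasure = ∫ x in (0 : ℝ)..1, f x := by
  rw [unitMeasure_eq, intervalIntegral.integral_of_le zero_le_one]

theorem intervalIntegrable_iff_unitMeasure {f : ℝ → E} :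
    IntervalIntegrable f volume 0 1 ↔ Integrable f unitMeasure := by
  rw [unitMeasure_eq, intervalIntegrable_iff_integrableOn_Ioc_of_le zero_le_one, IntegrableOn]

instance : IsProbabilityMeasure unitMeasure := ⟨by simp [unitMeasure]⟩

theorem ae_unitMeasure_of_forall {p : ℝ → Prop} (h : ∀ x ∈ Icc (0 : ℝ) 1, p x) :
    ∀ᵐ x ∂unitMeasure, p x :=
  (ae_restrict_iff' measurableSet_Ioo).2 (Eventually.of_forall fun x hx =>
    h x (Ioo_subset_Icc_self hx))

theorem memLp_of_continuousOn {v : ℝ → E} {p : ENNReal} (hv : ContinuousOn v (Icc 0 1)) :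
    MemLp v p unitMeasure := by
  obtain ⟨C, hC⟩ := isCompact_Icc.exists_bound_of_continuousOn hv
  refine MemLp.of_bound ?_ C (ae_unitMeasure_of_forall hC)
  exact (hv.mono Ioo_subset_Icc_self).aestronglyMeasurable measurableSet_Ioo

theorem IsPrim.memLp {v h : ℝ → E} {p : ENNReal} (H : IsPrim v h) : MemLp v p unitMeasure :=
  memLp_of_continuousOn H.continuousOn

theorem IsPrim.congr_deriv {v h k : ℝ → E} (H : IsPrim v h) (hk : h =ᵐ[unitMeasure] k) :
    IsPrim v k := by
  refine ⟨intervalIntegrable_iff_unitMeasure.2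
    ((intervalIntegrable_iff_unitMeasure.1 H.1).congr hk), fun x hx => ?_⟩
  rw [H.2 x hx]
  congr 1
  rw [intervalIntegral.integral_of_le hx.1, intervalIntegral.integral_of_le hx.1]
  refine integral_congr_ae (ae_restrict_of_ae_restrict_of_subset (Ioc_subset_Ioc_right hx.2) ?_)
  rwa [← unitMeasure_eq]

theorem eqOn_Icc_of_ae_eq {v w : ℝ → E} (hv : ContinuousOn v (Icc 0 1))
    (hw : ContinuousOn w (Icc 0 1)) (h : v =ᵐ[unitMeasure] w) : EqOn v w (Icc 0 1) := by
  have h1 : EqOn v w (Ioo 0 1) :=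
    Measure.eqOn_open_of_ae_eq h isOpen_Ioo (hv.mono Ioo_subset_Icc_self)
      (hw.mono Ioo_subset_Icc_self)
  refine h1.of_subset_closure hv hw Ioo_subset_Icc_self ?_
  rw [closure_Ioo (by norm_num)]

/-- Primitives that agree a.e. have derivatives that agree a.e. -/
theorem IsPrim.deriv_unique [CompleteSpace E] {v h w k : ℝ → E} (H : IsPrim v h) (K : IsPrim w k)
    (hvw : v =ᵐ[unitMeasure] w) : h =ᵐ[unitMeasure] k := by
  have heq := eqOn_Icc_of_ae_eq H.continuousOn K.continuousOn hvw
  have h0 : (0 : ℝ) ∈ uIcc (0 : ℝ) 1 := by simp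
  rw [unitMeasure]
  refine (ae_restrict_iff' measurableSet_Ioo).2 ?_
  filter_upwards [H.1.ae_hasDerivAt_integral, K.1.ae_hasDerivAt_integral] with x h1 h2 hx
  have hx' : x ∈ uIcc (0 : ℝ) 1 := by
    rw [uIcc_of_le zero_le_one]; exact Ioo_subset_Icc_self hx
  have e1 := (h1 hx' 0 h0).const_add (v 0)
  have e2 := (h2 hx' 0 h0).const_add (w 0)
  refine (e1.congr_of_eventuallyEq ?_).unique e2
  filter_upwards [isOpen_Ioo.mem_nhds hx] with y hy
  have hy' := Ioo_subset_Icc_self hy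
  rw [← H.2 y hy', ← K.2 y hy', heq hy']

theorem isPrim_of_hasDerivAt [CompleteSpace E] {v h : ℝ → E} (H : ∀ x, HasDerivAt v (h x) x)
    (hh : Continuous h) : IsPrim v h := by
  refine ⟨hh.intervalIntegrable _ _, fun x _ => ?_⟩
  rw [intervalIntegral.integral_eq_sub_of_hasDerivAt (fun y _ => H y) (hh.intervalIntegrable _ _)]
  abel

end Primitive

/-- The product rule for absolutely continuous functions, obtained from integration by parts on each
`[0,x]`. -/
theorem IsPrim.mul {v h w k : ℝ → ℝ} (H : IsPrim v h) (K : IsPrim w k) :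
    IsPrim (fun x => v x * w x) (fun x => h x * w x + v x * k x) := by
  have hu : uIcc (0 : ℝ) 1 = Icc 0 1 := uIcc_of_le zero_le_one
  have hvc : ContinuousOn v (uIcc 0 1) := hu ▸ H.continuousOn
  have hwc : ContinuousOn w (uIcc 0 1) := hu ▸ K.continuousOn
  refine ⟨(H.1.mul_continuousOn hwc).add (K.1.continuousOn_mul hvc), fun x hx => ?_⟩
  have h0 : (0 : ℝ) ∈ uIcc (0 : ℝ) 1 := by simp
  -- Nothing is known about `v` outside [0,1], so derivatives are taken of the integral formula,
  -- which is defined on all of ℝ and agrees with `v` on [0,1].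
  have aux : ∀ (v h : ℝ → ℝ), IsPrim v h →
      AbsolutelyContinuousOnInterval (fun x => v 0 + ∫ t in (0 : ℝ)..x, h t) 0 x ∧
      ∀ᵐ y, y ∈ Icc (0 : ℝ) 1 → HasDerivAt (fun x => v 0 + ∫ t in (0 : ℝ)..x, h t) (h y) y := by
    intro v h H
    constructor
    · have := H.1.absolutelyContinuousOnInterval_intervalIntegral h0
      have c : AbsolutelyContinuousOnInterval (fun _ : ℝ => v 0) 0 1 :=
        contDiff_const.contDiffOn.absolutelyContinuousOnInterval
      refine (c.fun_add this).mono ?_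
      rw [hu, uIcc_of_le hx.1]
      exact Icc_subset_Icc_right hx.2
    · filter_upwards [H.1.ae_hasDerivAt_integral] with y hy hy'
      exact (hy (hu ▸ hy') 0 h0).const_add _
  obtain ⟨a1, d1⟩ := aux v h H
  obtain ⟨a2, d2⟩ := aux w k K
  have := a1.integral_deriv_mul_eq_sub a2
  simp only [intervalIntegral.integral_same, add_zero] at this
  rw [← H.2 x hx, ← K.2 x hx] at this
  rw [← sub_eq_iff_eq_add', ← this]
  refine intervalIntegral.integral_congr_ae ?_
  filter_upwards [d1, d2] with y h1 h2 hy
  rw [uIoc_of_le hx.1] at hy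
  have hy' : y ∈ Icc (0 : ℝ) 1 := ⟨hy.1.le, hy.2.trans hx.2⟩
  rw [(h1 hy').deriv, (h2 hy').deriv, ← H.2 y hy', ← K.2 y hy']

/-- Integration by parts. -/
theorem IsPrim.integral_mul {v h w k : ℝ → ℝ} (H : IsPrim v h) (K : IsPrim w k) :
    ∫ x, v x * k x ∂unitMeasure = v 1 * w 1 - v 0 * w 0 - ∫ x, h x * w x ∂unitMeasure := by
  have hu : uIcc (0 : ℝ) 1 = Icc 0 1 := uIcc_of_le zero_le_one
  have h1 := (H.mul K).sub_eq (x := 0) (y := 1) (by simp) (by simp)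
  rw [intervalIntegral.integral_add (H.1.mul_continuousOn (hu ▸ K.continuousOn))
    (K.1.continuousOn_mul (hu ▸ H.continuousOn)), ← integral_unitMeasure,
    ← integral_unitMeasure] at h1
  linarith

theorem IsPrim.integral_mul_periodic {v h w k : ℝ → ℝ} (H : IsPrim v h) (K : IsPrim w k)
    (hv : v 0 = v 1) (hw : w 0 = w 1) :
    ∫ x, v x * k x ∂unitMeasure = - ∫ x, h x * w x ∂unitMeasure := by
  rw [H.integral_mul K, hv, hw]; ring

/-! ### Weak derivatives and absolutely continuous representatives -/

/-- A primitive is weakly differentiable. -/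
theorem IsPrim.hasWeakDeriv {v h : ℝ → ℝ} (H : IsPrim v h) : HasWeakDeriv v h := by
  intro φ hφ _ hs
  have hz : ∀ x, x ∉ Ioo (0 : ℝ) 1 → φ x = 0 := fun x hx =>
    image_eq_zero_of_notMem_tsupport fun h' => hx (hs h')
  have hP : IsPrim φ (deriv φ) :=
    isPrim_of_hasDerivAt (fun x => (hφ.differentiable (by simp) x).hasDerivAt)
      (hφ.continuous_deriv (by simp))
  rw [H.integral_mul hP, hz 0 (by simp), hz 1 (by simp)]
  ring

/-- A test function of integral one exists. -/
theorem exists_bump : ∃ ψ : ℝ → ℝ, ContDiff ℝ (⊤ : ℕ∞) ψ ∧ HasCompactSupport ψ ∧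
    tsupport ψ ⊆ Ioo (0 : ℝ) 1 ∧ ∫ x, ψ x = 1 := by
  let b : ContDiffBump (1 / 2 : ℝ) := ⟨1 / 8, 1 / 4, by norm_num, by norm_num⟩
  refine ⟨b.normed volume, b.contDiff_normed, b.hasCompactSupport_normed, ?_,
    b.integral_normed⟩
  rw [b.tsupport_normed_eq, Real.closedBall_eq_Icc]
  intro x hx
  simp only [b] at hx
  constructor <;> linarith [hx.1, hx.2]

theorem setIntegral_eq_of_support {φ : ℝ → ℝ} (hs : tsupport φ ⊆ Ioo (0 : ℝ) 1) :
    ∫ x, φ x ∂unitMeasure = ∫ x, φ x := by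
  refine setIntegral_eq_integral_of_forall_compl_eq_zero fun x hx => ?_
  exact image_eq_zero_of_notMem_tsupport fun h => hx (hs h)

/-- The primitive of a test function of integral zero is a test function. -/
theorem exists_test_primitive {ψ : ℝ → ℝ} (h1 : ContDiff ℝ (⊤ : ℕ∞) ψ)
    (h3 : tsupport ψ ⊆ Ioo (0 : ℝ) 1) (h4 : ∫ x, ψ x = 0) :
    ∃ φ : ℝ → ℝ, ContDiff ℝ (⊤ : ℕ∞) φ ∧ HasCompactSupport φ ∧ tsupport φ ⊆ Ioo (0 : ℝ) 1 ∧
      deriv φ = ψ := by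
  -- The support is compact, so it keeps a positive distance from 0 and 1; for empty support any
  -- interior point serves.
  obtain ⟨a, b, ha, hb, hab⟩ : ∃ a b : ℝ, 0 < a ∧ b < 1 ∧ tsupport ψ ⊆ Icc a b := by
    have hK : IsCompact (tsupport ψ) :=
      isCompact_Icc.of_isClosed_subset (isClosed_tsupport ψ) (h3.trans Ioo_subset_Icc_self)
    rcases (tsupport ψ).eq_empty_or_nonempty with he | hne
    · exact ⟨1 / 2, 1 / 2, by norm_num, by norm_num, by simp [he]⟩
    · obtain ⟨a, ha, ha'⟩ := hK.exists_isLeast hne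
      obtain ⟨b, hb, hb'⟩ := hK.exists_isGreatest hne
      exact ⟨a, b, (h3 ha).1, (h3 hb).2, fun x hx => ⟨ha' hx, hb' hx⟩⟩
  have hz : ∀ x, x ∉ Icc a b → ψ x = 0 := fun x hx =>
    image_eq_zero_of_notMem_tsupport fun h' => hx (hab h')
  have hd : ∀ x, HasDerivAt (fun x => ∫ t in (0 : ℝ)..x, ψ t) (ψ x) x := fun x =>
    intervalIntegral.integral_hasDerivAt_right (h1.continuous.intervalIntegrable _ _)
      h1.continuous.aestronglyMeasurable.stronglyMeasurableAtFilter h1.continuous.continuousAt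
  have hderiv : deriv (fun x => ∫ t in (0 : ℝ)..x, ψ t) = ψ := funext fun x => (hd x).deriv
  have h01 : ∫ t in (0 : ℝ)..1, ψ t = 0 := by
    rw [← integral_unitMeasure, setIntegral_eq_of_support h3, h4]
  -- To the left of `a` the integrand vanishes; to the right of `b` the whole integral of `ψ` has
  -- been collected, and it is zero.
  have hzero : ∀ x, x ∉ Icc a b → ∫ t in (0 : ℝ)..x, ψ t = 0 := by
    intro x hx
    rw [mem_Icc, not_and_or, not_le, not_le] at hx
    rcases hx with hx | hx
    · refine (intervalIntegral.integral_congr (g := fun _ => 0) fun t ht => hz t ?_).trans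
        (by simp)
      intro h
      have := ht.2
      rcases le_max_iff.1 this with h' | h' <;> linarith [h.1]
    · rw [← intervalIntegral.integral_add_adjacent_intervals
        (h1.continuous.intervalIntegrable 0 1) (h1.continuous.intervalIntegrable 1 x), h01,
        zero_add]
      refine (intervalIntegral.integral_congr (g := fun _ => 0) fun t ht => hz t ?_).trans
        (by simp)
      intro h
      have := ht.1
      rcases min_le_iff.1 this with h' | h' <;> linarith [h.2]
  have hsupp : tsupport (fun x => ∫ t in (0 : ℝ)..x, ψ t) ⊆ Icc a b :=
    closure_minimal (fun x hx => by_contra fun h => hx (hzero x h)) isClosed_Icc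
  refine ⟨fun x => ∫ t in (0 : ℝ)..x, ψ t, ?_, ?_, fun x hx => ?_, hderiv⟩
  · rw [contDiff_infty_iff_deriv]
    exact ⟨fun x => (hd x).differentiableAt, by rwa [hderiv]⟩
  · exact isCompact_Icc.of_isClosed_subset (isClosed_tsupport _) hsupp
  · have := hsupp hx
    exact ⟨lt_of_lt_of_le ha this.1, lt_of_le_of_lt this.2 hb⟩

/-- du Bois-Reymond: a function whose weak derivative vanishes is constant. -/
theorem ae_const_of_hasWeakDeriv_zero {z : ℝ → ℝ} (hz : Integrable z unitMeasure)
    (h : HasWeakDeriv z 0) : ∃ c : ℝ, z =ᵐ[unitMeasure] fun _ => c := by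
  obtain ⟨ψ₀, s0, c0, t0, i0⟩ := exists_bump
  refine ⟨∫ x, z x * ψ₀ x ∂unitMeasure, ?_⟩
  set c := ∫ x, z x * ψ₀ x ∂unitMeasure with hc
  have intz : ∀ ψ : ℝ → ℝ, Continuous ψ → Integrable (fun x => z x * ψ x) unitMeasure := by
    intro ψ hψ
    exact intervalIntegrable_iff_unitMeasure.1
      ((intervalIntegrable_iff_unitMeasure.2 hz).mul_continuousOn hψ.continuousOn)
  -- Subtracting `(∫ ψ) ψ₀` leaves a test function of integral zero, that is, the derivative of a
  -- test function, against which `z` integrates to zero.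
  have key : ∀ ψ : ℝ → ℝ, ContDiff ℝ (⊤ : ℕ∞) ψ → HasCompactSupport ψ →
      tsupport ψ ⊆ Ioo (0 : ℝ) 1 → ∫ x, z x * ψ x ∂unitMeasure = (∫ x, ψ x) * c := by
    intro ψ s1 c1 t1
    obtain ⟨φ, sφ, cφ, tφ, dφ⟩ := exists_test_primitive
      (ψ := fun x => ψ x - (∫ y, ψ y) * ψ₀ x) (s1.sub (contDiff_const.mul s0))
      (by
        refine (closure_minimal (fun x hx => ?_)
          ((isClosed_tsupport ψ).union (isClosed_tsupport ψ₀))).trans (union_subset t1 t0)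
        by_contra hn
        rw [mem_union, not_or] at hn
        apply hx
        simp [image_eq_zero_of_notMem_tsupport hn.1, image_eq_zero_of_notMem_tsupport hn.2])
      (by
        rw [integral_sub (s1.continuous.integrable_of_hasCompactSupport c1)
          ((s0.continuous.integrable_of_hasCompactSupport c0).const_mul _),
          integral_const_mul, i0]
        ring)
    have h1 := h φ sφ cφ tφ
    rw [dφ] at h1
    simp only [mul_sub, Pi.zero_apply, zero_mul, integral_zero, neg_zero] at h1
    have e : ∀ x, z x * ((∫ y, ψ y) * ψ₀ x) = (∫ y, ψ y) * (z x * ψ₀ x) := fun x => by ring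
    simp only [e] at h1
    rw [integral_sub (intz ψ s1.continuous) ((intz ψ₀ s0.continuous).const_mul _),
      integral_const_mul] at h1
    linarith
  have hloc : LocallyIntegrableOn (fun x => z x - c) (Ioo (0 : ℝ) 1) volume := by
    have : IntegrableOn (fun x => z x - c) (Ioo (0 : ℝ) 1) volume := hz.sub (integrable_const c)
    exact this.locallyIntegrableOn
  have := isOpen_Ioo.ae_eq_zero_of_integral_contDiff_smul_eq_zero hloc (fun ψ s1 c1 t1 => by
    have hs : tsupport (fun x => ψ x • (z x - c)) ⊆ Ioo (0 : ℝ) 1 :=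
      (tsupport_smul_subset_left ψ _).trans t1
    rw [← setIntegral_eq_of_support hs]
    have e : ∀ x, ψ x • (z x - c) = z x * ψ x - c * ψ x := fun x => by
      simp only [smul_eq_mul]; ring
    simp only [e]
    rw [integral_sub (intz ψ s1.continuous), integral_const_mul, key ψ s1 c1 t1,
      setIntegral_eq_of_support t1]
    · ring
    · exact (memLp_one_iff_integrable.1
        (memLp_of_continuousOn s1.continuous.continuousOn)).const_mul c)
  rw [unitMeasure]
  refine (ae_restrict_iff' measurableSet_Ioo).2 ?_
  filter_upwards [this] with x hx hx'
  linarith [hx hx']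

/-- The passage from weak to absolutely continuous: `v` minus the primitive of `g` has weak
derivative zero, hence is constant. -/
theorem HasWeakDeriv.exists_isPrim {v g : ℝ → ℝ} (hv : Integrable v unitMeasure)
    (hg : Integrable g unitMeasure) (h : HasWeakDeriv v g) :
    ∃ V : ℝ → ℝ, v =ᵐ[unitMeasure] V ∧ IsPrim V g := by
  have hP : IsPrim (fun x => (0 : ℝ) + ∫ t in (0 : ℝ)..x, g t) g :=
    isPrim_integral (intervalIntegrable_iff_unitMeasure.2 hg) 0
  set G := fun x => (0 : ℝ) + ∫ t in (0 : ℝ)..x, g t with hG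
  have hGi : Integrable G unitMeasure := memLp_one_iff_integrable.1 hP.memLp
  obtain ⟨c, hc⟩ := ae_const_of_hasWeakDeriv_zero (hv.sub hGi) (by
    intro φ hφ hcφ ht
    have h1 := h φ hφ hcφ ht
    have h2 := hP.hasWeakDeriv φ hφ hcφ ht
    simp only [Pi.sub_apply, sub_mul, Pi.zero_apply, zero_mul, integral_zero, neg_zero]
    have hd := (hφ.continuous_deriv (by simp)).continuousOn (s := uIcc 0 1)
    rw [integral_sub, h1, h2, sub_self]
    · exact intervalIntegrable_iff_unitMeasure.1
        ((intervalIntegrable_iff_unitMeasure.2 hv).mul_continuousOn hd)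
    · exact intervalIntegrable_iff_unitMeasure.1
        ((intervalIntegrable_iff_unitMeasure.2 hGi).mul_continuousOn hd))
  refine ⟨fun x => c + ∫ t in (0 : ℝ)..x, g t, ?_, isPrim_integral hP.1 c⟩
  filter_upwards [hc] with x hx
  simp only [Pi.sub_apply, hG, zero_add] at hx
  linarith

/-! ### Jets as representatives of Sobolev functions -/

/-- `V 0, …, V m` are absolutely continuous representatives of a function in `H^m(0,1)` and of its
derivatives (for the last one, merely a square integrable function). -/
def Jet (m : ℕ) (V : ℕ → ℝ → ℝ) : Prop :=
  (∀ j < m, IsPrim (V j) (V (j + 1))) ∧ MemLp (V m) 2 unitMeasure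

theorem Jet.memLp {m : ℕ} {V : ℕ → ℝ → ℝ} (H : Jet m V) {j : ℕ} (hj : j ≤ m) :
    MemLp (V j) 2 unitMeasure := by
  rcases hj.lt_or_eq with h | rfl
  · exact (H.1 j h).memLp
  · exact H.2

theorem Jet.mono {m n : ℕ} {V : ℕ → ℝ → ℝ} (H : Jet m V) (h : n ≤ m) : Jet n V :=
  ⟨fun j hj => H.1 j (hj.trans_le h), H.memLp h⟩

theorem Jet.tail {m : ℕ} {V : ℕ → ℝ → ℝ} (H : Jet (m + 1) V) : Jet m fun j => V (j + 1) :=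
  ⟨fun j hj => H.1 (j + 1) (by omega), H.2⟩

theorem Jet.lin {m : ℕ} {V W : ℕ → ℝ → ℝ} (H : Jet m V) (K : Jet m W) (a b : ℝ) :
    Jet m fun j x => a * V j x + b * W j x :=
  ⟨fun j hj => ((H.1 j hj).const_mul a).add ((K.1 j hj).const_mul b),
    (H.2.const_mul a).add (K.2.const_mul b)⟩

theorem HasWeakDeriv.congr {v v' g g' : ℝ → ℝ} (h : HasWeakDeriv v g)
    (hv : v =ᵐ[unitMeasure] v') (hg : g =ᵐ[unitMeasure] g') : HasWeakDeriv v' g' := by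
  intro φ h1 h2 h3
  have e1 : ∫ x, v' x * deriv φ x ∂unitMeasure = ∫ x, v x * deriv φ x ∂unitMeasure :=
    integral_congr_ae (by filter_upwards [hv] with x hx; rw [hx])
  have e2 : ∫ x, g' x * φ x ∂unitMeasure = ∫ x, g x * φ x ∂unitMeasure :=
    integral_congr_ae (by filter_upwards [hg] with x hx; rw [hx])
  rw [e1, e2]
  exact h φ h1 h2 h3

/-- Both functions have the same set of weak derivatives, so the choice returns the same one; hence
true equality and not only equality almost everywhere. -/
theorem weakDeriv_congr {v w : ℝ → ℝ} (h : v =ᵐ[unitMeasure] w) : weakDeriv v = weakDeriv w := by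
  have e : HasWeakDeriv v = HasWeakDeriv w := by
    funext g
    exact propext ⟨fun H => H.congr h EventuallyEq.rfl, fun H => H.congr h.symm EventuallyEq.rfl⟩
  unfold weakDeriv
  rw [e]

theorem HasWeakDeriv.unique {v g h : ℝ → ℝ} (hv : Integrable v unitMeasure)
    (hg : Integrable g unitMeasure) (hh : Integrable h unitMeasure)
    (H : HasWeakDeriv v g) (K : HasWeakDeriv v h) : g =ᵐ[unitMeasure] h := by
  obtain ⟨V, e1, p1⟩ := H.exists_isPrim hv hg
  obtain ⟨W, e2, p2⟩ := K.exists_isPrim hv hh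
  exact p1.deriv_unique p2 (e1.symm.trans e2)

theorem integrable_of_memLp_two {v : ℝ → ℝ} (h : MemLp v 2 unitMeasure) :
    Integrable v unitMeasure := h.integrable (by norm_num)

theorem weakDeriv_ae_eq {v g : ℝ → ℝ} (hv : Integrable v unitMeasure)
    (hg : MemLp g 2 unitMeasure) (H : HasWeakDeriv v g) : weakDeriv v =ᵐ[unitMeasure] g := by
  have hex : ∃ g, MemLp g 2 unitMeasure ∧ HasWeakDeriv v g := ⟨g, hg, H⟩
  rw [weakDeriv, dif_pos hex]
  exact HasWeakDeriv.unique hv (integrable_of_memLp_two hex.choose_spec.1)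
    (integrable_of_memLp_two hg) hex.choose_spec.2 H

theorem MemSobolev.memLp {m : ℕ} {v : ℝ → ℝ} (h : MemSobolev m v) : MemLp v 2 unitMeasure := by
  cases m with
  | zero => exact h
  | succ m => exact h.1

theorem iterate_weakDeriv_ae_eq {v w : ℝ → ℝ} (h : v =ᵐ[unitMeasure] w) (j : ℕ) :
    weakDeriv^[j] v =ᵐ[unitMeasure] weakDeriv^[j] w := by
  cases j with
  | zero => exact h
  | succ j => simp only [Function.iterate_succ, Function.comp_apply, weakDeriv_congr h]; rfl

/-- A jet determines the weak derivatives of its first entry. -/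
theorem Jet.memSobolev {m : ℕ} {V : ℕ → ℝ → ℝ} (H : Jet m V) {v : ℝ → ℝ}
    (hv : v =ᵐ[unitMeasure] V 0) :
    MemSobolev m v ∧ ∀ j ≤ m, weakDeriv^[j] v =ᵐ[unitMeasure] V j := by
  induction m generalizing V v with
  | zero =>
    refine ⟨H.2.ae_eq hv.symm, fun j hj => ?_⟩
    obtain rfl : j = 0 := by omega
    exact hv
  | succ m ih =>
    have hP := H.1 0 (by omega)
    have hw : HasWeakDeriv v (V 1) := hP.hasWeakDeriv.congr hv.symm EventuallyEq.rfl
    have hL : MemLp v 2 unitMeasure := (H.memLp (Nat.zero_le _)).ae_eq hv.symm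
    refine ⟨⟨hL, V 1, hw, (ih H.tail EventuallyEq.rfl).1⟩, fun j hj => ?_⟩
    cases j with
    | zero => exact hv
    | succ j =>
      have h1 := weakDeriv_ae_eq (integrable_of_memLp_two hL) (H.memLp (by omega)) hw
      exact (ih H.tail h1).2 j (by omega)

/-- Every function in `H^m(0,1)` is represented by a jet. -/
theorem MemSobolev.exists_jet {m : ℕ} {v : ℝ → ℝ} (h : MemSobolev m v) :
    ∃ V, Jet m V ∧ v =ᵐ[unitMeasure] V 0 ∧ ∀ j ≤ m, weakDeriv^[j] v =ᵐ[unitMeasure] V j := by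
  suffices ∃ V, Jet m V ∧ v =ᵐ[unitMeasure] V 0 by
    obtain ⟨V, hV, h0⟩ := this
    exact ⟨V, hV, h0, (hV.memSobolev h0).2⟩
  induction m generalizing v with
  | zero => exact ⟨fun _ => v, ⟨by simp, h⟩, EventuallyEq.rfl⟩
  | succ m ih =>
    obtain ⟨hv, g, hg, hm⟩ := h
    obtain ⟨V, hV, h0⟩ := ih hm
    obtain ⟨W, hW, hP⟩ := hg.exists_isPrim (integrable_of_memLp_two hv)
      (integrable_of_memLp_two hm.memLp)
    refine ⟨fun j => Nat.casesOn j W V, ⟨fun j hj => ?_, hV.2⟩, hW⟩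
    cases j with
    | zero => exact hP.congr_deriv h0
    | succ j => exact hV.1 j (by omega)

theorem periodicTrace_iff {v V : ℝ → ℝ} (h : v =ᵐ[unitMeasure] V)
    (hV : ContinuousOn V (Icc 0 1)) : PeriodicTrace v ↔ V 0 = V 1 := by
  refine ⟨fun ⟨c, hc, e, h01⟩ => ?_, fun H => ⟨V, hV, h, H⟩⟩
  have := eqOn_Icc_of_ae_eq hV hc (h.symm.trans e)
  rw [this (by simp), this (by simp), h01]

theorem zeroTrace_iff {v V : ℝ → ℝ} (h : v =ᵐ[unitMeasure] V)
    (hV : ContinuousOn V (Icc 0 1)) : ZeroTrace v ↔ V 0 = 0 := by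
  refine ⟨fun ⟨c, hc, e, h0⟩ => ?_, fun H => ⟨V, hV, h, H⟩⟩
  have := eqOn_Icc_of_ae_eq hV hc (h.symm.trans e)
  rw [this (by simp), h0]

/-- A jet all of whose entries below the top order are periodic. -/
def PerJet (m : ℕ) (V : ℕ → ℝ → ℝ) : Prop := Jet m V ∧ ∀ j < m, V j 0 = V j 1

theorem memPeriodicSobolev_iff {m : ℕ} {v : ℝ → ℝ} :
    MemPeriodicSobolev m v ↔ ∃ V, PerJet m V ∧ v =ᵐ[unitMeasure] V 0 := by
  constructor
  · rintro ⟨h, hp⟩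
    obtain ⟨V, hV, h0, hj⟩ := h.exists_jet
    exact ⟨V, ⟨hV, fun j hjm =>
      (periodicTrace_iff (hj j hjm.le) (hV.1 j hjm).continuousOn).1 (hp j hjm)⟩, h0⟩
  · rintro ⟨V, ⟨hV, hp⟩, h0⟩
    obtain ⟨h1, h2⟩ := hV.memSobolev h0
    exact ⟨h1, fun j hj =>
      (periodicTrace_iff (h2 j hj.le) (hV.1 j hj).continuousOn).2 (hp j hj)⟩

theorem PerJet.lin {m : ℕ} {V W : ℕ → ℝ → ℝ} (H : PerJet m V) (K : PerJet m W) (a b : ℝ) :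
    PerJet m fun j x => a * V j x + b * W j x :=
  ⟨H.1.lin K.1 a b, fun j hj => by simp only [H.2 j hj, K.2 j hj]⟩

/-! ### The L² and H² norms and products of jets -/

/-- The `L²(0,1)` norm. -/
def l2 (f : ℝ → ℝ) : ℝ := Real.sqrt (∫ x, f x ^ 2 ∂unitMeasure)

theorem l2_nonneg (f : ℝ → ℝ) : 0 ≤ l2 f := Real.sqrt_nonneg _

theorem l2_sq (f : ℝ → ℝ) : l2 f ^ 2 = ∫ x, f x ^ 2 ∂unitMeasure :=
  Real.sq_sqrt (integral_nonneg fun _ => sq_nonneg _)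

theorem inner_toLp {f g : ℝ → ℝ} (hf : MemLp f 2 unitMeasure) (hg : MemLp g 2 unitMeasure) :
    inner ℝ (hf.toLp f) (hg.toLp g) = ∫ x, f x * g x ∂unitMeasure := by
  rw [L2.inner_def]
  refine integral_congr_ae ?_
  filter_upwards [hf.coeFn_toLp, hg.coeFn_toLp] with x h1 h2
  rw [h1, h2]
  simp [mul_comm]

theorem l2_eq_norm {f : ℝ → ℝ} (hf : MemLp f 2 unitMeasure) : l2 f = ‖hf.toLp f‖ := by
  rw [← sq_eq_sq₀ (l2_nonneg f) (norm_nonneg _), l2_sq, ← real_inner_self_eq_norm_sq,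
    inner_toLp hf hf]
  simp only [sq]

theorem l2_add_le {f g : ℝ → ℝ} (hf : MemLp f 2 unitMeasure) (hg : MemLp g 2 unitMeasure) :
    l2 (fun x => f x + g x) ≤ l2 f + l2 g := by
  have : l2 (fun x => f x + g x) = ‖(hf.add hg).toLp (f + g)‖ := l2_eq_norm (hf.add hg)
  rw [this, l2_eq_norm hf, l2_eq_norm hg, MemLp.toLp_add]
  exact norm_add_le _ _

theorem abs_integral_mul_le {f g : ℝ → ℝ} (hf : MemLp f 2 unitMeasure)
    (hg : MemLp g 2 unitMeasure) : |∫ x, f x * g x ∂unitMeasure| ≤ l2 f * l2 g := by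
  rw [← inner_toLp hf hg, l2_eq_norm hf, l2_eq_norm hg]
  exact abs_real_inner_le_norm _ _

theorem l2_congr {f g : ℝ → ℝ} (h : f =ᵐ[unitMeasure] g) : l2 f = l2 g := by
  unfold l2
  congr 1
  exact integral_congr_ae (by filter_upwards [h] with x hx; rw [hx])

theorem l2_mono {f g : ℝ → ℝ} (hg : MemLp g 2 unitMeasure)
    (h : ∀ᵐ x ∂unitMeasure, |f x| ≤ |g x|) : l2 f ≤ l2 g := by
  refine Real.sqrt_le_sqrt (integral_mono_of_nonneg (ae_of_all _ fun _ => sq_nonneg _)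
    hg.integrable_sq ?_)
  filter_upwards [h] with x hx
  exact sq_le_sq.2 hx

theorem l2_const_mul (c : ℝ) (f : ℝ → ℝ) : l2 (fun x => c * f x) = |c| * l2 f := by
  unfold l2
  simp only [mul_pow]
  rw [integral_const_mul, Real.sqrt_mul (sq_nonneg c), Real.sqrt_sq_eq_abs]

/-- Multiplication by a function bounded on `[0,1]`. -/
theorem l2_mul_le {f g : ℝ → ℝ} {c : ℝ} (hc : 0 ≤ c) (hf : ∀ x ∈ Icc (0 : ℝ) 1, |f x| ≤ c)
    (hg : MemLp g 2 unitMeasure) : l2 (fun x => f x * g x) ≤ c * l2 g := by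
  have h := l2_const_mul c g
  rw [abs_of_nonneg hc] at h
  rw [← h]
  refine l2_mono (hg.const_mul c) (ae_unitMeasure_of_forall fun x hx => ?_)
  rw [abs_mul, abs_mul, abs_of_nonneg hc]
  exact mul_le_mul_of_nonneg_right (hf x hx) (abs_nonneg _)

theorem memLp_mul {f g : ℝ → ℝ} (hf : ContinuousOn f (Icc 0 1)) (hg : MemLp g 2 unitMeasure) :
    MemLp (fun x => f x * g x) 2 unitMeasure := by
  obtain ⟨c, hc⟩ := isCompact_Icc.exists_bound_of_continuousOn hf
  refine (hg.const_mul |c|).mono ?_ (ae_unitMeasure_of_forall fun x hx => ?_)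
  · exact ((hf.mono Ioo_subset_Icc_self).aestronglyMeasurable measurableSet_Ioo).mul
      hg.aestronglyMeasurable
  · rw [norm_mul, norm_mul, Real.norm_eq_abs |c|, abs_abs]
    exact mul_le_mul_of_nonneg_right ((hc x hx).trans (le_abs_self c)) (norm_nonneg _)

theorem Jet.h2norm_sq {V : ℕ → ℝ → ℝ} (H : Jet 2 V) {v : ℝ → ℝ} (hv : v =ᵐ[unitMeasure] V 0) :
    h2norm v ^ 2 = l2 (V 0) ^ 2 + l2 (V 1) ^ 2 + l2 (V 2) ^ 2 := by
  rw [h2norm, Real.sq_sqrt (Finset.sum_nonneg fun j _ => integral_nonneg fun _ => sq_nonneg _)]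
  have e : ∀ j ≤ 2, ∫ x, (weakDeriv^[j] v x) ^ 2 ∂unitMeasure = l2 (V j) ^ 2 := fun j hj => by
    rw [l2_sq]
    exact integral_congr_ae (by filter_upwards [(H.memSobolev hv).2 j hj] with x hx; rw [hx])
  simp only [Finset.sum_range_succ, Finset.sum_range_zero, zero_add]
  rw [e 0 (by omega), e 1 (by omega), e 2 (by omega)]

theorem h2norm_nonneg (v : ℝ → ℝ) : 0 ≤ h2norm v := Real.sqrt_nonneg _

theorem Jet.l2_le_h2norm {V : ℕ → ℝ → ℝ} (H : Jet 2 V) {v : ℝ → ℝ} (hv : v =ᵐ[unitMeasure] V 0)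
    {j : ℕ} (hj : j ≤ 2) : l2 (V j) ≤ h2norm v := by
  refine abs_le_of_sq_le_sq' ?_ (h2norm_nonneg v) |>.2
  rw [H.h2norm_sq hv]
  interval_cases j <;> nlinarith [sq_nonneg (l2 (V 0)), sq_nonneg (l2 (V 1)), sq_nonneg (l2 (V 2))]

/-- The jet of a product. -/
def mulJet (V W : ℕ → ℝ → ℝ) : ℕ → ℝ → ℝ
  | 0 => fun x => V 0 x * W 0 x
  | 1 => fun x => V 1 x * W 0 x + V 0 x * W 1 x
  | _ => fun x => V 2 x * W 0 x + 2 * (V 1 x * W 1 x) + V 0 x * W 2 x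

theorem Jet.mul {V W : ℕ → ℝ → ℝ} (H : Jet 2 V) (K : Jet 2 W) : Jet 2 (mulJet V W) := by
  have h0 := H.1 0 (by omega)
  have h1 := H.1 1 (by omega)
  have k0 := K.1 0 (by omega)
  have k1 := K.1 1 (by omega)
  refine ⟨fun j hj => ?_, ?_⟩
  · interval_cases j
    · exact h0.mul k0
    · refine ((h1.mul k0).add (h0.mul k1)).congr_deriv (ae_of_all _ fun x => ?_)
      simp only [mulJet]
      ring
  · have e1 := memLp_mul k0.continuousOn H.2
    have e2 := memLp_mul h1.continuousOn (k1.memLp (p := 2))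
    have e3 := memLp_mul h0.continuousOn K.2
    refine ((e1.add (e2.const_mul 2)).add e3).ae_eq (ae_of_all _ fun x => ?_)
    simp only [mulJet, Pi.add_apply]
    ring

/-! ### Complex-valued primitives -/

section Complex

theorem IsPrim.clm_comp {E F : Type*} [NormedAddCommGroup E] [NormedSpace ℝ E]
    [NormedAddCommGroup F] [NormedSpace ℝ F] [CompleteSpace E] [CompleteSpace F] {v h : ℝ → E}
    (H : IsPrim v h) (A : E →L[ℝ] F) : IsPrim (fun x => A (v x)) (fun x => A (h x)) := by
  have hi : IntervalIntegrable (fun x => A (h x)) volume 0 1 :=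
    intervalIntegrable_iff_unitMeasure.2 (A.integrable_comp (intervalIntegrable_iff_unitMeasure.1 H.1))
  refine ⟨hi, fun x hx => ?_⟩
  rw [A.intervalIntegral_comp_comm (intervalIntegrable_sub_interval H.1 (by simp) hx), ← map_add,
    ← H.2 x hx]

theorem IsPrim.ofReal {v h : ℝ → ℝ} (H : IsPrim v h) :
    IsPrim (fun x => (v x : ℂ)) (fun x => (h x : ℂ)) := H.clm_comp Complex.ofRealCLM

theorem IsPrim.re {v h : ℝ → ℂ} (H : IsPrim v h) :
    IsPrim (fun x => (v x).re) (fun x => (h x).re) := H.clm_comp Complex.reCLM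

theorem IsPrim.im {v h : ℝ → ℂ} (H : IsPrim v h) :
    IsPrim (fun x => (v x).im) (fun x => (h x).im) := H.clm_comp Complex.imCLM

/-- Reduces to the real product rule through real and imaginary parts. -/
theorem IsPrim.cmul {v h w k : ℝ → ℂ} (H : IsPrim v h) (K : IsPrim w k) :
    IsPrim (fun x => v x * w x) (fun x => h x * w x + v x * k x) := by
  have h1 := ((H.re.mul K.re).sub (H.im.mul K.im)).ofReal
  have h2 := (((H.re.mul K.im).add (H.im.mul K.re)).ofReal).const_mul Complex.I
  have := h1.add h2
  convert this using 1 <;> funext x <;> apply Complex.ext <;> simp <;> ring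

theorem isPrim_cexp (α : ℂ) :
    IsPrim (fun x : ℝ => Complex.exp (α * x)) (fun x : ℝ => α * Complex.exp (α * x)) := by
  refine isPrim_of_hasDerivAt (fun x => ?_) (by fun_prop)
  have h1 : HasDerivAt (fun x : ℂ => Complex.exp (α * x)) (Complex.exp (α * x) * (α * 1)) (x : ℂ) :=
    ((hasDerivAt_id _).const_mul _).cexp
  have h2 := h1.comp_ofReal
  rwa [mul_one, mul_comm] at h2

end Complex

/-! ### Supremum bounds and Wirtinger's inequality -/

theorem integral_abs_le_l2 {f : ℝ → ℝ} (hf : MemLp f 2 unitMeasure) :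
    ∫ x, |f x| ∂unitMeasure ≤ l2 f := by
  have h1 : MemLp (fun _ : ℝ => (1 : ℝ)) 2 unitMeasure := memLp_const 1
  have h2 : MemLp (fun x => |f x|) 2 unitMeasure := hf.abs
  have := (le_abs_self _).trans (abs_integral_mul_le h2 h1)
  simp only [mul_one] at this
  refine this.trans (le_of_eq ?_)
  simp [l2]

theorem abs_intervalIntegral_le {h : ℝ → ℝ} {x y : ℝ} (hxy : x ≤ y) :
    |∫ t in x..y, h t| ≤ ∫ t in x..y, |h t| :=
  intervalIntegral.abs_integral_le_integral_abs hxy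

/-- A periodic function with a zero is bounded by half the total variation. -/
theorem IsPrim.abs_le_of_periodic {v h : ℝ → ℝ} (H : IsPrim v h) (hh : MemLp h 2 unitMeasure)
    (hp : v 0 = v 1) {x₀ : ℝ} (hx₀ : x₀ ∈ Icc (0 : ℝ) 1) (hz : v x₀ = 0) {x : ℝ}
    (hx : x ∈ Icc (0 : ℝ) 1) : |v x| ≤ 1 / 2 * l2 h := by
  have key : ∀ a b : ℝ, a ∈ Icc (0 : ℝ) 1 → b ∈ Icc (0 : ℝ) 1 → a ≤ b →
      |v b - v a| ≤ 1 / 2 * l2 h := by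
    intro a b ha hb hab
    have h0 : (0 : ℝ) ∈ Icc (0 : ℝ) 1 := by simp
    have h1 : (1 : ℝ) ∈ Icc (0 : ℝ) 1 := by simp
    have e1 : |v b - v a| ≤ ∫ t in a..b, |h t| := by
      rw [H.sub_eq ha hb]; exact abs_intervalIntegral_le hab
    have e2 : |v a - v 0| ≤ ∫ t in (0 : ℝ)..a, |h t| := by
      rw [H.sub_eq h0 ha]; exact abs_intervalIntegral_le ha.1
    have e3 : |v 1 - v b| ≤ ∫ t in b..1, |h t| := by
      rw [H.sub_eq hb h1]; exact abs_intervalIntegral_le hb.2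
    have e4 := integral_abs_le_l2 hh
    have hi := H.1.abs
    rw [integral_unitMeasure, ← intervalIntegral.integral_add_adjacent_intervals
      (intervalIntegrable_sub_interval hi h0 ha) (intervalIntegrable_sub_interval hi ha h1),
      ← intervalIntegral.integral_add_adjacent_intervals
      (intervalIntegrable_sub_interval hi ha hb) (intervalIntegrable_sub_interval hi hb h1)] at e4
    -- On the circle, `b` is reached from `a` along either arc. The two variations add up to at most
    -- `l2 h`, so the smaller one is at most half of it.
    have e5 : |v b - v a| ≤ |v a - v 0| + |v 1 - v b| := by
      have : v b - v a = -((v a - v 0) + (v 1 - v b)) := by rw [hp]; ring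
      rw [this, abs_neg]
      exact abs_add_le _ _
    linarith
  rcases le_total x₀ x with h | h
  · simpa [hz] using key x₀ x hx₀ hx h
  · simpa [hz] using key x x₀ hx hx₀ h

theorem exists_zero_of_integral_eq_zero {v : ℝ → ℝ} (hv : ContinuousOn v (Icc 0 1))
    (h : ∫ x, v x ∂unitMeasure = 0) : ∃ x ∈ Icc (0 : ℝ) 1, v x = 0 := by
  by_contra! hne
  have hi : IntervalIntegrable v volume 0 1 :=
    ContinuousOn.intervalIntegrable (by rwa [uIcc_of_le zero_le_one])
  rw [integral_unitMeasure] at h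
  have hc : ∀ x ∈ Icc (0 : ℝ) 1, ∀ y ∈ Icc (0 : ℝ) 1, v x < 0 → 0 < v y → False := by
    intro x hx y hy h1 h2
    obtain ⟨z, hz, hz'⟩ := isPreconnected_Icc.intermediate_value hx hy hv ⟨h1.le, h2.le⟩
    exact hne z hz hz'
  have h0 : (0 : ℝ) ∈ Icc (0 : ℝ) 1 := by simp
  rcases lt_or_gt_of_ne (hne 0 h0) with hneg | hpos
  · have : 0 < ∫ x in (0 : ℝ)..1, -v x :=
      intervalIntegral.intervalIntegral_pos_of_pos_on hi.neg (fun x hx => by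
        have hx' := Ioo_subset_Icc_self hx
        rcases lt_or_gt_of_ne (hne x hx') with h' | h'
        · simpa using h'
        · exact (hc 0 h0 x hx' hneg h').elim) zero_lt_one
    rw [intervalIntegral.integral_neg] at this
    linarith
  · have : 0 < ∫ x in (0 : ℝ)..1, v x :=
      intervalIntegral.intervalIntegral_pos_of_pos_on hi (fun x hx => by
        have hx' := Ioo_subset_Icc_self hx
        rcases lt_or_gt_of_ne (hne x hx') with h' | h'
        · exact (hc x hx' 0 h0 h' hpos).elim
        · exact h') zero_lt_one
    linarith

theorem IsPrim.abs_le_of_mean_zero {v h : ℝ → ℝ} (H : IsPrim v h) (hh : MemLp h 2 unitMeasure)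
    (hp : v 0 = v 1) (hm : ∫ x, v x ∂unitMeasure = 0) {x : ℝ}
    (hx : x ∈ Icc (0 : ℝ) 1) : |v x| ≤ 1 / 2 * l2 h := by
  obtain ⟨x₀, hx₀, hz⟩ := exists_zero_of_integral_eq_zero H.continuousOn hm
  exact H.abs_le_of_periodic hh hp hx₀ hz hx

theorem hasSum_sq_fourierCoeffOn_ofReal {v : ℝ → ℝ} (hv : MemLp v 2 unitMeasure) :
    HasSum (fun i => ‖fourierCoeffOn (zero_lt_one' ℝ) (fun x => (v x : ℂ)) i‖ ^ 2) (l2 v ^ 2) := by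
  have h1 : MemLp (fun x => (v x : ℂ)) 2 (volume.restrict (Ioc (0 : ℝ) 1)) := by
    rw [← unitMeasure_eq]; exact hv.ofReal
  have := hasSum_sq_fourierCoeffOn (zero_lt_one' ℝ) h1
  simpa [l2_sq, integral_unitMeasure] using this

/-- Differentiation multiplies the Fourier coefficients by `2πin`. -/
theorem IsPrim.fourierCoeffOn_deriv {v h : ℝ → ℂ} (H : IsPrim v h) (hp : v 0 = v 1) (n : ℤ) :
    fourierCoeffOn (zero_lt_one' ℝ) h n =
      2 * Real.pi * Complex.I * n * fourierCoeffOn (zero_lt_one' ℝ) v n := by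
  rw [fourierCoeffOn_eq_integral, fourierCoeffOn_eq_integral]
  simp only [fourier_coe_apply, smul_eq_mul]
  have hE := isPrim_cexp (-(2 * Real.pi * Complex.I * n))
  have e1 : Complex.exp (-(2 * Real.pi * Complex.I * n) * (1 : ℝ)) = 1 := by
    rw [Complex.exp_eq_one_iff]
    exact ⟨-n, by push_cast; ring⟩
  have hP := hE.cmul H
  have h2 := hP.sub_eq (x := 0) (y := 1) (by simp) (by simp)
  rw [e1, ← hp] at h2
  have hu : uIcc (0 : ℝ) 1 = Icc 0 1 := uIcc_of_le zero_le_one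
  rw [intervalIntegral.integral_add] at h2
  · simp only [mul_assoc, intervalIntegral.integral_const_mul] at h2
    simp only [Complex.ofReal_zero, mul_zero, Complex.exp_zero, one_mul, sub_self] at h2
    have e : ∀ x : ℝ, Complex.exp (2 * Real.pi * Complex.I * ((-n : ℤ) : ℂ) * x / ((1 - 0 : ℝ) : ℂ))
      = Complex.exp (-(2 * (Real.pi * (Complex.I * n))) * x) := fun x => by
      congr 1; push_cast; ring
    simp only [e]
    simp only [sub_zero, div_one, one_smul]
    linear_combination -h2
  · exact hE.1.mul_continuousOn (hu ▸ H.continuousOn)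
  · exact H.1.continuousOn_mul (hu ▸ hE.continuousOn)

/-- Wirtinger's inequality. -/
theorem IsPrim.wirtinger {v h : ℝ → ℝ} (H : IsPrim v h) (hh : MemLp h 2 unitMeasure)
    (hp : v 0 = v 1) (hm : ∫ x, v x ∂unitMeasure = 0) : 2 * Real.pi * l2 v ≤ l2 h := by
  refine abs_le_of_sq_le_sq' ?_ (l2_nonneg h) |>.2
  have h1 := (hasSum_sq_fourierCoeffOn_ofReal (H.memLp (p := 2))).mul_left ((2 * Real.pi) ^ 2)
  have h2 := hasSum_sq_fourierCoeffOn_ofReal hh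
  rw [mul_pow]
  refine hasSum_le (fun n => ?_) h1 h2
  rw [H.ofReal.fourierCoeffOn_deriv (by rw [hp]) n]
  -- Parseval's sums are compared term by term: the zeroth coefficient of `v` is its mean, which
  -- vanishes, and for the others `|2πn| ≥ 2π`.
  rcases eq_or_ne n 0 with rfl | hn
  · have : fourierCoeffOn (zero_lt_one' ℝ) (fun x => (v x : ℂ)) 0 = 0 := by
      rw [fourierCoeffOn_eq_integral]
      simp only [neg_zero, fourier_zero, one_smul, sub_zero, div_one]
      rw [intervalIntegral.integral_ofReal, ← integral_unitMeasure, hm]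
      rfl
    rw [this]
    simp
  · rw [norm_mul, mul_pow ‖(2 * Real.pi * Complex.I * n : ℂ)‖]
    refine mul_le_mul_of_nonneg_right ?_ (by positivity)
    have e : ‖(2 * Real.pi * Complex.I * n : ℂ)‖ = 2 * Real.pi * |(n : ℝ)| := by
      simp [abs_of_pos Real.pi_pos]
    rw [e]
    have : (1 : ℝ) ≤ |(n : ℝ)| := by exact_mod_cast (Int.one_le_abs hn : (1 : ℤ) ≤ |n|)
    refine pow_le_pow_left₀ (by positivity) ?_ 2
    nlinarith [Real.pi_pos]

/-- `|v x|` differs from `|v y|` by at most `∫ |h| ≤ l2 h`; averaging over `y` replaces `|v y|` by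
its mean, at most `l2 v`. -/
theorem IsPrim.abs_le_l2_add {v h : ℝ → ℝ} (H : IsPrim v h) (hh : MemLp h 2 unitMeasure)
    {x : ℝ} (hx : x ∈ Icc (0 : ℝ) 1) : |v x| ≤ l2 v + l2 h := by
  have hi := intervalIntegrable_iff_unitMeasure.1 H.1.abs
  have key : ∀ y ∈ Icc (0 : ℝ) 1, |v x| - l2 h ≤ |v y| := by
    intro y hy
    have e1 : |v x - v y| ≤ l2 h := by
      refine le_trans ?_ (integral_abs_le_l2 hh)
      rw [H.sub_eq hy hx, integral_unitMeasure]
      have hs : uIoc y x ⊆ Ioc 0 1 := by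
        intro t ht
        have ht : min y x < t ∧ t ≤ max y x := ht
        exact ⟨(le_min hy.1 hx.1).trans_lt ht.1, ht.2.trans (max_le hy.2 hx.2)⟩
      rw [intervalIntegral.integral_of_le zero_le_one]
      refine (intervalIntegral.norm_integral_le_integral_norm_uIoc (f := h)).trans ?_
      exact setIntegral_mono_set (by rw [IntegrableOn, ← unitMeasure_eq]; exact hi) (ae_of_all _ fun _ => abs_nonneg _)
        hs.eventuallyLE
    have := abs_sub_abs_le_abs_sub (v x) (v y)
    linarith
  have h2 : |v x| - l2 h ≤ ∫ y, |v y| ∂unitMeasure := by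
    have h3 : Integrable (fun y => |v y|) unitMeasure :=
      (integrable_of_memLp_two H.memLp).abs
    have := integral_mono_ae (integrable_const (|v x| - l2 h)) h3
      (ae_unitMeasure_of_forall key)
    simpa using this
  linarith [integral_abs_le_l2 (H.memLp (p := 2))]

theorem l2_add_le₃ {f g k : ℝ → ℝ} (hf : MemLp f 2 unitMeasure) (hg : MemLp g 2 unitMeasure)
    (hk : MemLp k 2 unitMeasure) : l2 (fun x => f x + g x + k x) ≤ l2 f + l2 g + l2 k :=
  (l2_add_le (hf.add hg) hk).trans (add_le_add_left (l2_add_le hf hg) _)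

/-- Bounds for the second derivative of a product. -/
theorem Jet.l2_mulJet_two_le {V W : ℕ → ℝ → ℝ} (H : Jet 2 V) (K : Jet 2 W) {a b c : ℝ}
    (ha : ∀ x ∈ Icc (0 : ℝ) 1, |V 0 x| ≤ a) (hb : ∀ x ∈ Icc (0 : ℝ) 1, |V 1 x| ≤ b)
    (hc : ∀ x ∈ Icc (0 : ℝ) 1, |W 0 x| ≤ c) :
    l2 (mulJet V W 2) ≤ c * l2 (V 2) + 2 * (b * l2 (W 1)) + a * l2 (W 2) := by
  have h0 := H.1 0 (by omega)
  have h1 := H.1 1 (by omega)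
  have k0 := K.1 0 (by omega)
  have k1 := K.1 1 (by omega)
  have z : (0 : ℝ) ∈ Icc (0 : ℝ) 1 := by simp
  have e1 := memLp_mul k0.continuousOn H.2
  have e2 := (memLp_mul h1.continuousOn (k1.memLp (p := 2))).const_mul 2
  have e3 := memLp_mul h0.continuousOn K.2
  have e : mulJet V W 2 = fun x => W 0 x * V 2 x + 2 * (V 1 x * W 1 x) + V 0 x * W 2 x := by
    funext x; simp only [mulJet]; ring
  rw [e]
  refine (l2_add_le₃ e1 e2 e3).trans ?_
  have i2 := l2_const_mul 2 (fun x => V 1 x * W 1 x)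
  rw [abs_of_pos two_pos] at i2
  rw [i2]
  exact add_le_add_three (l2_mul_le ((abs_nonneg _).trans (hc 0 z)) hc H.2)
    (mul_le_mul_of_nonneg_left
      (l2_mul_le ((abs_nonneg _).trans (hb 0 z)) hb (K.memLp (by omega))) zero_le_two)
    (l2_mul_le ((abs_nonneg _).trans (ha 0 z)) ha K.2)

/-! ### Algebra constants -/

/-- Two components of the H² norm add up to at most `√2 ≤ 3/2` times the norm, which bounds the
suprema. The product and its two derivatives are then bounded by 3/2, 3 and 6 times `N * M`, and 9/4
+ 9 + 36 ≤ 49. -/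
theorem isAlgebraConstant_seven {C : ℝ} (hC : 7 ≤ C) : IsAlgebraConstant C := by
  intro v w hv hw
  obtain ⟨V, ⟨hV, -⟩, v0⟩ := memPeriodicSobolev_iff.1 hv
  obtain ⟨W, ⟨hW, -⟩, w0⟩ := memPeriodicSobolev_iff.1 hw
  have h0 := hV.1 0 (by omega)
  have h1 := hV.1 1 (by omega)
  have k0 := hW.1 0 (by omega)
  have k1 := hW.1 1 (by omega)
  have m1 : MemLp (V 1) 2 unitMeasure := hV.memLp (by omega)
  have n1 : MemLp (W 1) 2 unitMeasure := hW.memLp (by omega)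
  have hvw : (fun x => v x * w x) =ᵐ[unitMeasure] mulJet V W 0 := by
    filter_upwards [v0, w0] with x h1 h2
    simp only [mulJet, h1, h2]
  have hsq := (hV.mul hW).h2norm_sq hvw
  have hN := hV.h2norm_sq v0
  have hM := hW.h2norm_sq w0
  have nN := h2norm_nonneg v
  have nM := h2norm_nonneg w
  set N := h2norm v
  set M := h2norm w
  have sqle : ∀ {a b c n : ℝ}, 0 ≤ n → n ^ 2 = a ^ 2 + b ^ 2 + c ^ 2 →
      a ≤ n ∧ b ≤ n ∧ c ≤ n ∧ a + b ≤ 3 / 2 * n ∧ b + c ≤ 3 / 2 * n := by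
    intro a b c n hn h
    refine ⟨?_, ?_, ?_, ?_, ?_⟩ <;>
    · refine abs_le_of_sq_le_sq' ?_ (by positivity) |>.2
      nlinarith [sq_nonneg a, sq_nonneg b, sq_nonneg c, sq_nonneg (a - b), sq_nonneg (b - c)]
  obtain ⟨a1, a2, a3, a4, a5⟩ := sqle nN hN
  obtain ⟨b1, b2, b3, b4, b5⟩ := sqle nM hM
  have s0 : ∀ x ∈ Icc (0 : ℝ) 1, |V 0 x| ≤ 3 / 2 * N := fun x hx =>
    (h0.abs_le_l2_add m1 hx).trans a4
  have s1 : ∀ x ∈ Icc (0 : ℝ) 1, |V 1 x| ≤ 3 / 2 * N := fun x hx =>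
    (h1.abs_le_l2_add hV.2 hx).trans a5
  have t0 : ∀ x ∈ Icc (0 : ℝ) 1, |W 0 x| ≤ 3 / 2 * M := fun x hx =>
    (k0.abs_le_l2_add n1 hx).trans b4
  have p0 : l2 (mulJet V W 0) ≤ 3 / 2 * N * M :=
    (l2_mul_le (by positivity) s0 k0.memLp).trans
      (mul_le_mul_of_nonneg_left b1 (by positivity))
  have p1 : l2 (mulJet V W 1) ≤ 3 * N * M := by
    have e : mulJet V W 1 = fun x => W 0 x * V 1 x + V 0 x * W 1 x := by
      funext x; simp only [mulJet]; ring
    rw [e]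
    refine (l2_add_le (memLp_mul k0.continuousOn m1) (memLp_mul h0.continuousOn n1)).trans ?_
    have q1 := (l2_mul_le (by positivity) t0 m1).trans
      (mul_le_mul_of_nonneg_left a2 (by positivity))
    have q2 := (l2_mul_le (by positivity) s0 n1).trans
      (mul_le_mul_of_nonneg_left b2 (by positivity))
    linarith
  have p2 : l2 (mulJet V W 2) ≤ 6 * N * M := by
    refine (hV.l2_mulJet_two_le hW s0 s1 t0).trans ?_
    have q1 := mul_le_mul_of_nonneg_left a3 (by positivity : 0 ≤ 3 / 2 * M)
    have q2 := mul_le_mul_of_nonneg_left b2 (by positivity : 0 ≤ 3 / 2 * N)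
    have q3 := mul_le_mul_of_nonneg_left b3 (by positivity : 0 ≤ 3 / 2 * N)
    linarith
  have hNM : 0 ≤ N * M := by positivity
  have r0 := pow_le_pow_left₀ (l2_nonneg _) p0 2
  have r1 := pow_le_pow_left₀ (l2_nonneg _) p1 2
  have r2 := pow_le_pow_left₀ (l2_nonneg _) p2 2
  have h7 : h2norm (fun x => v x * w x) ≤ 7 * (N * M) := by
    refine abs_le_of_sq_le_sq' ?_ (by positivity) |>.2
    rw [hsq]
    nlinarith [sq_nonneg (N * M)]
  nlinarith

theorem isPrim_const (c : ℝ) : IsPrim (fun _ => c) (fun _ => (0 : ℝ)) :=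
  isPrim_of_hasDerivAt (fun x => hasDerivAt_const x c) continuous_const

/-- Test on `v = w = 1`. This bound is the only property of `C` that enters the energy estimates. -/
theorem IsAlgebraConstant.one_le {C : ℝ} (h : IsAlgebraConstant C) : 1 ≤ C := by
  let V : ℕ → ℝ → ℝ := fun j => if j = 0 then fun _ => 1 else fun _ => 0
  have hV : PerJet 2 V := by
    refine ⟨⟨fun j hj => ?_, ?_⟩, fun j hj => ?_⟩
    · interval_cases j
      · exact isPrim_const 1
      · exact isPrim_const 0
    · exact memLp_const 0
    · interval_cases j <;> simp [V]
  have h1 := h (fun _ => 1) (fun _ => 1) (memPeriodicSobolev_iff.2 ⟨V, hV, EventuallyEq.rfl⟩)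
    (memPeriodicSobolev_iff.2 ⟨V, hV, EventuallyEq.rfl⟩)
  have h2 := hV.1.h2norm_sq (v := fun _ => 1) EventuallyEq.rfl
  have h3 : h2norm (fun _ => 1) = 1 := by
    rw [← sq_eq_sq₀ (h2norm_nonneg _) zero_le_one, h2]
    simp [V, l2]
  simpa [h3] using h1

/-! ### Estimates for periodic functions vanishing at the end points -/

/-- A jet of order `m ≥ 2` which is periodic up to order `1` and vanishes at `0`. -/
structure ZeroJet (V : ℕ → ℝ → ℝ) : Prop where
  jet : Jet 2 V
  zero : V 0 0 = 0
  per0 : V 0 0 = V 0 1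
  per1 : V 1 0 = V 1 1

theorem IsPrim.mean_zero {v h : ℝ → ℝ} (H : IsPrim v h) (hp : v 0 = v 1) :
    ∫ x, h x ∂unitMeasure = 0 := by
  rw [integral_unitMeasure]
  exact H.integral_eq_zero_iff.2 hp

namespace ZeroJet

variable {V W : ℕ → ℝ → ℝ}

theorem prim0 (H : ZeroJet V) : IsPrim (V 0) (V 1) := H.jet.1 0 (by omega)

theorem prim1 (H : ZeroJet V) : IsPrim (V 1) (V 2) := H.jet.1 1 (by omega)

theorem l2_one_le (H : ZeroJet V) : 2 * Real.pi * l2 (V 1) ≤ l2 (V 2) :=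
  H.prim1.wirtinger H.jet.2 H.per1 (H.prim0.mean_zero H.per0)

theorem abs_zero_le (H : ZeroJet V) : ∀ x ∈ Icc (0 : ℝ) 1, |V 0 x| ≤ 1 / 2 * l2 (V 1) :=
  fun _ hx => H.prim0.abs_le_of_periodic (H.jet.memLp (by omega)) H.per0 (by simp) H.zero hx

theorem abs_one_le (H : ZeroJet V) : ∀ x ∈ Icc (0 : ℝ) 1, |V 1 x| ≤ 1 / 2 * l2 (V 2) :=
  fun _ hx => H.prim1.abs_le_of_mean_zero H.jet.2 H.per1 (H.prim0.mean_zero H.per0) hx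

theorem l2_zero_le (H : ZeroJet V) : l2 (V 0) ≤ l2 (V 1) := by
  have h : l2 (V 0) ≤ l2 (fun _ => 1 / 2 * l2 (V 1)) :=
    l2_mono (memLp_const _) (ae_unitMeasure_of_forall fun x hx =>
      (H.abs_zero_le x hx).trans (le_abs_self _))
  have e : l2 (fun _ => 1 / 2 * l2 (V 1)) = 1 / 2 * l2 (V 1) := by
    simp [l2]
  linarith [l2_nonneg (V 1)]

/-- The L² norms of `V 0`, `V 1`, `V 2` increase, so the H² norm is at most `√3` times the last.
This turns decay of second derivatives into decay in H². -/
theorem h2norm_le (H : ZeroJet V) {v : ℝ → ℝ} (hv : v =ᵐ[unitMeasure] V 0) :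
    h2norm v ≤ 2 * l2 (V 2) := by
  have h1 := H.l2_one_le
  have h0 := H.l2_zero_le
  have n0 := l2_nonneg (V 0)
  have n1 := l2_nonneg (V 1)
  have n2 := l2_nonneg (V 2)
  have h3 : l2 (V 1) ≤ l2 (V 2) := by nlinarith [Real.pi_gt_three]
  refine abs_le_of_sq_le_sq' ?_ (by positivity) |>.2
  rw [H.jet.h2norm_sq hv]
  nlinarith

/-- The product estimate for functions vanishing at the end points. -/
theorem l2_mul_le (H : ZeroJet V) (K : ZeroJet W) :
    Real.pi * l2 (mulJet V W 2) ≤ l2 (V 2) * l2 (W 2) := by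
  -- With suprema bounded by half the norm of the next derivative and Wirtinger for `V 1` and `W 1`,
  -- the three terms contribute 1/(4π), 1/(2π) and 1/(4π), in total 1/π.
  have h1 := H.jet.l2_mulJet_two_le K.jet H.abs_zero_le H.abs_one_le K.abs_zero_le
  have i1 := mul_le_mul_of_nonneg_left H.l2_one_le (l2_nonneg (W 2))
  have i2 := mul_le_mul_of_nonneg_left K.l2_one_le (l2_nonneg (V 2))
  have := mul_le_mul_of_nonneg_left h1 Real.pi_pos.le
  linarith

theorem lin (H : ZeroJet V) (K : ZeroJet W) (a b : ℝ) :
    ZeroJet fun j x => a * V j x + b * W j x :=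
  ⟨H.jet.lin K.jet a b, by simp [H.zero, K.zero], by simp only [H.per0, K.per0],
    by simp only [H.per1, K.per1]⟩

end ZeroJet

/-! ### Solutions as curves in L² and the energy inequality -/

open Classical in
/-- The class of a function in `L²(0,1)`, zero if it is not square integrable. -/
def lpOf (f : ℝ → ℝ) : Lp ℝ 2 unitMeasure := if h : MemLp f 2 unitMeasure then h.toLp f else 0

theorem lpOf_eq {f : ℝ → ℝ} (h : MemLp f 2 unitMeasure) : lpOf f = h.toLp f := dif_pos h

theorem norm_lpOf {f : ℝ → ℝ} (h : MemLp f 2 unitMeasure) : ‖lpOf f‖ = l2 f := by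
  rw [lpOf_eq h, l2_eq_norm h]

theorem inner_lpOf {f g : ℝ → ℝ} (hf : MemLp f 2 unitMeasure) (hg : MemLp g 2 unitMeasure) :
    inner ℝ (lpOf f) (lpOf g) = ∫ x, f x * g x ∂unitMeasure := by
  rw [lpOf_eq hf, lpOf_eq hg, inner_toLp hf hg]

theorem memLp_sub {f g : ℝ → ℝ} (hf : MemLp f 2 unitMeasure) (hg : MemLp g 2 unitMeasure) :
    MemLp (fun x => f x - g x) 2 unitMeasure := hf.sub hg

theorem lpOf_sub {f g : ℝ → ℝ} (hf : MemLp f 2 unitMeasure) (hg : MemLp g 2 unitMeasure) :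
    lpOf f - lpOf g = lpOf fun x => f x - g x := by
  rw [lpOf_eq hf, lpOf_eq hg, ← MemLp.toLp_sub, ← lpOf_eq]
  rfl

theorem lpOf_smul {f : ℝ → ℝ} (hf : MemLp f 2 unitMeasure) (c : ℝ) :
    c • lpOf f = lpOf fun x => c * f x := by
  rw [lpOf_eq hf, ← MemLp.toLp_const_smul, ← lpOf_eq]
  rfl

/-- Differentiability of a curve in `H²` gives differentiability in `L²` of each derivative. -/
theorem HasDerivAtH2.hasDerivAt_lpOf {u : ℝ → ℝ → ℝ} {U : ℝ → ℕ → ℝ → ℝ} {g : ℝ → ℝ}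
    {G : ℕ → ℝ → ℝ} {t : ℝ} (ht : 0 < t) (hU : ∀ s, 0 ≤ s → Jet 2 (U s))
    (hu : ∀ s, 0 ≤ s → u s =ᵐ[unitMeasure] U s 0) (hG : Jet 2 G) (hg : g =ᵐ[unitMeasure] G 0)
    (H : HasDerivAtH2 u g t) {j : ℕ} (hj : j ≤ 2) :
    HasDerivAt (fun s => lpOf (U s j)) (lpOf (G j)) t := by
  rw [hasDerivAt_iff_tendsto_slope_zero, tendsto_iff_norm_sub_tendsto_zero]
  refine squeeze_zero' (Eventually.of_forall fun _ => norm_nonneg _) ?_ H.2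
  have hev : ∀ᶠ h : ℝ in 𝓝[≠] 0, -t < h :=
    mem_nhdsWithin_of_mem_nhds (Ioi_mem_nhds (by linarith))
  filter_upwards [hev] with h hh
  have hs : 0 ≤ t + h := by linarith
  have J : Jet 2 fun j x => h⁻¹ * (1 * U (t + h) j x + (-1) * U t j x) + (-1) * G j x := by
    simpa using (((hU _ hs).lin (hU t ht.le) 1 (-1)).lin hG h⁻¹ (-1))
  have hae : (fun x => (u (t + h) x - u t x) / h - g x) =ᵐ[unitMeasure]
      fun x => h⁻¹ * (1 * U (t + h) 0 x + (-1) * U t 0 x) + (-1) * G 0 x := by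
    filter_upwards [hu _ hs, hu t ht.le, hg] with x h1 h2 h3
    rw [h1, h2, h3]
    ring
  have m1 := (hU _ hs).memLp hj
  have m2 := (hU t ht.le).memLp hj
  rw [lpOf_sub m1 m2, lpOf_smul (memLp_sub m1 m2), lpOf_sub ((memLp_sub m1 m2).const_mul _) (hG.memLp hj),
    norm_lpOf (memLp_sub ((memLp_sub m1 m2).const_mul _) (hG.memLp hj))]
  refine le_trans (le_of_eq ?_) (J.l2_le_h2norm hae hj)
  congr 1
  funext x
  ring

/-- `U` represents `u ∈ H^{d+2}` together with the boundary conditions of a solution. -/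
structure SolState (d : ℕ) (u : ℝ → ℝ) (U : ℕ → ℝ → ℝ) : Prop where
  jet : Jet (d + 2) U
  ae : ∀ j ≤ d + 2, weakDeriv^[j] u =ᵐ[unitMeasure] U j
  zero : U 0 0 = 0
  per : ∀ j ≤ d, U j 0 = U j 1

theorem SolState.zeroJet {d : ℕ} (hd : 2 ≤ d) {u : ℝ → ℝ} {U : ℕ → ℝ → ℝ} (H : SolState d u U) :
    ZeroJet U :=
  ⟨H.jet.mono (by omega), H.zero, H.per 0 (by omega), H.per 1 (by omega)⟩

section

variable {d : ℕ} {a : ℕ → ℝ} {b : ℕ → ℕ → ℝ} {L : ℝ} {f u : ℝ → ℝ → ℝ}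

theorem IsSolution.exists_solState (H : IsSolution d a b L f u) :
    ∃ U : ℝ → ℕ → ℝ → ℝ, ∀ t, 0 ≤ t → SolState d (u t) (U t) := by
  have : ∀ t, ∃ U : ℕ → ℝ → ℝ, 0 ≤ t → SolState d (u t) U := by
    intro t
    by_cases ht : 0 ≤ t
    · obtain ⟨U, hU, h0, hj⟩ := (H.mem t ht).exists_jet
      refine ⟨U, fun _ => ⟨hU, hj, ?_, fun j hjd => ?_⟩⟩
      · exact (zeroTrace_iff h0 (hU.1 0 (by omega)).continuousOn).1 (H.zero t ht)
      · exact (periodicTrace_iff (hj j (by omega)) (hU.1 j (by omega)).continuousOn).1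
          (H.periodic t ht j hjd)
    · exact ⟨0, fun h => absurd h ht⟩
  choose U hU using this
  exact ⟨U, hU⟩

/-- The time derivative of a solution, as a jet. -/
theorem IsSolution.exists_deriv_jet (hd : 2 ≤ d) (H : IsSolution d a b L f u)
    {U : ℝ → ℕ → ℝ → ℝ} (hU : ∀ t, 0 ≤ t → SolState d (u t) (U t)) {t : ℝ} (ht : 0 < t) :
    ∃ G : ℕ → ℝ → ℝ, Jet 2 G ∧
      (fun x => linOp d a L (u t) x + quadOp d b L (u t) x + f t x) =ᵐ[unitMeasure] G 0 ∧
      G 1 0 = G 1 1 ∧ HasDerivAt (fun s => lpOf (U s 2)) (lpOf (G 2)) t := by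
  have h1 := H.equation t ht
  obtain ⟨G, hG, hg, -⟩ := h1.1.exists_jet
  have hJ : ∀ s, 0 ≤ s → Jet 2 (U s) := fun s hs => (hU s hs).jet.mono (by omega)
  have hder : HasDerivAt (fun s => lpOf (U s 2)) (lpOf (G 2)) t :=
    h1.hasDerivAt_lpOf ht hJ (fun s hs => (hU s hs).ae 0 (by omega)) hG hg le_rfl
  refine ⟨G, hG, hg, ?_, hder⟩
  -- Pairing with the constant 1 gives the mean of the second derivative, zero at all positive times
  -- since `∂ₓu` is periodic. Differentiating in time, `G 2` has mean zero, which is the periodicity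
  -- of `G 1`.
  have m1 : MemLp (fun _ : ℝ => (1 : ℝ)) 2 unitMeasure := memLp_const 1
  have h2 := (hasDerivAt_const t (lpOf fun _ => (1 : ℝ))).inner ℝ hder
  have h3 : (fun s => inner ℝ (lpOf fun _ => (1 : ℝ)) (lpOf (U s 2))) =ᶠ[𝓝 t] fun _ => 0 := by
    filter_upwards [Ioi_mem_nhds ht] with s hs
    have hs' : 0 ≤ s := le_of_lt hs
    rw [inner_lpOf m1 (hJ s hs').2]
    simp only [one_mul]
    exact ((hJ s hs').1 1 (by omega)).mean_zero ((hU s hs').per 1 (by omega))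
  have h4 := h2.unique ((hasDerivAt_const t (0 : ℝ)).congr_of_eventuallyEq h3)
  rw [inner_zero_left, add_zero, inner_lpOf m1 hG.2] at h4
  simp only [one_mul] at h4
  rw [integral_unitMeasure] at h4
  exact (hG.1 1 (by omega)).integral_eq_zero_iff.1 h4

/-- The equation holds only for `t > 0`; this continuity links the energy inequality to the initial
data. -/
theorem IsSolution.continuousWithinAt_zero (hd : 2 ≤ d) (H : IsSolution d a b L f u)
    {U : ℝ → ℕ → ℝ → ℝ} (hU : ∀ t, 0 ≤ t → SolState d (u t) (U t)) :
    ContinuousWithinAt (fun s => lpOf (U s 2)) (Ici 0) 0 := by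
  have hJ : ∀ s, 0 ≤ s → Jet 2 (U s) := fun s hs => (hU s hs).jet.mono (by omega)
  rw [← continuousWithinAt_Ioi_iff_Ici, ContinuousWithinAt, tendsto_iff_norm_sub_tendsto_zero]
  refine squeeze_zero' (Eventually.of_forall fun _ => norm_nonneg _) ?_ H.initial
  filter_upwards [self_mem_nhdsWithin] with t ht
  have ht' : 0 ≤ t := le_of_lt ht
  have J := (hJ t ht').lin (hJ 0 le_rfl) 1 (-1)
  have hae : (fun x => u t x - u 0 x) =ᵐ[unitMeasure]
      fun x => 1 * U t 0 x + (-1) * U 0 0 x := by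
    filter_upwards [(hU t ht').ae 0 (by omega), (hU 0 le_rfl).ae 0 (by omega)] with x h1 h2
    simp only [Function.iterate_zero, id_eq] at h1 h2
    rw [h1, h2]
    ring
  rw [lpOf_sub (hJ t ht').2 (hJ 0 le_rfl).2, norm_lpOf (memLp_sub (hJ t ht').2 (hJ 0 le_rfl).2)]
  refine le_trans (le_of_eq ?_) (J.l2_le_h2norm hae le_rfl)
  congr 1
  funext x
  ring

/-- The `L²` norm of the difference of the second derivatives. -/
def diffTwo (u w : ℝ → ℝ) : ℝ := l2 fun x => weakDeriv^[2] u x - weakDeriv^[2] w x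

/-- The `L²` norm of the sum of the second derivatives. -/
def sumTwo (u w : ℝ → ℝ) : ℝ := l2 fun x => weakDeriv^[2] u x + weakDeriv^[2] w x

/-- The energy inequality satisfied by the right-hand side of the equation. -/
def IsDissipative (d : ℕ) (a : ℕ → ℝ) (b : ℕ → ℕ → ℝ) (L β μ : ℝ) : Prop :=
  ∀ (u w : ℝ → ℝ) (U W F G : ℕ → ℝ → ℝ), SolState d u U → SolState d w W → PerJet 2 F →
    Jet 2 G → G 1 0 = G 1 1 →
    G 0 =ᵐ[unitMeasure] (fun x => linOp d a L u x + quadOp d b L u x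
      - (linOp d a L w x + quadOp d b L w x) + F 0 x) →
    μ * sumTwo u w ≤ β →
    ∫ x, (U 2 x - W 2 x) * G 2 x ∂unitMeasure ≤
      -(β - μ * sumTwo u w) * diffTwo u w ^ 2 + l2 (F 2) * diffTwo u w

theorem diffTwo_eq {u w : ℝ → ℝ} {U W : ℕ → ℝ → ℝ} (hU : SolState d u U) (hW : SolState d w W) :
    diffTwo u w = l2 fun x => U 2 x - W 2 x := by
  refine l2_congr ?_
  filter_upwards [hU.ae 2 (by omega), hW.ae 2 (by omega)] with x h1 h2
  rw [h1, h2]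

theorem sumTwo_eq {u w : ℝ → ℝ} {U W : ℕ → ℝ → ℝ} (hU : SolState d u U) (hW : SolState d w W) :
    sumTwo u w = l2 fun x => U 2 x + W 2 x := by
  refine l2_congr ?_
  filter_upwards [hU.ae 2 (by omega), hW.ae 2 (by omega)] with x h1 h2
  rw [h1, h2]

/-- The two solutions may have different forcings. The choice `w = 0`, `k = 0` gives the a priori
bound, and `k = f` with `Fm = 0` gives the contraction. -/
theorem IsDissipative.energy {β μ Fm : ℝ} (hD : IsDissipative d a b L β μ) (hd : 2 ≤ d)
    {k w : ℝ → ℝ → ℝ}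
    (hu : IsSolution d a b L f u) (hw : IsSolution d a b L k w)
    (hF : ∀ t, 0 ≤ t → MemPeriodicSobolev 2 (f t) ∧ MemPeriodicSobolev 2 (k t) ∧
      h2norm (fun x => f t x - k t x) ≤ Fm) :
    ContinuousOn (fun t => diffTwo (u t) (w t) ^ 2) (Ici 0) ∧
    ∀ t, 0 < t → μ * sumTwo (u t) (w t) ≤ β →
      ∃ E', HasDerivAt (fun t => diffTwo (u t) (w t) ^ 2) E' t ∧
        E' ≤ 2 * (-(β - μ * sumTwo (u t) (w t)) * diffTwo (u t) (w t) ^ 2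
          + Fm * diffTwo (u t) (w t)) := by
  obtain ⟨U, hU⟩ := hu.exists_solState
  obtain ⟨W, hW⟩ := hw.exists_solState
  have mU : ∀ t, 0 ≤ t → MemLp (U t 2) 2 unitMeasure := fun t ht => (hU t ht).jet.memLp (by omega)
  have mW : ∀ t, 0 ≤ t → MemLp (W t 2) 2 unitMeasure := fun t ht => (hW t ht).jet.memLp (by omega)
  have e : ∀ t, 0 ≤ t → diffTwo (u t) (w t) ^ 2 = ‖lpOf (U t 2) - lpOf (W t 2)‖ ^ 2 := by
    intro t ht
    rw [lpOf_sub (mU t ht) (mW t ht), norm_lpOf (memLp_sub (mU t ht) (mW t ht)),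
      diffTwo_eq (hU t ht) (hW t ht)]
  -- Differentiability is kept separate from the bound on the derivative because continuity is
  -- needed also at times where `μ * sumTwo` exceeds `β`.
  have hder : ∀ t, 0 < t → ∃ E', HasDerivAt (fun t => diffTwo (u t) (w t) ^ 2) E' t ∧
      (μ * sumTwo (u t) (w t) ≤ β → E' ≤ 2 * (-(β - μ * sumTwo (u t) (w t)) *
        diffTwo (u t) (w t) ^ 2 + Fm * diffTwo (u t) (w t))) := by
    intro t ht
    obtain ⟨G, jG, aG, pG, dG⟩ := hu.exists_deriv_jet hd hU ht
    obtain ⟨K, jK, aK, pK, dK⟩ := hw.exists_deriv_jet hd hW ht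
    have hd1 := (dG.sub dK).norm_sq
    refine ⟨_, hd1.congr_of_eventuallyEq ?_, fun hμ => ?_⟩
    · filter_upwards [Ioi_mem_nhds ht] with s hs using e s (le_of_lt hs)
    · obtain ⟨hf, hk, hfk⟩ := hF t ht.le
      obtain ⟨P, hP, aP⟩ := memPeriodicSobolev_iff.1 hf
      obtain ⟨R, hR, aR⟩ := memPeriodicSobolev_iff.1 hk
      have hmain := hD (u t) (w t) (U t) (W t) _ _ (hU t ht.le) (hW t ht.le)
        (hP.lin hR 1 (-1)) (jG.lin jK 1 (-1)) (by simp only [pG, pK]) (by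
          filter_upwards [aG, aK, aP, aR] with x h1 h2 h3 h4
          rw [← h1, ← h2, h3, h4]
          ring) hμ
      have hl : l2 (fun x => 1 * P 2 x + (-1) * R 2 x) ≤ Fm := by
        refine le_trans ((hP.1.lin hR.1 1 (-1)).l2_le_h2norm (v := fun x => f t x - k t x) ?_
          le_rfl) hfk
        filter_upwards [aP, aR] with x h1 h2
        rw [h1, h2]
        ring
      have hn : 0 ≤ diffTwo (u t) (w t) := l2_nonneg _
      have h5 := mul_le_mul_of_nonneg_right hl hn
      have hi : inner ℝ (lpOf (U t 2) - lpOf (W t 2)) (lpOf (G 2) - lpOf (K 2)) =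
          ∫ x, (U t 2 x - W t 2 x) * (1 * G 2 x + (-1) * K 2 x) ∂unitMeasure := by
        rw [lpOf_sub (mU t ht.le) (mW t ht.le), lpOf_sub jG.2 jK.2,
          inner_lpOf (memLp_sub (mU t ht.le) (mW t ht.le)) (memLp_sub jG.2 jK.2)]
        congr 1
        funext x
        ring
      simp only [Pi.sub_apply]
      rw [hi]
      linarith
  refine ⟨fun t ht => ?_, fun t ht hμ => ?_⟩
  · rcases eq_or_lt_of_le (show (0 : ℝ) ≤ t from ht) with rfl | ht'
    · have := ((hu.continuousWithinAt_zero hd hU).sub (hw.continuousWithinAt_zero hd hW)).norm.pow 2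
      exact this.congr (fun s hs => e s hs) (e 0 le_rfl)
    · obtain ⟨E', h1, -⟩ := hder t ht'
      exact h1.continuousAt.continuousWithinAt
  · obtain ⟨E', h1, h2⟩ := hder t ht
    exact ⟨E', h1, h2 hμ⟩

end

/-! ### Barrier and decay arguments for scalar functions -/

/-- A barrier argument: a function that decreases whenever it reaches the level `c` stays below. -/
theorem lt_of_barrier {E : ℝ → ℝ} {c : ℝ} (hc : ContinuousOn E (Ici 0)) (h0 : E 0 < c)
    (h : ∀ t, 0 < t → E t = c → ∃ E', HasDerivAt E E' t ∧ E' < 0) : ∀ t, 0 ≤ t → E t < c := by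
  intro t ht
  by_contra! hn
  have hK : IsCompact (Icc 0 t ∩ E ⁻¹' Ici c) :=
    isCompact_Icc.of_isClosed_subset
      ((hc.mono Icc_subset_Ici_self).preimage_isClosed_of_isClosed isClosed_Icc isClosed_Ici)
      inter_subset_left
  obtain ⟨s, ⟨hs1, hs2⟩, hs3⟩ := hK.exists_isLeast ⟨t, ⟨ht, le_rfl⟩, hn⟩
  have hs0 : 0 < s := by
    rcases hs1.1.lt_or_eq with h' | h'
    · exact h'
    · rw [← h'] at hs2
      exact absurd h0 (not_lt.2 hs2)
  have hlt : ∀ r, 0 ≤ r → r < s → E r < c := by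
    intro r hr hrs
    by_contra! h'
    exact absurd (hs3 ⟨⟨hr, hrs.le.trans hs1.2⟩, h'⟩) (not_le.2 hrs)
  have hev : ∀ᶠ r in 𝓝[<] s, 0 ≤ r ∧ r < s := by
    filter_upwards [mem_nhdsWithin_of_mem_nhds (Ioi_mem_nhds hs0), self_mem_nhdsWithin] with r h1 h2
    exact ⟨le_of_lt h1, h2⟩
  have hEs : E s = c := by
    refine le_antisymm ?_ hs2
    have h1 : Tendsto E (𝓝[<] s) (𝓝 (E s)) :=
      ((hc.continuousAt (Ici_mem_nhds hs0)).tendsto).mono_left nhdsWithin_le_nhds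
    refine le_of_tendsto h1 ?_
    filter_upwards [hev] with r hr using (hlt r hr.1 hr.2).le
  obtain ⟨E', hE, hneg⟩ := h s hs0 hEs
  have hss : Iio s ⊆ {s}ᶜ := fun r hr => ne_of_lt hr
  have h2 := (hasDerivAt_iff_tendsto_slope.1 hE).mono_left (nhdsWithin_mono s hss)
  -- At the first time `s` with `E s = c`, difference quotients from the left are positive because
  -- `E r < c` for `r < s`; a negative derivative forbids this.
  obtain ⟨r, hr1, hr2, hr3⟩ := ((h2.eventually (gt_mem_nhds hneg)).and hev).exists
  have h3 := hlt r hr2 hr3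
  rw [slope_def_field, hEs, div_neg_iff] at hr1
  rcases hr1 with ⟨_, h4⟩ | ⟨_, h4⟩ <;> linarith

/-- Grönwall's argument: `exp (κ t) * E t` is nonincreasing. -/
theorem tendsto_zero_of_deriv_le {E : ℝ → ℝ} {κ : ℝ} (hκ : 0 < κ) (hc : ContinuousOn E (Ici 0))
    (hE : ∀ t, 0 ≤ t → 0 ≤ E t)
    (h : ∀ t, 0 < t → ∃ E', HasDerivAt E E' t ∧ E' ≤ -κ * E t) : Tendsto E atTop (𝓝 0) := by
  have hanti : AntitoneOn (fun t => Real.exp (κ * t) * E t) (Ici 0) := by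
    have hd : ∀ t, 0 < t → ∃ D, HasDerivAt (fun t => Real.exp (κ * t) * E t) D t ∧ D ≤ 0 := by
      intro t ht
      obtain ⟨E', h1, h2⟩ := h t ht
      have h3 : HasDerivAt (fun t => Real.exp (κ * t)) (Real.exp (κ * t) * (κ * 1)) t :=
        ((hasDerivAt_id t).const_mul κ).exp
      refine ⟨_, h3.mul h1, ?_⟩
      have : Real.exp (κ * t) * (κ * 1) * E t + Real.exp (κ * t) * E' =
          Real.exp (κ * t) * (κ * E t + E') := by ring
      rw [this]
      exact mul_nonpos_of_nonneg_of_nonpos (Real.exp_pos _).le (by linarith)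
    refine antitoneOn_of_deriv_nonpos (convex_Ici 0) ?_ ?_ ?_
    · exact (by fun_prop : Continuous fun t => Real.exp (κ * t)).continuousOn.mul hc
    · intro t ht
      rw [interior_Ici] at ht
      obtain ⟨D, h1, -⟩ := hd t ht
      exact h1.differentiableAt.differentiableWithinAt
    · intro t ht
      rw [interior_Ici] at ht
      obtain ⟨D, h1, h2⟩ := hd t ht
      rwa [h1.deriv]
  have h1 : Tendsto (fun t => Real.exp (-(κ * t)) * E 0) atTop (𝓝 0) := by
    have : Tendsto (fun t => Real.exp (-(κ * t))) atTop (𝓝 0) :=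
      Real.tendsto_exp_neg_atTop_nhds_zero.comp (tendsto_id.const_mul_atTop hκ)
    simpa using this.mul_const (E 0)
  refine tendsto_of_tendsto_of_tendsto_of_le_of_le' tendsto_const_nhds h1 ?_ ?_
  · filter_upwards [eventually_ge_atTop 0] with t ht using hE t ht
  · filter_upwards [eventually_ge_atTop 0] with t ht
    have := hanti (mem_Ici.2 le_rfl) (mem_Ici.2 ht) ht
    simp only [mul_zero, Real.exp_zero, one_mul] at this
    rw [Real.exp_neg, inv_mul_eq_div, le_div_iff₀ (Real.exp_pos _)]
    linarith

/-! ### The zero solution -/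

theorem perJet_zero (m : ℕ) : PerJet m fun _ _ => 0 :=
  ⟨⟨fun _ _ => isPrim_const 0, memLp_const 0⟩, fun _ _ => rfl⟩

theorem h2norm_eq_zero {v : ℝ → ℝ} (hv : v =ᵐ[unitMeasure] fun _ => 0) : h2norm v = 0 := by
  have h := (perJet_zero 2).1.h2norm_sq hv
  simp only [l2, ne_eq, OfNat.ofNat_ne_zero, not_false_eq_true, zero_pow, integral_zero,
    Real.sqrt_zero, add_zero] at h
  exact pow_eq_zero_iff (two_ne_zero) |>.1 h

theorem iterate_weakDeriv_zero (j : ℕ) :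
    weakDeriv^[j] (fun _ => 0) =ᵐ[unitMeasure] fun _ => 0 :=
  ((perJet_zero j).1.memSobolev EventuallyEq.rfl).2 j le_rfl

theorem linOp_zero (d : ℕ) (a : ℕ → ℝ) (L : ℝ) :
    linOp d a L (fun _ => 0) =ᵐ[unitMeasure] fun _ => 0 := by
  filter_upwards [ae_all_iff.2 fun j => iterate_weakDeriv_zero j] with x hx
  simp [linOp, hx]

theorem quadOp_zero (d : ℕ) (b : ℕ → ℕ → ℝ) (L : ℝ) :
    quadOp d b L (fun _ => 0) =ᵐ[unitMeasure] fun _ => 0 := by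
  filter_upwards [ae_all_iff.2 fun j => iterate_weakDeriv_zero j] with x hx
  simp [quadOp, hx]

/-- The comparison solution against which a single solution is estimated in `IsDissipative.apriori`.
-/
theorem isSolution_zero (d : ℕ) (a : ℕ → ℝ) (b : ℕ → ℕ → ℝ) (L : ℝ) :
    IsSolution d a b L (fun _ _ => 0) fun _ _ => 0 where
  mem _ _ := ((perJet_zero _).1.memSobolev EventuallyEq.rfl).1
  zero _ _ := ⟨fun _ => 0, continuousOn_const, EventuallyEq.rfl, rfl⟩
  periodic _ _ k _ := ⟨fun _ => 0, continuousOn_const, iterate_weakDeriv_zero k, rfl⟩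
  initial := by simp [h2norm_eq_zero]
  equation t _ := by
    have h0 : (fun x => linOp d a L (fun _ => 0) x + quadOp d b L (fun _ => 0) x + 0)
        =ᵐ[unitMeasure] fun _ => 0 := by
      filter_upwards [linOp_zero d a L, quadOp_zero d b L] with x h1 h2
      rw [h1, h2]; simp
    refine ⟨((perJet_zero _).1.memSobolev h0).1, ?_⟩
    refine tendsto_const_nhds.congr fun h => (h2norm_eq_zero ?_).symm
    filter_upwards [h0] with x hx
    rw [hx]; simp

theorem isForcing_zero : IsForcing (fun _ _ => 0) 0 := by
  refine ⟨fun _ _ => memPeriodicSobolev_iff.2 ⟨_, perJet_zero 2, EventuallyEq.rfl⟩, ?_⟩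
  have h : h2norm (fun _ => 0) = 0 := h2norm_eq_zero EventuallyEq.rfl
  simp only [h]
  rw [Set.Nonempty.image_const ⟨0, by simp⟩]
  exact isLUB_singleton

/-! ### From dissipativity to asymptotic stability -/

section

variable {d : ℕ} {a : ℕ → ℝ} {b : ℕ → ℕ → ℝ} {L : ℝ} {f u : ℝ → ℝ → ℝ} {β μ : ℝ}

/-- Write `u + w = 2u - (u - w)`: the sum is controlled by the a priori bound on `u` alone and by
the difference. -/
theorem SolState.sumTwo_le {u w : ℝ → ℝ} {U W : ℕ → ℝ → ℝ} (hU : SolState d u U)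
    (hW : SolState d w W) : sumTwo u w ≤ 2 * diffTwo u (fun _ => 0) + diffTwo u w := by
  have mU : MemLp (U 2) 2 unitMeasure := hU.jet.memLp (by omega)
  have mW : MemLp (W 2) 2 unitMeasure := hW.jet.memLp (by omega)
  have e : diffTwo u (fun _ => 0) = l2 (U 2) := by
    refine l2_congr ?_
    filter_upwards [hU.ae 2 (by omega), iterate_weakDeriv_zero 2] with x h1 h2
    rw [h1, h2, sub_zero]
  rw [sumTwo_eq hU hW, diffTwo_eq hU hW, e]
  have h1 := l2_add_le (mU.const_mul 2) ((memLp_sub mU mW).const_mul (-1))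
  have h2 := l2_const_mul 2 (U 2)
  have h3 := l2_const_mul (-1) (fun x => U 2 x - W 2 x)
  rw [h2, h3] at h1
  simp only [abs_neg, abs_one, one_mul, abs_two] at h1
  refine le_trans (le_of_eq ?_) h1
  congr 1
  funext x
  ring

theorem sumTwo_zero (u : ℝ → ℝ) : sumTwo u (fun _ => 0) = diffTwo u fun _ => 0 := by
  refine l2_congr ?_
  filter_upwards [iterate_weakDeriv_zero 2] with x h2
  rw [h2, sub_zero, add_zero]

/-- An absorbing ball for the second derivative. -/
theorem IsDissipative.apriori {M fmax : ℝ} (hD : IsDissipative d a b L β μ) (hd : 2 ≤ d)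
    (hu : IsSolution d a b L f u) (hf : IsForcing f fmax) (hM : 0 < M)
    (h0 : diffTwo (u 0) (fun _ => 0) < M) (hμ : μ * M ≤ β) (h : fmax + μ * M ^ 2 < β * M) :
    ∀ t, 0 ≤ t → diffTwo (u t) (fun _ => 0) < M := by
  have hz : MemPeriodicSobolev 2 fun _ => 0 :=
    memPeriodicSobolev_iff.2 ⟨_, perJet_zero 2, EventuallyEq.rfl⟩
  obtain ⟨hc, hE⟩ := hD.energy (Fm := fmax) hd hu (isSolution_zero d a b L) (fun t ht => by
    refine ⟨hf.1 t ht, hz, ?_⟩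
    simp only [sub_zero]
    exact hf.2.1 ⟨t, ht, rfl⟩)
  have n : ∀ t, 0 ≤ diffTwo (u t) (fun _ => 0) := fun t => l2_nonneg _
  intro t ht
  refine lt_of_pow_lt_pow_left₀ 2 hM.le (lt_of_barrier hc
    (pow_lt_pow_left₀ h0 (n 0) two_ne_zero) (fun s hs hEs => ?_) t ht)
  have hs : diffTwo (u s) (fun _ => 0) = M := (sq_eq_sq₀ (n s) hM.le).1 hEs
  obtain ⟨E', h1, h2⟩ := hE s ‹_› (by rw [sumTwo_zero, hs]; exact hμ)
  refine ⟨E', h1, h2.trans_lt ?_⟩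
  -- On the sphere the bound equals `2M (fmax + μM² - βM)`, negative by `h`.
  rw [sumTwo_zero, hs]
  nlinarith

/-- Dissipativity implies asymptotic stability of small solutions. -/
theorem IsDissipative.isTrajectoryAsympStable {fmax M : ℝ} (hD : IsDissipative d a b L β μ)
    (hd : 2 ≤ d) (hμ0 : 0 ≤ μ) (hu : IsSolution d a b L f u) (hf : IsForcing f fmax)
    (h0 : h2norm (u 0) < M) (hμ : 2 * μ * M < β) (h : fmax + μ * M ^ 2 < β * M) :
    IsTrajectoryAsympStable d a b L f u := by
  have hM : 0 < M := (h2norm_nonneg _).trans_lt h0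
  obtain ⟨U, hU⟩ := hu.exists_solState
  have hu0 : diffTwo (u 0) (fun _ => 0) < M := by
    refine lt_of_le_of_lt ?_ h0
    have e : diffTwo (u 0) (fun _ => 0) = l2 (U 0 2) := by
      refine l2_congr ?_
      filter_upwards [(hU 0 le_rfl).ae 2 (by omega), iterate_weakDeriv_zero 2] with x h1 h2
      rw [h1, h2, sub_zero]
    rw [e]
    exact ((hU 0 le_rfl).jet.mono (by omega)).l2_le_h2norm ((hU 0 le_rfl).ae 0 (by omega)) le_rfl
  have hap := hD.apriori hd hu hf hM hu0 (by nlinarith) h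
  -- This `δ` uses at most half of the slack `β - 2μM`; the denominator has `μ + 1` because `μ` may
  -- be zero.
  obtain ⟨δ, hδ, hδ'⟩ : ∃ δ > 0, μ * (2 * M + δ) < β := by
    refine ⟨(β - 2 * μ * M) / (2 * (μ + 1)), by apply div_pos <;> linarith, ?_⟩
    have : μ * ((β - 2 * μ * M) / (2 * (μ + 1))) ≤ (β - 2 * μ * M) / 2 := by
      rw [mul_div_assoc', div_le_div_iff₀ (by linarith) two_pos]
      nlinarith
    linarith
  have hκ : 0 < β - μ * (2 * M + δ) := by linarith
  have hz : MemPeriodicSobolev 2 fun _ => 0 :=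
    memPeriodicSobolev_iff.2 ⟨_, perJet_zero 2, EventuallyEq.rfl⟩
  have hen : ∀ w, IsSolution d a b L f w →
      ContinuousOn (fun t => diffTwo (u t) (w t) ^ 2) (Ici 0) ∧
      ∀ t, 0 < t → diffTwo (u t) (w t) ≤ δ → ∃ E',
        HasDerivAt (fun t => diffTwo (u t) (w t) ^ 2) E' t ∧
        E' ≤ -(2 * (β - μ * (2 * M + δ))) * diffTwo (u t) (w t) ^ 2 := by
    intro w hw
    obtain ⟨W, hW⟩ := hw.exists_solState
    obtain ⟨hc, hE⟩ := hD.energy (Fm := 0) hd hu hw (fun t ht => by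
      refine ⟨hf.1 t ht, hf.1 t ht, ?_⟩
      simp only [sub_self]
      exact (h2norm_eq_zero EventuallyEq.rfl).le)
    refine ⟨hc, fun t ht hdt => ?_⟩
    have hs : sumTwo (u t) (w t) ≤ 2 * M + δ := by
      have := (hU t ht.le).sumTwo_le (hW t ht.le)
      linarith [hap t ht.le]
    have hs' := mul_le_mul_of_nonneg_left hs hμ0
    obtain ⟨E', h1, h2⟩ := hE t ht (by linarith)
    refine ⟨E', h1, h2.trans ?_⟩
    nlinarith [mul_le_mul_of_nonneg_right hs' (sq_nonneg (diffTwo (u t) (w t)))]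
  have hn : ∀ v w, 0 ≤ diffTwo v w := fun v w => l2_nonneg _
  -- Every ball of radius `r ≤ δ` around the trajectory is invariant, since the energy strictly
  -- decreases on its boundary.
  have hsmall : ∀ w, IsSolution d a b L f w → ∀ r, 0 < r → r ≤ δ → diffTwo (u 0) (w 0) < r →
      ∀ t, 0 ≤ t → diffTwo (u t) (w t) < r := by
    intro w hw r hr hrδ hlt t ht
    obtain ⟨hc, hE⟩ := hen w hw
    refine lt_of_pow_lt_pow_left₀ 2 hr.le (lt_of_barrier hc
      (pow_lt_pow_left₀ hlt (hn _ _) two_ne_zero) (fun s hs hEs => ?_) t ht)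
    have hs' : diffTwo (u s) (w s) = r := (sq_eq_sq₀ (hn _ _) hr.le).1 hEs
    obtain ⟨E', h1, h2⟩ := hE s hs (by rw [hs']; exact hrδ)
    refine ⟨E', h1, h2.trans_lt ?_⟩
    rw [hs']
    have : 0 < r ^ 2 := by positivity
    nlinarith
  -- Equivalence of `diffTwo` with the H² norm of the difference, which transfers smallness at time
  -- 0 one way and the conclusion back.
  have hnorm : ∀ w, IsSolution d a b L f w → ∀ t, 0 ≤ t →
      diffTwo (u t) (w t) ≤ h2norm (fun x => u t x - w t x) ∧
      h2norm (fun x => u t x - w t x) ≤ 2 * diffTwo (u t) (w t) := by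
    intro w hw t ht
    obtain ⟨W, hW⟩ := hw.exists_solState
    have hZ := ((hU t ht).zeroJet hd).lin ((hW t ht).zeroJet hd) 1 (-1)
    have hae : (fun x => u t x - w t x) =ᵐ[unitMeasure] fun x => 1 * U t 0 x + -1 * W t 0 x := by
      filter_upwards [(hU t ht).ae 0 (by omega), (hW t ht).ae 0 (by omega)] with x h1 h2
      simp only [Function.iterate_zero, id_eq] at h1 h2
      rw [h1, h2]
      ring
    have e : diffTwo (u t) (w t) = l2 fun x => 1 * U t 2 x + -1 * W t 2 x := by
      rw [diffTwo_eq (hU t ht) (hW t ht)]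
      congr 1
      funext x
      ring
    rw [e]
    exact ⟨hZ.jet.l2_le_h2norm hae le_rfl, hZ.h2norm_le hae⟩
  refine ⟨fun ε hε => ⟨min δ (ε / 2), by positivity, fun w hw hlt t ht => ?_⟩,
    δ, hδ, fun w hw hlt => ?_⟩
  · have h1 := hsmall w hw (min δ (ε / 2)) (by positivity) (min_le_left _ _)
      ((hnorm w hw 0 le_rfl).1.trans_lt hlt) t ht
    have h2 := (hnorm w hw t ht).2
    have h3 := min_le_right δ (ε / 2)
    linarith
  · have h1 := hsmall w hw δ hδ le_rfl ((hnorm w hw 0 le_rfl).1.trans_lt hlt)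
    obtain ⟨hc, hE⟩ := hen w hw
    have h2 := tendsto_zero_of_deriv_le (mul_pos two_pos hκ) hc (fun t _ => sq_nonneg _)
      (fun t ht => hE t ht (h1 t ht.le).le)
    have h3 : Tendsto (fun t => diffTwo (u t) (w t)) atTop (𝓝 0) := by
      have := h2.sqrt
      simpa [Real.sqrt_sq (hn _ _)] using this
    refine squeeze_zero' (Eventually.of_forall fun _ => h2norm_nonneg _) ?_
      (by simpa using h3.const_mul 2)
    filter_upwards [eventually_ge_atTop 0] with t ht using (hnorm w hw t ht).2

end

/-! ### Dissipativity of the three equations -/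

section

variable {d : ℕ} {a : ℕ → ℝ} {b : ℕ → ℕ → ℝ} {L β μ : ℝ}

theorem integrable_mul {f g : ℝ → ℝ} (hf : MemLp f 2 unitMeasure) (hg : MemLp g 2 unitMeasure) :
    Integrable (fun x => f x * g x) unitMeasure := hf.integrable_mul hg

theorem integral_add_three {f g k : ℝ → ℝ} (hf : Integrable f unitMeasure)
    (hg : Integrable g unitMeasure) (hk : Integrable k unitMeasure) :
    ∫ x, (f x + g x + k x) ∂unitMeasure =
      ∫ x, f x ∂unitMeasure + ∫ x, g x ∂unitMeasure + ∫ x, k x ∂unitMeasure := by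
  rw [← integral_add hf hg]
  exact integral_add (hf.add hg) hk

/-- It suffices to test the spatial derivative of the right-hand side with the third derivative. -/
theorem isDissipative_of_deriv (hd : 2 ≤ d)
    (h : ∀ (u w : ℝ → ℝ) (U W : ℕ → ℝ → ℝ), SolState d u U → SolState d w W →
      μ * sumTwo u w ≤ β → ∃ A₀ A : ℝ → ℝ, IsPrim A₀ A ∧ MemLp A 2 unitMeasure ∧
        (fun x => linOp d a L u x + quadOp d b L u x - (linOp d a L w x + quadOp d b L w x))
          =ᵐ[unitMeasure] A₀ ∧
        -∫ x, (U 3 x - W 3 x) * A x ∂unitMeasure ≤ -(β - μ * sumTwo u w) * diffTwo u w ^ 2) :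
    IsDissipative d a b L β μ := by
  intro u w U W F G hU hW hF hG pG aG hμ
  obtain ⟨A₀, A, hA, mA, aA, hb⟩ := h u w U W hU hW hμ
  have hF0 := hF.1.1 0 (by omega)
  have hF1 := hF.1.1 1 (by omega)
  have hV : IsPrim (fun x => U 2 x - W 2 x) fun x => U 3 x - W 3 x :=
    (hU.jet.1 2 (by omega)).sub (hW.jet.1 2 (by omega))
  have hVp : (fun x => U 2 x - W 2 x) 0 = (fun x => U 2 x - W 2 x) 1 := by
    simp only [hU.per 2 hd, hW.per 2 hd]
  have mV3 : MemLp (fun x => U 3 x - W 3 x) 2 unitMeasure :=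
    memLp_sub (hU.jet.memLp (by omega)) (hW.jet.memLp (by omega))
  have hG1 : G 1 =ᵐ[unitMeasure] fun x => A x + F 1 x := by
    refine (hG.1 0 (by omega)).deriv_unique (hA.add hF0) ?_
    filter_upwards [aG, aA] with x h1 h2
    rw [h1, ← h2]
  -- Boundary terms vanish since `∂ₓ²(u - w)` is periodic (`2 ≤ d`) and so is `G 1`; only `G 1`,
  -- never `G 2`, has to be identified.
  have e1 := hV.integral_mul_periodic (hG.1 1 (by omega)) hVp pG
  have e2 : ∫ x, (U 3 x - W 3 x) * G 1 x ∂unitMeasure =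
      ∫ x, (U 3 x - W 3 x) * A x ∂unitMeasure + ∫ x, (U 3 x - W 3 x) * F 1 x ∂unitMeasure := by
    rw [← integral_add (integrable_mul mV3 mA) (integrable_mul mV3 hF1.memLp)]
    refine integral_congr_ae ?_
    filter_upwards [hG1] with x hx
    rw [hx]
    ring
  -- The forcing is integrated by parts back, so that only second derivatives of it and of `u - w`
  -- remain.
  have e3 := hV.integral_mul_periodic hF1 hVp (hF.2 1 (by omega))
  have e4 := (le_abs_self _).trans (abs_integral_mul_le (hV.memLp (p := 2)) hF.1.2)
  rw [← diffTwo_eq hU hW] at e4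
  rw [e1, e2]
  linarith

/-- The scalar inequality behind the energy estimate. -/
theorem dissipation_le {β m μ S y z : ℝ} (hz : 2 * Real.pi * y ≤ z) (hy : 0 ≤ y) (hS : 0 ≤ S)
    (hm : m ≤ μ)
    (hm0 : 0 ≤ m) (hμ : μ * S ≤ β) :
    -(β / (2 * Real.pi) ^ 2) * z ^ 2 + m * (z * (S / 2 * y / Real.pi)) ≤ -(β - μ * S) * y ^ 2 := by
  have hpi := Real.pi_pos
  -- In terms of `x` the claim is `-β x² + m S x y ≤ -(β - μS) y²`. Use `m ≤ μ`, `x y ≤ x²`, and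
  -- then `y ≤ x` with `β - μS ≥ 0`.
  obtain ⟨x, rfl⟩ : ∃ x, z = 2 * Real.pi * x := ⟨z / (2 * Real.pi), by field_simp⟩
  have hxy : y ≤ x := le_of_mul_le_mul_left hz (by positivity)
  have e : -(β / (2 * Real.pi) ^ 2) * (2 * Real.pi * x) ^ 2 +
      m * (2 * Real.pi * x * (S / 2 * y / Real.pi)) = -β * x ^ 2 + m * S * (x * y) := by
    field_simp
  rw [e]
  have hx : 0 ≤ x := hy.trans hxy
  have h1 : m * S * (x * y) ≤ μ * S * (x * y) :=
    mul_le_mul_of_nonneg_right (mul_le_mul_of_nonneg_right hm hS) (mul_nonneg hx hy)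
  have hS' : m * S ≤ μ * S := mul_le_mul_of_nonneg_right hm hS
  have h2 : (β - μ * S) * y ^ 2 ≤ (β - μ * S) * x ^ 2 :=
    mul_le_mul_of_nonneg_left (pow_le_pow_left₀ hy hxy 2) (by linarith)
  have h3 : 0 ≤ μ * S := mul_nonneg (hm0.trans hm) hS
  nlinarith [mul_le_mul_of_nonneg_left (mul_le_mul_of_nonneg_left hxy hx) h3]

/-- The difference and the mean of two states. -/
theorem SolState.diff_mean {u w : ℝ → ℝ} {U W : ℕ → ℝ → ℝ} (hd : 2 ≤ d) (hU : SolState d u U)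
    (hW : SolState d w W) {V Q : ℕ → ℝ → ℝ} (hV : V = fun j x => 1 * U j x + -1 * W j x)
    (hQ : Q = fun j x => 1 / 2 * U j x + 1 / 2 * W j x) :
    ZeroJet V ∧ ZeroJet Q ∧ Jet (d + 2) V ∧ (∀ j ≤ d, V j 0 = V j 1) ∧ diffTwo u w = l2 (V 2) ∧
      sumTwo u w = 2 * l2 (Q 2) ∧ 2 * Real.pi * diffTwo u w ≤ l2 (V 3) ∧
      l2 (mulJet Q V 2) ≤ sumTwo u w / 2 * diffTwo u w / Real.pi := by
  have zV : ZeroJet V := hV ▸ (hU.zeroJet hd).lin (hW.zeroJet hd) 1 (-1)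
  have zQ : ZeroJet Q := hQ ▸ (hU.zeroJet hd).lin (hW.zeroJet hd) (1 / 2) (1 / 2)
  have jV : Jet (d + 2) V := hV ▸ hU.jet.lin hW.jet 1 (-1)
  have pV : ∀ j ≤ d, V j 0 = V j 1 := fun j hj => by
    simp only [hV, hU.per j hj, hW.per j hj]
  have e1 : diffTwo u w = l2 (V 2) := by
    rw [diffTwo_eq hU hW, hV]
    congr 1; funext x; ring
  have e2 : sumTwo u w = 2 * l2 (Q 2) := by
    have := l2_const_mul 2 (Q 2)
    rw [abs_two] at this
    rw [sumTwo_eq hU hW, ← this, hQ]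
    congr 1; funext x; ring
  refine ⟨zV, zQ, jV, pV, e1, e2, ?_, ?_⟩
  · rw [e1]
    exact (jV.1 2 (by omega)).wirtinger (jV.memLp (by omega)) (pV 2 hd)
      ((jV.1 1 (by omega)).mean_zero (pV 1 (by omega)))
  · rw [le_div_iff₀ Real.pi_pos, e1, e2, mul_comm]
    refine (zQ.l2_mul_le zV).trans (le_of_eq ?_)
    ring

/-- Polarisation gives `u uₓ - w wₓ = (qv)ₓ`, so the tested derivative is `A = (ν/L²) vₓₓₓ -
(1/L)(qv)ₓₓ`. -/
theorem isDissipative_burgers {ν C : ℝ} (hL : 0 < L) (hC : 1 ≤ C) :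
    IsDissipative 2 (burgersLin ν) burgersQuad L (ν * (2 * Real.pi / L) ^ 2) (C / L) := by
  refine isDissipative_of_deriv le_rfl fun u w U W hU hW hμ => ?_
  obtain ⟨V, hV⟩ : ∃ V : ℕ → ℝ → ℝ, V = fun j x => 1 * U j x + -1 * W j x := ⟨_, rfl⟩
  obtain ⟨Q, hQ⟩ : ∃ Q : ℕ → ℝ → ℝ, Q = fun j x => 1 / 2 * U j x + 1 / 2 * W j x := ⟨_, rfl⟩
  obtain ⟨zV, zQ, jV, pV, e1, e2, h3, h4⟩ := hU.diff_mean le_rfl hW hV hQ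
  have jP := zQ.jet.mul zV.jet
  have mV3 : MemLp (V 3) 2 unitMeasure := jV.memLp (by omega)
  have m1 := mV3.const_mul (ν / L ^ 2)
  have m2 := jP.2.const_mul (-1 / L)
  refine ⟨_, _, ((jV.1 2 (by omega)).const_mul (ν / L ^ 2)).add
    ((jP.1 1 (by omega)).const_mul (-1 / L)), m1.add m2, ?_, ?_⟩
  · filter_upwards [hU.ae 0 (by omega), hU.ae 1 (by omega), hU.ae 2 (by omega),
      hW.ae 0 (by omega), hW.ae 1 (by omega), hW.ae 2 (by omega)] with x a0 a1 a2 b0 b1 b2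
    simp only [Function.iterate_succ, Function.iterate_zero, Function.comp_apply, id_eq] at *
    rw [burgers_rhs, burgers_rhs, a0, a1, a2, b0, b1, b2]
    simp only [hV, hQ, mulJet]
    ring
  · have hUW : ∀ x, U 3 x - W 3 x = V 3 x := fun x => by simp only [hV]; ring
    simp only [hUW]
    have i1 : ∫ x, V 3 x * (ν / L ^ 2 * V 3 x + -1 / L * mulJet Q V 2 x) ∂unitMeasure =
        ν / L ^ 2 * l2 (V 3) ^ 2 + -1 / L * ∫ x, V 3 x * mulJet Q V 2 x ∂unitMeasure := by
      rw [l2_sq, ← integral_const_mul, ← integral_const_mul, ← integral_add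
        (mV3.integrable_sq.const_mul _) ((integrable_mul mV3 jP.2).const_mul _)]
      congr 1; funext x; ring
    rw [show (1 : ℕ) + 1 = 2 from rfl, show (2 : ℕ) + 1 = 3 from rfl, i1]
    have i2 := (le_abs_self _).trans (abs_integral_mul_le mV3 jP.2)
    have i3 := i2.trans (mul_le_mul_of_nonneg_left h4 (l2_nonneg _))
    -- The true constant of the quadratic term is `1/L`; it is enlarged to `μ` by `C ≥ 1`.
    have hm : 1 / L ≤ C / L := div_le_div_of_nonneg_right hC hL.le
    have i4 := mul_le_mul_of_nonneg_left i3 (by positivity : 0 ≤ 1 / L)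
    have i5 := dissipation_le (S := sumTwo u w) h3 (l2_nonneg _) (l2_nonneg _) hm (by positivity) hμ
    have e5 : ν * (2 * Real.pi / L) ^ 2 / (2 * Real.pi) ^ 2 = ν / L ^ 2 := by
      have := Real.pi_pos
      field_simp
    rw [e5] at i5
    refine le_trans (le_of_eq ?_) (le_trans (add_le_add_right i4 (-(ν / L ^ 2) * l2 (V 3) ^ 2)) i5)
    ring

/-- The sign of `p` is free, so the second order term alone need not dissipate. Wirtinger applied to
`V 3` turns the fourth order term into a multiple of `‖V 3‖²`, and both together equal `-β/(2π)² ‖V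
3‖²`. -/
theorem isDissipative_ks {p q c C : ℝ} (hL : 0 < L) (hC : 1 ≤ C) (hq : q < 0) :
    IsDissipative 4 (ksLin p q) (ksQuad c) L
      (p * (2 * Real.pi / L) ^ 2 - q * (2 * Real.pi / L) ^ 4) (C * |c| / L) := by
  refine isDissipative_of_deriv (by omega) fun u w U W hU hW hμ => ?_
  obtain ⟨V, hV⟩ : ∃ V : ℕ → ℝ → ℝ, V = fun j x => 1 * U j x + -1 * W j x := ⟨_, rfl⟩
  obtain ⟨Q, hQ⟩ : ∃ Q : ℕ → ℝ → ℝ, Q = fun j x => 1 / 2 * U j x + 1 / 2 * W j x := ⟨_, rfl⟩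
  obtain ⟨zV, zQ, jV, pV, e1, e2, h3, h4⟩ := hU.diff_mean (by omega) hW hV hQ
  have jP := zQ.jet.mul zV.jet
  have mV3 : MemLp (V 3) 2 unitMeasure := jV.memLp (by omega)
  have mV5 : MemLp (V 5) 2 unitMeasure := jV.memLp (by omega)
  have m1 := mV3.const_mul (p / L ^ 2)
  have m2 := jP.2.const_mul (c / L)
  have m3 := mV5.const_mul (q / L ^ 4)
  refine ⟨_, _, (((jV.1 2 (by omega)).const_mul (p / L ^ 2)).add
    ((jV.1 4 (by omega)).const_mul (q / L ^ 4))).add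
    ((jP.1 1 (by omega)).const_mul (c / L)), (m1.add m3).add m2, ?_, ?_⟩
  · filter_upwards [hU.ae 0 (by omega), hU.ae 1 (by omega), hU.ae 2 (by omega),
      hU.ae 4 (by omega), hW.ae 0 (by omega), hW.ae 1 (by omega), hW.ae 2 (by omega),
      hW.ae 4 (by omega)] with x a0 a1 a2 a4 b0 b1 b2 b4
    simp only [Function.iterate_succ, Function.iterate_zero, Function.comp_apply, id_eq] at *
    rw [ks_rhs, ks_rhs, a0, a1, a2, a4, b0, b1, b2, b4]
    simp only [hV, hQ, mulJet]
    ring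
  · have hUW : ∀ x, U 3 x - W 3 x = V 3 x := fun x => by simp only [hV]; ring
    simp only [hUW]
    have i0 := (jV.1 3 (by omega)).integral_mul_periodic (jV.1 4 (by omega)) (pV 3 (by omega))
      (pV 4 (by omega))
    have i1 : ∫ x, V 3 x * (p / L ^ 2 * V 3 x + q / L ^ 4 * V 5 x + c / L * mulJet Q V 2 x)
        ∂unitMeasure = p / L ^ 2 * l2 (V 3) ^ 2 + q / L ^ 4 * (∫ x, V 3 x * V 5 x ∂unitMeasure)
          + c / L * ∫ x, V 3 x * mulJet Q V 2 x ∂unitMeasure := by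
      have j1 := mV3.integrable_sq.const_mul (p / L ^ 2)
      have j2 := (integrable_mul mV3 mV5).const_mul (q / L ^ 4)
      have j3 := (integrable_mul mV3 jP.2).const_mul (c / L)
      rw [l2_sq, ← integral_const_mul, ← integral_const_mul, ← integral_const_mul,
        ← integral_add_three j1 j2 j3]
      congr 1; funext x; ring
    have i0' : ∫ x, V 3 x * V 5 x ∂unitMeasure = - l2 (V 4) ^ 2 := by
      rw [l2_sq, show (5 : ℕ) = 4 + 1 from rfl, i0]
      congr 2; funext x; ring
    rw [show (1 : ℕ) + 1 = 2 from rfl, show (2 : ℕ) + 1 = 3 from rfl,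
      show (4 : ℕ) + 1 = 5 from rfl, i1, i0']
    have w4 : 2 * Real.pi * l2 (V 3) ≤ l2 (V 4) :=
      (jV.1 3 (by omega)).wirtinger (jV.memLp (by omega)) (pV 3 (by omega))
        ((jV.1 2 (by omega)).mean_zero (pV 2 (by omega)))
    have w4' := pow_le_pow_left₀ (by have := l2_nonneg (V 3); positivity) w4 2
    have w5 := mul_le_mul_of_nonneg_left w4' (by have := neg_pos.2 hq; positivity : 0 ≤ -q / L ^ 4)
    have i2 := abs_integral_mul_le mV3 jP.2
    have i3 := i2.trans (mul_le_mul_of_nonneg_left h4 (l2_nonneg _))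
    have hm : |c| / L ≤ C * |c| / L :=
      div_le_div_of_nonneg_right (le_mul_of_one_le_left (abs_nonneg c) hC) hL.le
    have i4 := mul_le_mul_of_nonneg_left i3 (by positivity : 0 ≤ |c| / L)
    have i6 : -(c / L * ∫ x, V 3 x * mulJet Q V 2 x ∂unitMeasure) ≤
        |c| / L * |∫ x, V 3 x * mulJet Q V 2 x ∂unitMeasure| := by
      refine (neg_le_abs _).trans (le_of_eq ?_)
      rw [abs_mul, abs_div, abs_of_pos hL]
    have i5 := dissipation_le (S := sumTwo u w) h3 (l2_nonneg _) (l2_nonneg _) hm (by positivity) hμ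
    have e5 : -((p * (2 * Real.pi / L) ^ 2 - q * (2 * Real.pi / L) ^ 4) / (2 * Real.pi) ^ 2) *
        l2 (V 3) ^ 2 = -(p / L ^ 2) * l2 (V 3) ^ 2 -
        -q / L ^ 4 * (2 * Real.pi * l2 (V 3)) ^ 2 := by
      have := Real.pi_pos
      field_simp
      ring
    rw [e5] at i5
    have e6 : q / L ^ 4 * -l2 (V 4) ^ 2 = -q / L ^ 4 * l2 (V 4) ^ 2 := by ring
    rw [e6]
    linarith

/-- The reaction terms have no derivative to spare: they are integrated by parts back to `V 2`,
where `r₁` contributes exactly `r₁‖V 2‖²` and the quadratic term at most `|r₂| S ‖V 2‖²/π`. -/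
theorem isDissipative_kpp {D r₁ r₂ C : ℝ} (hL : 0 < L) (hC : 1 ≤ C) (hD : 0 < D) :
    IsDissipative 2 (kppLin D r₁) (kppQuad r₂) L (D * (2 * Real.pi / L) ^ 2 - r₁) (C * |r₂|) := by
  refine isDissipative_of_deriv le_rfl fun u w U W hU hW hμ => ?_
  obtain ⟨V, hV⟩ : ∃ V : ℕ → ℝ → ℝ, V = fun j x => 1 * U j x + -1 * W j x := ⟨_, rfl⟩
  obtain ⟨Q, hQ⟩ : ∃ Q : ℕ → ℝ → ℝ, Q = fun j x => 1 / 2 * U j x + 1 / 2 * W j x := ⟨_, rfl⟩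
  obtain ⟨zV, zQ, jV, pV, e1, e2, h3, h4⟩ := hU.diff_mean le_rfl hW hV hQ
  have jP := zQ.jet.mul zV.jet
  have mV1 : MemLp (V 1) 2 unitMeasure := jV.memLp (by omega)
  have mV2 : MemLp (V 2) 2 unitMeasure := jV.memLp (by omega)
  have mV3 : MemLp (V 3) 2 unitMeasure := jV.memLp (by omega)
  have mP1 : MemLp (mulJet Q V 1) 2 unitMeasure := jP.memLp (by omega)
  have m1 := mV3.const_mul (D / L ^ 2)
  have m2 := mV1.const_mul r₁
  have m3 := mP1.const_mul (-2 * r₂)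
  refine ⟨_, _, (((jV.1 2 (by omega)).const_mul (D / L ^ 2)).add
    ((jV.1 0 (by omega)).const_mul r₁)).add
    ((jP.1 0 (by omega)).const_mul (-2 * r₂)), (m1.add m2).add m3, ?_, ?_⟩
  · filter_upwards [hU.ae 0 (by omega), hU.ae 2 (by omega),
      hW.ae 0 (by omega), hW.ae 2 (by omega)] with x a0 a2 b0 b2
    simp only [Function.iterate_succ, Function.iterate_zero, Function.comp_apply, id_eq] at *
    rw [kpp_rhs, kpp_rhs, a0, a2, b0, b2]
    simp only [hV, hQ, mulJet]
    ring
  · have hUW : ∀ x, U 3 x - W 3 x = V 3 x := fun x => by simp only [hV]; ring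
    simp only [hUW]
    have i1 : ∫ x, V 3 x * (D / L ^ 2 * V 3 x + r₁ * V 1 x + -2 * r₂ * mulJet Q V 1 x)
        ∂unitMeasure = D / L ^ 2 * l2 (V 3) ^ 2 + r₁ * (∫ x, V 1 x * V 3 x ∂unitMeasure)
          + -2 * r₂ * ∫ x, mulJet Q V 1 x * V 3 x ∂unitMeasure := by
      have j1 := mV3.integrable_sq.const_mul (D / L ^ 2)
      have j2 := (integrable_mul mV1 mV3).const_mul r₁
      have j3 := (integrable_mul mP1 mV3).const_mul (-2 * r₂)
      rw [l2_sq, ← integral_const_mul, ← integral_const_mul, ← integral_const_mul,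
        ← integral_add_three j1 j2 j3]
      congr 1; funext x; ring
    have i2 := (jV.1 1 (by omega)).integral_mul_periodic (jV.1 2 (by omega)) (pV 1 (by omega))
      (pV 2 le_rfl)
    have i3 := (jP.1 1 (by omega)).integral_mul_periodic (jV.1 2 (by omega))
      (by simp only [mulJet, zQ.per0, zQ.per1, zV.per0, zV.per1]) (pV 2 le_rfl)
    have i2' : ∫ x, V 1 x * V 3 x ∂unitMeasure = -l2 (V 2) ^ 2 := by
      rw [l2_sq, show (3 : ℕ) = 2 + 1 from rfl, i2]
      congr 2; funext x; simp only [sq]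
    rw [show (0 : ℕ) + 1 = 1 from rfl, show (2 : ℕ) + 1 = 3 from rfl, i1, i2',
      show (3 : ℕ) = 2 + 1 from rfl, i3]
    simp only [Nat.reduceAdd]
    have i4 := abs_integral_mul_le jP.2 mV2
    have n2 := l2_nonneg (V 2)
    have nS : 0 ≤ sumTwo u w := l2_nonneg _
    have i5 := i4.trans (mul_le_mul_of_nonneg_right h4 n2)
    have i6 : -2 * r₂ * ∫ x, mulJet Q V 2 x * V 2 x ∂unitMeasure ≤
        2 * |r₂| * |∫ x, mulJet Q V 2 x * V 2 x ∂unitMeasure| := by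
      refine (le_abs_self _).trans (le_of_eq ?_)
      rw [abs_mul, abs_mul, abs_neg, abs_two]
    have i7 := mul_le_mul_of_nonneg_left i5 (by positivity : 0 ≤ 2 * |r₂|)
    rw [e1] at h3
    have i8 := pow_le_pow_left₀ (by positivity) h3 2
    have i9 := mul_le_mul_of_nonneg_left i8 (by positivity : 0 ≤ D / L ^ 2)
    have e5 : D / L ^ 2 * (2 * Real.pi * l2 (V 2)) ^ 2 =
        D * (2 * Real.pi / L) ^ 2 * l2 (V 2) ^ 2 := by ring
    have hpi : 1 / Real.pi ≤ C :=
      ((div_le_one Real.pi_pos).2 (by linarith [Real.pi_gt_three])).trans hC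
    have i10 := mul_le_mul_of_nonneg_left hpi
      (by positivity : 0 ≤ |r₂| * sumTwo u w * l2 (V 2) ^ 2)
    rw [e1] at i7 ⊢
    have e6 : 2 * |r₂| * (sumTwo u w / 2 * l2 (V 2) / Real.pi * l2 (V 2)) =
      |r₂| * sumTwo u w * l2 (V 2) ^ 2 * (1 / Real.pi) := by ring
    rw [e6] at i7
    rw [e5] at i9
    linarith

end

/-! ### Periodic solutions of linear ordinary differential equations -/

/-- Periodic solutions of `v' = α v + g`. -/
theorem exists_periodic_first_order {α : ℂ} (hα : Complex.exp α ≠ 1) {g : ℝ → ℂ}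
    (hg : IntervalIntegrable g volume 0 1) :
    ∃ v : ℝ → ℂ, IsPrim v (fun x => α * v x + g x) ∧ v 0 = v 1 := by
  have hu : uIcc (0 : ℝ) 1 = Icc 0 1 := uIcc_of_le zero_le_one
  have hi : IntervalIntegrable (fun x : ℝ => Complex.exp (-α * x) * g x) volume 0 1 :=
    hg.continuousOn_mul (hu ▸ (isPrim_cexp (-α)).continuousOn)
  set I := ∫ x in (0 : ℝ)..1, Complex.exp (-α * x) * g x with hI
  -- The initial value for which variation of constants returns to its start: `c = exp α * (c + I)`.
  set c := Complex.exp α * I / (1 - Complex.exp α) with hc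
  have hG := isPrim_integral hi c
  refine ⟨fun x => Complex.exp (α * x) *
    (c + ∫ t in (0 : ℝ)..x, Complex.exp (-α * t) * g t), ?_, ?_⟩
  · refine ((isPrim_cexp α).cmul hG).congr_deriv (ae_of_all _ fun x => ?_)
    have : Complex.exp (α * x) * Complex.exp (-α * x) = 1 := by
      rw [← Complex.exp_add, neg_mul, add_neg_cancel, Complex.exp_zero]
    linear_combination g x * this
  · have h1 : (1 : ℂ) - Complex.exp α ≠ 0 := sub_ne_zero.2 hα.symm
    simp only [Complex.ofReal_zero, mul_zero, Complex.exp_zero, intervalIntegral.integral_same,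
      Complex.ofReal_one, mul_one, add_zero, one_mul]
    rw [← hI, hc]
    field_simp
    ring

/-- Periodic solutions of `v'' = σ v + g`. -/
theorem exists_periodic_second_order {σ : ℂ} (hσ : ∀ k : ℤ, σ ≠ -(2 * Real.pi * k) ^ 2)
    {g : ℝ → ℂ} (hg : IntervalIntegrable g volume 0 1) :
    ∃ v v₁ : ℝ → ℂ, IsPrim v v₁ ∧ IsPrim v₁ (fun x => σ * v x + g x) ∧ v 0 = v 1 ∧
      v₁ 0 = v₁ 1 := by
  -- With `σ = α²` the operator factors as `(∂ - α)(∂ + α)`: solve `z' = αz + g`, then `v' = -αv +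
  -- z`. Non-resonance of `σ` says that `exp (±α) ≠ 1`.
  obtain ⟨α, rfl⟩ := IsAlgClosed.exists_pow_nat_eq σ (n := 2) two_pos
  have hne : ∀ γ : ℂ, γ ^ 2 = α ^ 2 → Complex.exp γ ≠ 1 := by
    intro γ hγ h1
    obtain ⟨n, hn⟩ := Complex.exp_eq_one_iff.1 h1
    refine hσ n ?_
    rw [← hγ, hn]
    linear_combination (4 * (Real.pi : ℂ) ^ 2 * n ^ 2) * Complex.I_sq
  obtain ⟨z, hz, pz⟩ := exists_periodic_first_order (hne α rfl) hg
  have hu : uIcc (0 : ℝ) 1 = Icc 0 1 := uIcc_of_le zero_le_one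
  obtain ⟨v, hv, pv⟩ := exists_periodic_first_order (hne (-α) (neg_sq α))
    (hu ▸ hz.continuousOn : ContinuousOn z (uIcc 0 1)).intervalIntegrable
  refine ⟨v, fun x => -α * v x + z x, hv, ?_, pv, by simp only [pv, pz]⟩
  refine ((hv.const_mul (-α)).add hz).congr_deriv (ae_of_all _ fun x => ?_)
  ring

/-- Periodic solutions of `A v'' + B v = g`. -/
theorem exists_perJet_two {A B : ℝ} (hA : A ≠ 0)
    (h : ∀ k : ℤ, -A * (2 * Real.pi * k) ^ 2 + B ≠ 0) {g : ℝ → ℝ} (hg : MemLp g 2 unitMeasure) :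
    ∃ V, PerJet 2 V ∧ ∀ x, A * V 2 x + B * V 0 x = g x := by
  have hgi : IntervalIntegrable (fun x => ((g x / A : ℝ) : ℂ)) volume 0 1 :=
    intervalIntegrable_iff_unitMeasure.2 ((integrable_of_memLp_two hg).div_const A).ofReal
  obtain ⟨v, v₁, h0, h1, p0, p1⟩ := exists_periodic_second_order (σ := ((-B / A : ℝ) : ℂ))
    (fun k hk => h k (by
      have hk' : -B / A = -(2 * Real.pi * k) ^ 2 := by exact_mod_cast hk
      rw [div_eq_iff hA] at hk'
      linarith)) hgi
  -- The top entry is defined by the equation itself, so that the equation holds at every point.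
  -- Real parts suffice because the coefficients are real.
  let V : ℕ → ℝ → ℝ := fun j => match j with
    | 0 => fun x => (v x).re
    | 1 => fun x => (v₁ x).re
    | _ => fun x => -B / A * (v x).re + g x / A
  refine ⟨V, ⟨⟨fun j hj => ?_, ?_⟩, fun j hj => ?_⟩, fun x => ?_⟩
  · interval_cases j
    · exact h0.re
    · refine h1.re.congr_deriv (ae_of_all _ fun x => ?_)
      simp [V, -Complex.ofReal_div, -Complex.ofReal_neg]
  · exact ((h0.re.memLp (p := 2)).const_mul _).add (hg.mul_const (A⁻¹))
  · interval_cases j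
    · simp only [V, p0]
    · simp only [V, p1]
  · simp only [V]
    field_simp
    ring

/-- Periodic solutions of `A v'''' + B v'' + D v = g`. -/
theorem exists_perJet_four {A B D : ℝ} (hA : A ≠ 0)
    (h : ∀ k : ℤ, A * (2 * Real.pi * k) ^ 4 - B * (2 * Real.pi * k) ^ 2 + D ≠ 0) {g : ℝ → ℝ}
    (hg : MemLp g 2 unitMeasure) :
    ∃ V, PerJet 4 V ∧ ∀ x, A * V 4 x + B * V 2 x + D * V 0 x = g x := by
  have hAc : (A : ℂ) ≠ 0 := by exact_mod_cast hA
  have hgi : IntervalIntegrable (fun x => ((g x / A : ℝ) : ℂ)) volume 0 1 :=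
    intervalIntegrable_iff_unitMeasure.2 ((integrable_of_memLp_two hg).div_const A).ofReal
  -- The operator is `A(∂² - σ₁)(∂² - σ₂)` with the roots of `Aσ² + Bσ + D`, possibly not real.
  -- Solve `z'' = σ₁z + g/A`, then `v'' = σ₂v + z`.
  obtain ⟨δ, hδ⟩ := IsAlgClosed.exists_pow_nat_eq ((B : ℂ) ^ 2 - 4 * A * D) (n := 2) two_pos
  obtain ⟨σ₁, h₁⟩ : ∃ σ₁ : ℂ, σ₁ = (-B + δ) / (2 * A) := ⟨_, rfl⟩
  obtain ⟨σ₂, h₂⟩ : ∃ σ₂ : ℂ, σ₂ = (-B - δ) / (2 * A) := ⟨_, rfl⟩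
  have hsum : A * (σ₁ + σ₂) = -B := by rw [h₁, h₂]; field_simp; ring
  have hprod : A * (σ₁ * σ₂) = D := by
    rw [h₁, h₂]; field_simp; linear_combination -hδ
  have hne : ∀ σ : ℂ, A * σ ^ 2 + B * σ + D = 0 → ∀ k : ℤ, σ ≠ -(2 * Real.pi * k) ^ 2 := by
    intro σ hσ k hk
    refine h k ?_
    rw [hk] at hσ
    have : (A : ℂ) * (2 * Real.pi * k) ^ 4 - B * (2 * Real.pi * k) ^ 2 + D = 0 := by
      linear_combination hσ
    exact_mod_cast this
  have r1 : A * σ₁ ^ 2 + B * σ₁ + D = 0 := by linear_combination -hprod + σ₁ * hsum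
  have r2 : A * σ₂ ^ 2 + B * σ₂ + D = 0 := by linear_combination -hprod + σ₂ * hsum
  obtain ⟨z, z₁, hz, hz₁, pz, pz₁⟩ := exists_periodic_second_order (hne σ₁ r1) hgi
  have hu : uIcc (0 : ℝ) 1 = Icc 0 1 := uIcc_of_le zero_le_one
  obtain ⟨v, v₁, hv, hv₁, pv, pv₁⟩ := exists_periodic_second_order (hne σ₂ r2)
    (hu ▸ hz.continuousOn : ContinuousOn z (uIcc 0 1)).intervalIntegrable
  have hv₂ := (hv.const_mul σ₂).add hz
  have hv₃ := (hv₁.const_mul σ₂).add hz₁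
  let V : ℕ → ℝ → ℝ := fun j => match j with
    | 0 => fun x => (v x).re
    | 1 => fun x => (v₁ x).re
    | 2 => fun x => (σ₂ * v x + z x).re
    | 3 => fun x => (σ₂ * v₁ x + z₁ x).re
    | _ => fun x => A⁻¹ * (g x - B * (σ₂ * v x + z x).re - D * (v x).re)
  refine ⟨V, ⟨⟨fun j hj => ?_, ?_⟩, fun j hj => ?_⟩, fun x => ?_⟩
  · interval_cases j
    · exact hv.re
    · exact hv₁.re
    · exact hv₂.re
    · refine hv₃.re.congr_deriv (ae_of_all _ fun x => ?_)
      have e : (A : ℂ) * (σ₂ * (σ₂ * v x + z x) + (σ₁ * z x + ((g x / A : ℝ) : ℂ))) =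
          g x - B * (σ₂ * v x + z x) - D * v x := by
        push_cast
        field_simp
        linear_combination (σ₂ * v x + z x) * hsum - v x * hprod
      have e' := congrArg Complex.re e
      simp only [Complex.re_ofReal_mul, Complex.sub_re, Complex.ofReal_re] at e'
      simp only [V]
      rw [← e', inv_mul_cancel_left₀ hA]
  · exact ((hg.sub ((hv₂.re.memLp (p := 2)).const_mul B)).sub
      ((hv.re.memLp (p := 2)).const_mul D)).const_mul A⁻¹
  · interval_cases j
    · simp only [V, pv]
    · simp only [V, pv₁]
    · simp only [V, pv, pz]
    · simp only [V, pv₁, pz₁]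
  · simp only [V]
    field_simp
    ring

/-! ### Self-adjointness and spectrum -/

section

variable {d : ℕ} {a : ℕ → ℝ} {L : ℝ}

theorem PerJet.integral_succ_mul {m : ℕ} {V W : ℕ → ℝ → ℝ} (H : PerJet m V) (K : PerJet m W)
    {i j : ℕ} (hi : i < m) (hj : j < m) :
    ∫ x, V (i + 1) x * W j x ∂unitMeasure = -∫ x, V i x * W (j + 1) x ∂unitMeasure := by
  rw [(H.1.1 i hi).integral_mul_periodic (K.1.1 j hj) (H.2 i hi) (K.2 j hj), neg_neg]

theorem PerJet.integral_mul_eq {m : ℕ} {V W : ℕ → ℝ → ℝ} (H : PerJet m V) (K : PerJet m W)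
    {l : ℕ} (hl : l ≤ m) :
    ∫ x, V l x * W 0 x ∂unitMeasure = (-1) ^ l * ∫ x, V 0 x * W l x ∂unitMeasure := by
  have key : ∀ k ≤ l, ∫ x, V l x * W 0 x ∂unitMeasure =
      (-1) ^ k * ∫ x, V (l - k) x * W k x ∂unitMeasure := by
    intro k hk
    induction k with
    | zero => simp
    | succ k ih =>
      rw [ih (by omega), show l - k = (l - (k + 1)) + 1 by omega,
        H.integral_succ_mul K (by omega) (by omega)]
      ring
  simpa using key l le_rfl

/-- The linear part applied to a jet. -/
def linJet (d : ℕ) (a : ℕ → ℝ) (L : ℝ) (V : ℕ → ℝ → ℝ) (x : ℝ) : ℝ :=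
  ∑ l ∈ Finset.range (d + 1), 1 / L ^ l * a l * V l x

theorem Jet.linOp_ae_eq {V : ℕ → ℝ → ℝ} (H : Jet d V) {v : ℝ → ℝ} (hv : v =ᵐ[unitMeasure] V 0) :
    linOp d a L v =ᵐ[unitMeasure] linJet d a L V := by
  have h : ∀ᵐ x ∂unitMeasure, ∀ l, l ≤ d → weakDeriv^[l] v x = V l x := by
    rw [ae_all_iff]
    intro l
    by_cases hl : l ≤ d
    · filter_upwards [(H.memSobolev hv).2 l hl] with x hx _ using hx
    · exact ae_of_all _ fun x h => absurd h hl
  filter_upwards [h] with x hx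
  refine Finset.sum_congr rfl fun l hl => ?_
  rw [hx l (by have := Finset.mem_range.1 hl; omega)]

theorem Jet.memLp_linJet {V : ℕ → ℝ → ℝ} (H : Jet d V) : MemLp (linJet d a L V) 2 unitMeasure :=
  memLp_finsetSum _ fun l hl =>
    (H.memLp (by have := Finset.mem_range.1 hl; omega)).const_mul (1 / L ^ l * a l)

theorem linOp_congr {v w : ℝ → ℝ} (h : v =ᵐ[unitMeasure] w) :
    linOp d a L v =ᵐ[unitMeasure] linOp d a L w := by
  filter_upwards [ae_all_iff.2 fun j => iterate_weakDeriv_ae_eq h j] with x hx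
  simp only [linOp, hx]

theorem PerJet.linJet_symm (ha : ∀ l, Odd l → a l = 0) {V W : ℕ → ℝ → ℝ} (H : PerJet d V)
    (K : PerJet d W) : ∫ x, linJet d a L V x * W 0 x ∂unitMeasure =
      ∫ x, V 0 x * linJet d a L W x ∂unitMeasure := by
  have m0 := H.1.memLp (Nat.zero_le d)
  have n0 := K.1.memLp (Nat.zero_le d)
  have hle : ∀ l ∈ Finset.range (d + 1), l ≤ d := fun l hl => by
    have := Finset.mem_range.1 hl; omega
  simp only [linJet, Finset.sum_mul, Finset.mul_sum]
  rw [integral_finsetSum, integral_finsetSum]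
  · refine Finset.sum_congr rfl fun l hl => ?_
    have e1 : ∀ x, 1 / L ^ l * a l * V l x * W 0 x = 1 / L ^ l * a l * (V l x * W 0 x) :=
      fun x => by ring
    have e2 : ∀ x, V 0 x * (1 / L ^ l * a l * W l x) = 1 / L ^ l * a l * (V 0 x * W l x) :=
      fun x => by ring
    simp only [e1, e2, integral_const_mul]
    rw [H.integral_mul_eq K (hle l hl)]
    rcases Nat.even_or_odd l with h | h
    · rw [h.neg_one_pow, one_mul]
    · rw [ha l h]; ring
  · exact fun l hl => integrable_mul m0 ((K.1.memLp (hle l hl)).const_mul _)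
  · exact fun l hl => integrable_mul ((H.1.memLp (hle l hl)).const_mul _) n0

/-- Symmetry of `𝓛 - s` on periodic functions. -/
theorem linOp_symm (ha : ∀ l, Odd l → a l = 0) {v w : ℝ → ℝ} (hv : MemPeriodicSobolev d v)
    (hw : MemPeriodicSobolev d w) :
    MemLp (linOp d a L v) 2 unitMeasure ∧
    ∫ x, linOp d a L v x * w x ∂unitMeasure = ∫ x, v x * linOp d a L w x ∂unitMeasure := by
  obtain ⟨V, hV, v0⟩ := memPeriodicSobolev_iff.1 hv
  obtain ⟨W, hW, w0⟩ := memPeriodicSobolev_iff.1 hw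
  have h1 := hV.1.linOp_ae_eq (a := a) (L := L) v0
  have h2 := hW.1.linOp_ae_eq (a := a) (L := L) w0
  refine ⟨hV.1.memLp_linJet.ae_eq h1.symm, ?_⟩
  exact (integral_congr_ae (h1.mul w0)).trans
    ((hV.linJet_symm ha hW).trans (integral_congr_ae (v0.mul h2)).symm)

theorem ae_eq_zero_of_integral_sq {v : ℝ → ℝ} (hv : MemLp v 2 unitMeasure)
    (h : ∫ x, v x * v x ∂unitMeasure = 0) : v =ᵐ[unitMeasure] 0 := by
  rw [integral_eq_zero_iff_of_nonneg (fun x => mul_self_nonneg _) (integrable_mul hv hv)] at h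
  filter_upwards [h] with x hx
  exact mul_self_eq_zero.1 hx

/-- If `𝓛 - s` is onto whenever `s` is not one of the numbers `e k`, and if these are eigenvalues,
then `𝓛` is self-adjoint and its spectrum consists of the `e k`. -/
theorem isSelfAdjointLin_and_linSpectrum {e : ℤ → ℝ} (ha : ∀ l, Odd l → a l = 0)
    (hsurj : ∀ s, (∀ k, s ≠ e k) → ∀ g, MemLp g 2 unitMeasure → ∃ v, MemPeriodicSobolev d v ∧
      (fun x => linOp d a L v x - s * v x) =ᵐ[unitMeasure] g)
    (heig : ∀ k, ∃ v, MemPeriodicSobolev d v ∧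
      (fun x => linOp d a L v x - e k * v x) =ᵐ[unitMeasure] 0 ∧ ¬ v =ᵐ[unitMeasure] 0)
    {s₀ : ℝ} (hs₀ : ∀ k, s₀ ≠ e k) :
    IsSelfAdjointLin d a L ∧ linSpectrum d a L = range e := by
  have hmem : ∀ {v}, MemPeriodicSobolev d v → MemLp v 2 unitMeasure := fun hv => hv.1.memLp
  have hsym : ∀ {s : ℝ} {v z : ℝ → ℝ}, MemPeriodicSobolev d v → MemPeriodicSobolev d z →
      ∫ x, (linOp d a L v x - s * v x) * z x ∂unitMeasure =
        ∫ x, v x * (linOp d a L z x - s * z x) ∂unitMeasure := by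
    intro s v z hv hz
    obtain ⟨m1, h1⟩ := linOp_symm (L := L) ha hv hz
    obtain ⟨m2, -⟩ := linOp_symm (L := L) ha hz hv
    have i0 := (integrable_mul (hmem hv) (hmem hz)).const_mul s
    have e1 : ∀ x, (linOp d a L v x - s * v x) * z x = linOp d a L v x * z x - s * (v x * z x) :=
      fun x => by ring
    have e2 : ∀ x, v x * (linOp d a L z x - s * z x) = v x * linOp d a L z x - s * (v x * z x) :=
      fun x => by ring
    simp only [e1, e2]
    rw [integral_sub (integrable_mul m1 (hmem hz)) i0, integral_sub (integrable_mul (hmem hv) m2) i0,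
      h1]
  constructor
  · intro w g hw hg
    constructor
    · intro h
      -- If `w` is in the domain of the adjoint, solve `(𝓛 - s₀)z = g - s₀w` in `H^d_per`. Then `w -
      -- z` is orthogonal to the range of `𝓛 - s₀`, which is all of L², so `w = z`.
      obtain ⟨z, hz, ez⟩ := hsurj s₀ hs₀ (fun x => g x - s₀ * w x) (memLp_sub hg (hw.const_mul s₀))
      have mwz : MemLp (fun x => w x - z x) 2 unitMeasure := memLp_sub hw (hmem hz)
      obtain ⟨v, hv, ev⟩ := hsurj s₀ hs₀ _ mwz
      have m1 := (linOp_symm (L := L) ha hv hv).1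
      have h0 : ∫ x, (w x - z x) * (w x - z x) ∂unitMeasure = 0 := by
        have c1 : ∫ x, (w x - z x) * (w x - z x) ∂unitMeasure =
            ∫ x, (linOp d a L v x - s₀ * v x) * (w x - z x) ∂unitMeasure :=
          integral_congr_ae (by filter_upwards [ev] with x hx; rw [hx])
        have c2 : ∫ x, (linOp d a L v x - s₀ * v x) * z x ∂unitMeasure =
            ∫ x, v x * (g x - s₀ * w x) ∂unitMeasure := by
          rw [hsym hv hz]
          exact integral_congr_ae (by filter_upwards [ez] with x hx; rw [hx])
        have mA : MemLp (fun x => linOp d a L v x - s₀ * v x) 2 unitMeasure :=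
          memLp_sub m1 ((hmem hv).const_mul s₀)
        have c3 : ∫ x, (linOp d a L v x - s₀ * v x) * w x ∂unitMeasure =
            ∫ x, v x * (g x - s₀ * w x) ∂unitMeasure := by
          have i0 := (integrable_mul (hmem hv) hw).const_mul s₀
          have e1 : ∀ x, (linOp d a L v x - s₀ * v x) * w x =
            linOp d a L v x * w x - s₀ * (v x * w x) := fun x => by ring
          have e2 : ∀ x, v x * (g x - s₀ * w x) = v x * g x - s₀ * (v x * w x) :=
            fun x => by ring
          simp only [e1, e2]
          rw [integral_sub (integrable_mul m1 hw) i0,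
            integral_sub (integrable_mul (hmem hv) hg) i0, h v hv]
        rw [c1]
        simp only [mul_sub]
        rw [integral_sub (integrable_mul mA hw) (integrable_mul mA (hmem hz)), c2, c3, sub_self]
      have hwz := ae_eq_zero_of_integral_sq mwz h0
      have hwz' : w =ᵐ[unitMeasure] z := by
        filter_upwards [hwz] with x hx using sub_eq_zero.1 hx
      refine ⟨?_, ?_⟩
      · obtain ⟨Z, hZ, z0⟩ := memPeriodicSobolev_iff.1 hz
        exact memPeriodicSobolev_iff.2 ⟨Z, hZ, hwz'.trans z0⟩
      · filter_upwards [linOp_congr (d := d) (a := a) (L := L) hwz', hwz', ez] with x h1 h2 h3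
        rw [h1]
        rw [h2] at h3
        linarith
    · rintro ⟨hp, hg'⟩ v hv
      rw [(linOp_symm ha hv hp).2]
      exact integral_congr_ae (by filter_upwards [hg'] with x hx; rw [hx])
  · ext s
    simp only [linSpectrum, mem_ofPred_eq, mem_range]
    constructor
    · intro hs
      by_contra! hne
      refine hs ⟨hsurj s fun k => (hne k).symm, fun v hv h => ?_⟩
      -- Surjectivity and symmetry give injectivity: a kernel element is `v = (𝓛 - s)z`, so `∫ v² =
      -- ∫ ((𝓛 - s)v) z = 0`.
      obtain ⟨z, hz, ez⟩ := hsurj s (fun k => (hne k).symm) v (hmem hv)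
      refine ae_eq_zero_of_integral_sq (hmem hv) ?_
      have c1 : ∫ x, v x * v x ∂unitMeasure =
          ∫ x, v x * (linOp d a L z x - s * z x) ∂unitMeasure :=
        integral_congr_ae (by filter_upwards [ez] with x hx; rw [hx])
      rw [c1, ← hsym hv hz]
      refine (integral_congr_ae (g := fun _ => (0 : ℝ)) ?_).trans (by simp)
      filter_upwards [h] with x hx
      rw [hx]
      simp
    · rintro ⟨k, rfl⟩ ⟨-, hinj⟩
      obtain ⟨v, hv, h1, h2⟩ := heig k
      exact h2 (hinj v hv h1)

/-- The derivatives of `cos (2πkx)`. -/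
def cosJet (k : ℤ) (j : ℕ) (x : ℝ) : ℝ :=
  (2 * Real.pi * k) ^ j * Real.cos (2 * Real.pi * k * x + j * (Real.pi / 2))

theorem perJet_cosJet (m : ℕ) (k : ℤ) : PerJet m (cosJet k) := by
  have hP : ∀ j, IsPrim (cosJet k j) (cosJet k (j + 1)) := by
    intro j
    refine isPrim_of_hasDerivAt (fun x => ?_) (by unfold cosJet; fun_prop)
    have h1 : HasDerivAt (fun x : ℝ => 2 * Real.pi * k * x + j * (Real.pi / 2))
        (2 * Real.pi * k * 1) x := ((hasDerivAt_id x).const_mul _).add_const _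
    refine (h1.cos.const_mul ((2 * Real.pi * k) ^ j)).congr_deriv ?_
    have : Real.cos (2 * Real.pi * k * x + (j + 1 : ℕ) * (Real.pi / 2)) =
        -Real.sin (2 * Real.pi * k * x + j * (Real.pi / 2)) := by
      rw [← Real.cos_add_pi_div_two]
      congr 1
      push_cast
      ring
    rw [cosJet, this]
    ring
  refine ⟨⟨fun j _ => hP j, (hP m).memLp⟩, fun j _ => ?_⟩
  have : 2 * Real.pi * k * 1 + j * (Real.pi / 2) =
      2 * Real.pi * k * 0 + j * (Real.pi / 2) + k * (2 * Real.pi) := by ring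
  rw [cosJet, cosJet, this, Real.cos_add_int_mul_two_pi]

theorem cosJet_two (k : ℤ) (x : ℝ) : cosJet k 2 x = -(2 * Real.pi * k) ^ 2 * cosJet k 0 x := by
  have : 2 * Real.pi * k * x + (2 : ℕ) * (Real.pi / 2) = 2 * Real.pi * k * x + Real.pi := by
    push_cast; ring
  rw [cosJet, cosJet, this, Real.cos_add_pi]
  simp

theorem cosJet_four (k : ℤ) (x : ℝ) : cosJet k 4 x = (2 * Real.pi * k) ^ 4 * cosJet k 0 x := by
  have : 2 * Real.pi * k * x + (4 : ℕ) * (Real.pi / 2) = 2 * Real.pi * k * x + 2 * Real.pi := by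
    push_cast; ring
  rw [cosJet, cosJet, this, Real.cos_add_two_pi]
  simp

theorem cosJet_zero_ne (k : ℤ) : ¬ cosJet k 0 =ᵐ[unitMeasure] 0 := by
  intro h
  have h1 : cosJet k 0 0 = 0 := eqOn_Icc_of_ae_eq (w := fun _ => 0) ((perJet_cosJet 1 k).1.1 0 one_pos).continuousOn
    continuousOn_const h (show (0 : ℝ) ∈ Icc (0 : ℝ) 1 by simp)
  simp [cosJet] at h1

theorem exists_memPeriodicSobolev_of_perJet {g : ℝ → ℝ} {s : ℝ}
    (h : ∃ V, PerJet d V ∧ ∀ x, linJet d a L V x - s * V 0 x = g x) :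
    ∃ v, MemPeriodicSobolev d v ∧ (fun x => linOp d a L v x - s * v x) =ᵐ[unitMeasure] g := by
  obtain ⟨V, hV, hg⟩ := h
  refine ⟨V 0, memPeriodicSobolev_iff.2 ⟨V, hV, EventuallyEq.rfl⟩, ?_⟩
  filter_upwards [hV.1.linOp_ae_eq (a := a) (L := L) EventuallyEq.rfl] with x hx
  rw [hx, hg]

theorem exists_eigenfunction {k : ℤ} {s : ℝ}
    (h : ∀ x, linJet d a L (cosJet k) x = s * cosJet k 0 x) :
    ∃ v, MemPeriodicSobolev d v ∧
      (fun x => linOp d a L v x - s * v x) =ᵐ[unitMeasure] 0 ∧ ¬ v =ᵐ[unitMeasure] 0 := by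
  refine ⟨cosJet k 0, memPeriodicSobolev_iff.2 ⟨_, perJet_cosJet d k, EventuallyEq.rfl⟩, ?_,
    cosJet_zero_ne k⟩
  filter_upwards [(perJet_cosJet d k).1.linOp_ae_eq (a := a) (L := L) EventuallyEq.rfl] with x hx
  rw [hx, h]
  simp

theorem linJet_kpp (D r₁ L : ℝ) (V : ℕ → ℝ → ℝ) (x : ℝ) :
    linJet 2 (kppLin D r₁) L V x = D / L ^ 2 * V 2 x + r₁ * V 0 x := by
  simp [linJet, kppLin, Finset.sum_range_succ]
  ring

theorem linJet_ks (p q L : ℝ) (V : ℕ → ℝ → ℝ) (x : ℝ) :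
    linJet 4 (ksLin p q) L V x = q / L ^ 4 * V 4 x + p / L ^ 2 * V 2 x := by
  simp [linJet, ksLin, Finset.sum_range_succ]
  ring

theorem burgersLin_eq_kppLin (ν : ℝ) : burgersLin ν = kppLin ν 0 := by
  funext l
  simp [burgersLin, kppLin]

/-- The point `s₀` lies above every eigenvalue. The case `r₁ = 0` is the linear part of the Burgers
equation. -/
theorem kpp_spectral {D r₁ L s₀ : ℝ} (hL : 0 < L) (hD : 0 < D) (hs₀ : r₁ < s₀) :
    IsSelfAdjointLin 2 (kppLin D r₁) L ∧
      linSpectrum 2 (kppLin D r₁) L =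
        range (fun k : ℤ => r₁ - D * (2 * Real.pi * k / L) ^ 2) := by
  refine isSelfAdjointLin_and_linSpectrum (s₀ := s₀) (fun l hl => ?_) (fun s hs g hg => ?_)
    (fun k => ?_) fun k => ?_
  · have h2 : l ≠ 2 := by rintro rfl; exact absurd hl (by decide)
    have h0 : l ≠ 0 := by rintro rfl; exact absurd hl (by decide)
    simp [kppLin, h2, h0]
  · obtain ⟨V, hV, h⟩ := exists_perJet_two (A := D / L ^ 2) (B := r₁ - s) (by positivity)
      (fun k hk => hs k (by
        have : D * (2 * Real.pi * k / L) ^ 2 = D / L ^ 2 * (2 * Real.pi * k) ^ 2 := by ring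
        rw [this]
        linarith)) hg
    refine exists_memPeriodicSobolev_of_perJet ⟨V, hV, fun x => ?_⟩
    rw [linJet_kpp, ← h]
    ring
  · refine exists_eigenfunction (k := k) fun x => ?_
    rw [linJet_kpp, cosJet_two]
    ring
  · have : 0 ≤ D * (2 * Real.pi * k / L) ^ 2 := by positivity
    linarith

theorem ks_spectral {p q L s₀ : ℝ} (hL : 0 < L) (hq : q < 0)
    (hs₀ : ∀ k : ℤ, s₀ ≠ -p * (2 * Real.pi * k / L) ^ 2 + q * (2 * Real.pi * k / L) ^ 4) :
    IsSelfAdjointLin 4 (ksLin p q) L ∧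
      linSpectrum 4 (ksLin p q) L =
        range (fun k : ℤ => -p * (2 * Real.pi * k / L) ^ 2 + q * (2 * Real.pi * k / L) ^ 4) := by
  refine isSelfAdjointLin_and_linSpectrum (s₀ := s₀) (fun l hl => ?_) (fun s hs g hg => ?_)
    (fun k => ?_) hs₀
  · have h2 : l ≠ 2 := by rintro rfl; exact absurd hl (by decide)
    have h0 : l ≠ 4 := by rintro rfl; exact absurd hl (by decide)
    simp [ksLin, h2, h0]
  · obtain ⟨V, hV, h⟩ := exists_perJet_four (A := q / L ^ 4) (B := p / L ^ 2) (D := -s)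
      (div_ne_zero hq.ne (by positivity))
      (fun k hk => hs k (by
        have e1 : p * (2 * Real.pi * k / L) ^ 2 = p / L ^ 2 * (2 * Real.pi * k) ^ 2 := by ring
        have e2 : q * (2 * Real.pi * k / L) ^ 4 = q / L ^ 4 * (2 * Real.pi * k) ^ 4 := by ring
        rw [neg_mul, e1, e2]
        linarith)) hg
    refine exists_memPeriodicSobolev_of_perJet ⟨V, hV, fun x => ?_⟩
    rw [linJet_ks, ← h]
    ring
  · refine exists_eigenfunction (k := k) fun x => ?_
    rw [linJet_ks, cosJet_two, cosJet_four]
    ring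

end

/-! ### The spectral gap -/

/-- A gap is attained at the first mode if the eigenvalues decrease away from it. -/
theorem isGap_of_le {e : ℤ → ℝ} {β : ℝ} (hβ : 0 < β) (h1 : e 1 = -β)
    (hle : ∀ k : ℤ, k ≠ 0 → e k ≤ -β) : IsGap e β :=
  ⟨hβ, ⟨1, by simp, h1⟩, by rintro _ ⟨k, hk, rfl⟩; exact hle k hk⟩

theorem one_le_sq_cast {k : ℤ} (hk : k ≠ 0) : (1 : ℝ) ≤ (k : ℝ) ^ 2 := by
  have : (0 : ℤ) < k ^ 2 := by positivity
  have : (1 : ℤ) ≤ k ^ 2 := this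
  exact_mod_cast this

theorem isGap_kpp {D r₁ L : ℝ} (hL : 0 < L) (hD : 0 < D) (hr : r₁ ≤ 0) :
    IsGap (fun k : ℤ => r₁ - D * (2 * Real.pi * k / L) ^ 2) (D * (2 * Real.pi / L) ^ 2 - r₁) := by
  have hpos : 0 < D * (2 * Real.pi / L) ^ 2 := by have := Real.pi_pos; positivity
  refine isGap_of_le (by linarith) (by simp) fun k hk => ?_
  have e : D * (2 * Real.pi * k / L) ^ 2 = D * (2 * Real.pi / L) ^ 2 * k ^ 2 := by ring
  simp only [e]
  nlinarith [one_le_sq_cast hk]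

/-- The `k`-th eigenvalue is `-k²β + k²(k² - 1) q (2π/L)⁴`, whose last term is nonpositive; and `β =
(2π/L)² (p - (2π/L)² q) > 0`. -/
theorem isGap_ks {p q L : ℝ} (hL : 0 < L) (hq : q < 0) (hp : (2 * Real.pi / L) ^ 2 * q < p) :
    IsGap (fun k : ℤ => -p * (2 * Real.pi * k / L) ^ 2 + q * (2 * Real.pi * k / L) ^ 4)
      (p * (2 * Real.pi / L) ^ 2 - q * (2 * Real.pi / L) ^ 4) := by
  have hs : 0 < (2 * Real.pi / L) ^ 2 := by have := Real.pi_pos; positivity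
  have e4 : (2 * Real.pi / L) ^ 4 = ((2 * Real.pi / L) ^ 2) ^ 2 := by ring
  have hβ : 0 < p * (2 * Real.pi / L) ^ 2 - q * (2 * Real.pi / L) ^ 4 := by
    rw [e4]; nlinarith
  refine isGap_of_le hβ (by simp; ring) fun k hk => ?_
  have h1 := one_le_sq_cast hk
  have e : -p * (2 * Real.pi * k / L) ^ 2 + q * (2 * Real.pi * k / L) ^ 4 =
      -((k : ℝ) ^ 2 * (p * (2 * Real.pi / L) ^ 2 - q * (2 * Real.pi / L) ^ 4)) +
        (k : ℝ) ^ 2 * ((k : ℝ) ^ 2 - 1) * (q * (2 * Real.pi / L) ^ 4) := by ring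
  simp only [e]
  have h2 : (k : ℝ) ^ 2 * ((k : ℝ) ^ 2 - 1) * (q * (2 * Real.pi / L) ^ 4) ≤ 0 :=
    mul_nonpos_of_nonneg_of_nonpos (mul_nonneg (sq_nonneg _) (by linarith))
      (mul_nonpos_of_nonpos_of_nonneg hq.le (by positivity))
  nlinarith

/-! ### Stability criteria and the values of the parameters -/

section

variable {d : ℕ} {a : ℕ → ℝ} {b : ℕ → ℕ → ℝ} {L β μ : ℝ} {f u : ℝ → ℝ → ℝ}

/-- Stability under the conditions `𝓡 < 1` and `𝓡* < 1`. -/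
theorem IsDissipative.stable_of_forcing {fmax : ℝ} (hD : IsDissipative d a b L β μ) (hd : 2 ≤ d)
    (hμ0 : 0 ≤ μ) (hu : IsSolution d a b L f u) (hf : IsForcing f fmax)
    (h1 : fmax + μ * h2norm (u 0) ^ 2 < β * h2norm (u 0)) (h2 : 2 * μ * h2norm (u 0) < β) :
    IsTrajectoryAsympStable d a b L f u := by
  -- Both conditions are open, hence survive for some `M` strictly above the initial norm, as the
  -- barrier argument requires.
  have hev : ∀ᶠ M in 𝓝[>] h2norm (u 0),
      fmax + μ * M ^ 2 < β * M ∧ 2 * μ * M < β := by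
    refine nhdsWithin_le_nhds (Filter.Eventually.and ?_ ?_)
    · exact (by fun_prop : ContinuousAt (fun M : ℝ => fmax + μ * M ^ 2) _).eventually_lt
        (by fun_prop) h1
    · exact (by fun_prop : ContinuousAt (fun M : ℝ => 2 * μ * M) _).eventually_lt
        continuousAt_const h2
  obtain ⟨M, ⟨hM1, hM2⟩, hM⟩ := (hev.and self_mem_nhdsWithin).exists
  exact hD.isTrajectoryAsympStable hd hμ0 hu hf hM hM2 hM1

/-- Without forcing the barrier condition `μM² < βM` follows from `2μM < β`. Taking `M` strictly
above the initial norm also covers zero initial data. -/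
theorem IsDissipative.stable_of_unforced (hD : IsDissipative d a b L β μ) (hd : 2 ≤ d)
    (hμ0 : 0 ≤ μ) (hu : IsSolution d a b L (fun _ _ => 0) u) (h2 : 2 * μ * h2norm (u 0) < β) :
    IsTrajectoryAsympStable d a b L (fun _ _ => 0) u := by
  have hev : ∀ᶠ M in 𝓝[>] h2norm (u 0), 2 * μ * M < β :=
    nhdsWithin_le_nhds ((by fun_prop : ContinuousAt (fun M : ℝ => 2 * μ * M) _).eventually_lt
      continuousAt_const h2)
  obtain ⟨M, hM1, hM⟩ := (hev.and self_mem_nhdsWithin).exists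
  have hMpos : 0 < M := (h2norm_nonneg _).trans_lt hM
  refine hD.isTrajectoryAsympStable hd hμ0 hu isForcing_zero hM hM1 ?_
  have : 0 ≤ μ * M := mul_nonneg hμ0 hMpos.le
  nlinarith

end

theorem muParam_burgers (C L : ℝ) : muParam C 2 burgersQuad L = C / L := by
  simp [muParam, burgersQuad, Finset.sum_range_succ]
  ring

theorem muParam_kpp (C L r₂ : ℝ) : muParam C 2 (kppQuad r₂) L = C * |r₂| := by
  simp [muParam, kppQuad, Finset.sum_range_succ]

theorem muParam_ks (C L c : ℝ) : muParam C 4 (ksQuad c) L = C * |c| / L := by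
  simp [muParam, ksQuad, Finset.sum_range_succ]
  ring

theorem burgers_stabR_lt_one_iff {C L ν fmax y₀ : ℝ} (hL : 0 < L) (hν : 0 < ν) (hy : 0 < y₀) :
    stabR fmax (C / L) (ν * (2 * Real.pi / L) ^ 2) y₀ < 1 ↔
      effVelocity fmax (C / L) y₀ * L ^ 2 / ν < (2 * Real.pi) ^ 2 := by
  have hpi := Real.pi_pos
  have e : stabR fmax (C / L) (ν * (2 * Real.pi / L) ^ 2) y₀ =
      effVelocity fmax (C / L) y₀ * L ^ 2 / ν / (2 * Real.pi) ^ 2 := by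
    unfold stabR effVelocity
    field_simp
  rw [e, div_lt_one (by positivity)]

theorem burgers_stabRstar_lt_one_iff {C L ν y₀ : ℝ} (hL : 0 < L) (hν : 0 < ν) :
    stabRstar (C / L) (ν * (2 * Real.pi / L) ^ 2) y₀ < 1 ↔
      2 * C * y₀ * L / ν < (2 * Real.pi) ^ 2 := by
  have hpi := Real.pi_pos
  have e : stabRstar (C / L) (ν * (2 * Real.pi / L) ^ 2) y₀ =
      2 * C * y₀ * L / ν / (2 * Real.pi) ^ 2 := by
    unfold stabRstar
    field_simp
  rw [e, div_lt_one (by positivity)]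

end QuadPDE

end

theorem mainTheorem3 :
    QuadPDE.IsAlgebraConstant 33.02 ∧
    ∀ (C L : ℝ), QuadPDE.IsAlgebraConstant C → 0 < L →
    -- forced Burgers equation
    (∀ ν : ℝ, 0 < ν →
      QuadPDE.IsSelfAdjointLin 2 (QuadPDE.burgersLin ν) L ∧
      QuadPDE.linSpectrum 2 (QuadPDE.burgersLin ν) L =
        Set.range (fun k : ℤ => -ν * (2 * Real.pi * k / L) ^ 2) ∧
      QuadPDE.IsGap (fun k : ℤ => -ν * (2 * Real.pi * k / L) ^ 2) (ν * (2 * Real.pi / L) ^ 2) ∧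
      QuadPDE.muParam C 2 QuadPDE.burgersQuad L = C / L ∧
      (∀ fmax y₀ : ℝ, 0 < y₀ →
        (QuadPDE.stabR fmax (C / L) (ν * (2 * Real.pi / L) ^ 2) y₀ < 1 ↔
          QuadPDE.effVelocity fmax (C / L) y₀ * L ^ 2 / ν < (2 * Real.pi) ^ 2) ∧
        (QuadPDE.stabRstar (C / L) (ν * (2 * Real.pi / L) ^ 2) y₀ < 1 ↔
          2 * C * y₀ * L / ν < (2 * Real.pi) ^ 2) ∧
        -- the first condition in terms of the Reynolds number `v L / ν`
        (QuadPDE.effVelocity fmax (C / L) y₀ * L ^ 2 / ν < (2 * Real.pi) ^ 2 ↔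
          QuadPDE.effVelocity fmax (C / L) y₀ * L / ν < (2 * Real.pi) ^ 2 / L)) ∧
      ∀ (f u : ℝ → ℝ → ℝ) (fmax : ℝ), QuadPDE.IsForcing f fmax →
        QuadPDE.IsSolution 2 (QuadPDE.burgersLin ν) QuadPDE.burgersQuad L f u →
        0 < QuadPDE.h2norm (u 0) →
        QuadPDE.effVelocity fmax (C / L) (QuadPDE.h2norm (u 0)) * L ^ 2 / ν
          < (2 * Real.pi) ^ 2 →
        2 * C * QuadPDE.h2norm (u 0) * L / ν < (2 * Real.pi) ^ 2 →
        QuadPDE.IsTrajectoryAsympStable 2 (QuadPDE.burgersLin ν) QuadPDE.burgersQuad L f u) ∧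
    -- KPP–Fisher equation
    (∀ D r₁ r₂ : ℝ, 0 < D → r₁ < 0 →
      QuadPDE.IsSelfAdjointLin 2 (QuadPDE.kppLin D r₁) L ∧
      QuadPDE.linSpectrum 2 (QuadPDE.kppLin D r₁) L =
        Set.range (fun k : ℤ => r₁ - D * (2 * Real.pi * k / L) ^ 2) ∧
      QuadPDE.IsGap (fun k : ℤ => r₁ - D * (2 * Real.pi * k / L) ^ 2)
        (D * (2 * Real.pi / L) ^ 2 - r₁) ∧
      QuadPDE.muParam C 2 (QuadPDE.kppQuad r₂) L = C * |r₂| ∧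
      (∀ y₀ : ℝ,
        QuadPDE.stabR 0 (C * |r₂|) (D * (2 * Real.pi / L) ^ 2 - r₁) y₀ =
          |r₂| * C * y₀ / (D * (2 * Real.pi / L) ^ 2 - r₁) ∧
        QuadPDE.stabRstar (C * |r₂|) (D * (2 * Real.pi / L) ^ 2 - r₁) y₀ =
          2 * |r₂| * C * y₀ / (D * (2 * Real.pi / L) ^ 2 - r₁)) ∧
      ∀ u : ℝ → ℝ → ℝ,
        QuadPDE.IsSolution 2 (QuadPDE.kppLin D r₁) (QuadPDE.kppQuad r₂) L (fun _ _ => 0) u →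
        |r₂| * C * QuadPDE.h2norm (u 0) / (D * (2 * Real.pi / L) ^ 2 - r₁) < 1 →
        2 * |r₂| * C * QuadPDE.h2norm (u 0) / (D * (2 * Real.pi / L) ^ 2 - r₁) < 1 →
        QuadPDE.IsTrajectoryAsympStable 2 (QuadPDE.kppLin D r₁) (QuadPDE.kppQuad r₂) L
          (fun _ _ => 0) u) ∧
    -- generalized Kuramoto–Sivashinsky equation
    (∀ a b c : ℝ, b < 0 → (2 * Real.pi / L) ^ 2 * b < a →
      QuadPDE.IsSelfAdjointLin 4 (QuadPDE.ksLin a b) L ∧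
      QuadPDE.linSpectrum 4 (QuadPDE.ksLin a b) L =
        Set.range (fun k : ℤ =>
          -a * (2 * Real.pi * k / L) ^ 2 + b * (2 * Real.pi * k / L) ^ 4) ∧
      QuadPDE.IsGap (fun k : ℤ =>
          -a * (2 * Real.pi * k / L) ^ 2 + b * (2 * Real.pi * k / L) ^ 4)
        (a * (2 * Real.pi / L) ^ 2 - b * (2 * Real.pi / L) ^ 4) ∧
      QuadPDE.muParam C 4 (QuadPDE.ksQuad c) L = C * |c| / L ∧
      (∀ y₀ : ℝ,
        QuadPDE.stabR 0 (C * |c| / L)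
            (a * (2 * Real.pi / L) ^ 2 - b * (2 * Real.pi / L) ^ 4) y₀ =
          |c| * C * y₀ / (L * (a * (2 * Real.pi / L) ^ 2 - b * (2 * Real.pi / L) ^ 4)) ∧
        QuadPDE.stabRstar (C * |c| / L)
            (a * (2 * Real.pi / L) ^ 2 - b * (2 * Real.pi / L) ^ 4) y₀ =
          2 * |c| * C * y₀ / (L * (a * (2 * Real.pi / L) ^ 2 - b * (2 * Real.pi / L) ^ 4))) ∧
      ∀ u : ℝ → ℝ → ℝ,
        QuadPDE.IsSolution 4 (QuadPDE.ksLin a b) (QuadPDE.ksQuad c) L (fun _ _ => 0) u →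
        |c| * C * QuadPDE.h2norm (u 0)
          / (L * (a * (2 * Real.pi / L) ^ 2 - b * (2 * Real.pi / L) ^ 4)) < 1 →
        2 * |c| * C * QuadPDE.h2norm (u 0)
          / (L * (a * (2 * Real.pi / L) ^ 2 - b * (2 * Real.pi / L) ^ 4)) < 1 →
        QuadPDE.IsTrajectoryAsympStable 4 (QuadPDE.ksLin a b) (QuadPDE.ksQuad c) L
          (fun _ _ => 0) u) := by
  have hpi := Real.pi_pos
  refine ⟨QuadPDE.isAlgebraConstant_seven (by norm_num), fun C L hC hL => ⟨?_, ?_, ?_⟩⟩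
  · intro ν hν
    have hsp := QuadPDE.kpp_spectral (r₁ := 0) (s₀ := 1) hL hν one_pos
    have hgap := QuadPDE.isGap_kpp (r₁ := 0) hL hν le_rfl
    simp only [zero_sub, sub_zero, ← neg_mul] at hsp hgap
    rw [QuadPDE.burgersLin_eq_kppLin]
    refine ⟨hsp.1, hsp.2, hgap, QuadPDE.muParam_burgers C L, fun fmax y₀ hy =>
      ⟨QuadPDE.burgers_stabR_lt_one_iff hL hν hy, QuadPDE.burgers_stabRstar_lt_one_iff hL hν, ?_⟩, ?_⟩
    · rw [lt_div_iff₀ hL]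
      refine iff_of_eq (congrArg (· < _) ?_)
      ring
    · intro f u fmax hf hu hy h1 h2
      rw [← QuadPDE.burgers_stabR_lt_one_iff hL hν hy, QuadPDE.stabR,
        div_lt_one (mul_pos hgap.1 hy)] at h1
      rw [← QuadPDE.burgers_stabRstar_lt_one_iff hL hν, QuadPDE.stabRstar,
        div_lt_one hgap.1] at h2
      have hD := QuadPDE.isDissipative_burgers (ν := ν) hL hC.one_le
      rw [QuadPDE.burgersLin_eq_kppLin] at hD
      exact hD.stable_of_forcing le_rfl (div_nonneg (zero_le_one.trans hC.one_le) hL.le)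
        hu hf h1 h2
  · intro D r₁ r₂ hD hr
    have hsp := QuadPDE.kpp_spectral (s₀ := 0) hL hD hr
    have hgap := QuadPDE.isGap_kpp hL hD hr.le
    refine ⟨hsp.1, hsp.2, hgap, QuadPDE.muParam_kpp C L r₂, fun y₀ => ⟨?_, ?_⟩, ?_⟩
    · rcases eq_or_ne y₀ 0 with rfl | hy
      · simp [QuadPDE.stabR]
      · have := hgap.1.ne'
        unfold QuadPDE.stabR
        field_simp
        ring
    · unfold QuadPDE.stabRstar
      ring
    · intro u hu _ h2
      rw [div_lt_one hgap.1] at h2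
      refine (QuadPDE.isDissipative_kpp hL hC.one_le hD).stable_of_unforced le_rfl
        (mul_nonneg (zero_le_one.trans hC.one_le) (abs_nonneg _)) hu ?_
      linarith
  · intro a b c hb hab
    have hgap := QuadPDE.isGap_ks hL hb hab
    -- The value 1 is no eigenvalue: the mode `k = 0` has eigenvalue 0 and all others are at most
    -- `-β < 0`.
    have hsp := QuadPDE.ks_spectral (p := a) (s₀ := 1) hL hb (fun k => by
      rcases eq_or_ne k 0 with rfl | hk
      · simp
      · have h1 := hgap.2.2 ⟨k, hk, rfl⟩
        have h2 := hgap.1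
        simp only at h1
        linarith)
    have hβ := hgap.1
    refine ⟨hsp.1, hsp.2, hgap, QuadPDE.muParam_ks C L c, fun y₀ => ⟨?_, ?_⟩, ?_⟩
    · unfold QuadPDE.stabR
      generalize a * (2 * Real.pi / L) ^ 2 - b * (2 * Real.pi / L) ^ 4 = β at hβ ⊢
      rcases eq_or_ne y₀ 0 with rfl | hy
      · simp
      · field_simp
        ring
    · unfold QuadPDE.stabRstar
      generalize a * (2 * Real.pi / L) ^ 2 - b * (2 * Real.pi / L) ^ 4 = β at hβ ⊢
      field_simp
    · intro u hu _ h2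
      rw [div_lt_one (mul_pos hL hβ)] at h2
      refine (QuadPDE.isDissipative_ks hL hC.one_le hb).stable_of_unforced (by norm_num)
        (div_nonneg (mul_nonneg (zero_le_one.trans hC.one_le) (abs_nonneg _)) hL.le) hu ?_
      have e : 2 * (C * |c| / L) * QuadPDE.h2norm (u 0) =
          2 * |c| * C * QuadPDE.h2norm (u 0) / L := by ring
      rw [e, div_lt_iff₀ hL]
      linarith
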